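/- **Setting.** Let $\Bbbk=\mathbb R$ or $\mathbb C$, let $U\subseteq\mathbb R^d$ be open with coordinates $(x^i)$, let $C^\infty(U)$ be the algebra of smooth $\Bbbk$-valued functions on $U$, and write one-forms as $A=A_i\,dx^i\in\Omega^1(U)$. Let $\theta=\tfrac12\theta^{ij}(x)\,\partial_i\wedge\partial_j$ be a Poisson structure on $U$, with bracket $\{f,g\}_\theta=\theta^{ij}\,\partial_if\,\partial_jg$, and put $\{A,f\}_\theta=\{A_i,f\}_\theta\,dx^i$. Let $(x^i,p_i)$ be the coordinates of $\pi:T^*U\to U$ and $\tilde\partial^i=\partial/\partial p_i$; let $C^\infty_{\rm pol}(T^*U)$ be the smooth functions on $T^*U$ that are polynomial in $p$, and let $t$ be a formal parameter. A *symplectic embedding* of $(U,\theta)$ is a closed formal two-form $\omega$ on $T^*U$ with coefficients in $C^\infty_{\rm pol}(T^*U)[[t]]$ such that $\omega|_{t=0}=dp_i\wedge dx^i$, such that $\{\pi^*f,\pi^*g\}_{\omega^{-1}}|_{p=0}=t\,\{f,g\}_\theta$ for all $f,g\in C^\infty(U)$, and such that the zero section is Lagrangian. Here $\omega^{-1}$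 is the inverse bivector, normalized by $\{x^i,p_j\}_{\omega^{-1}}|_{t=0}=\delta^i_j$. It is a *local symplectic embedding of the Poisson structure* $\theta$ if moreover $$\{x^i,x^j\}_{\omega^{-1}}=t\,\theta^{ij}(x),\qquad \{x^i,p_j\}_{\omega^{-1}}=\delta^i_j+t\,\gamma^i_j(x,p),\qquad \{p_i,p_j\}_{\omega^{-1}}=0,$$ with $\gamma^j_i(x,p)=\sum_{n\ge1}t^{n-1}\gamma_i^{j|i_1\cdots i_n}(x)\,p_{i_1}\cdots p_{i_n}$, where $\gamma_i^{j|i_1\cdots i_n}\in C^\infty(U)$ is symmetric in $i_1,\dots,i_n$. Put $\gamma^{(n)}(\alpha,A^{\otimes n})=n!\,\gamma_i^{j|i_1\cdots i_n}\,\alpha_j\,A_{i_1}\cdots A_{i_n}\,dx^i$ for $\alpha,A\in\Omega^1(U)$. The *Poisson gauge algebroid* is the action algebroid over $\Omega^1(U)$ of the Lie algebra $(C^\infty(U),\{\cdot,\cdot\}_\theta)$ with anchor given by the gauge variations $$\delta^\theta_fA=s_A^*\{\pi^*f,\,p_i-\pi^*A_i\}_{\omega^{-1}}\,dx^i\in\Omega^1(U)[[t]],\qquad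 s_A(x)=(x,A(x)).$$ Let $V=C^\infty(U)\oplus\Omega^1(U)$ with $C^\infty(U)$ in degree $0$ and $\Omega^1(U)$ in degree $1$. A (flat) $L_\infty$-structure on $V$ consists of $\Bbbk$-multilinear graded skew-symmetric maps $\ell_n:V^{\otimes n}\to V$ of degree $2-n$, $n\ge1$, satisfying for all $n\ge1$ and homogeneous $v_1,\dots,v_n$ the homotopy Jacobi identities $$\sum_{k=1}^n\frac{(-1)^{k(n-k)}}{k!\,(n-k)!}\sum_{\sigma\in S_n}{\rm sgn}(\sigma)\,\varepsilon(\sigma;v)\;\ell_{n-k+1}\big(\ell_k(v_{\sigma(1)},\dots,v_{\sigma(k)}),v_{\sigma(k+1)},\dots,v_{\sigma(n)}\big)=0,$$ where $\varepsilon(\sigma;v)$ is the Koszul sign. It *induces the Poisson gauge algebroid* if, for all $f,g\in C^\infty(U)$ and $A\in\Omega^1(U)$, $$\sum_{n\ge0}\frac{t^n}{n!}(-1)^{\frac{n(n-1)}2}\,\ell_{n+1}(f,A^{\otimes n})=\delta^\theta_fA,\qquad -\sum_{n\ge0}\frac{t^n}{n!}(-1)^{\frac{n(n-1)}2}\,\ell_{n+2}(f,g,A^{\otimes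 n})=\{f,g\}_\theta .$$ **Proposition.** Let $\omega$ be a local symplectic embedding of a Poisson structure $\theta$ on $U$. Then there is an $L_\infty$-structure $(\ell^\theta_n)_{n\ge1}$ on $C^\infty(U)\oplus\Omega^1(U)$ which induces the Poisson gauge algebroid. It satisfies, for all $f,g\in C^\infty(U)$ and $A\in\Omega^1(U)$, $$\ell_1^\theta(f)=df,\qquad \ell^\theta_2(f,g)=-\{f,g\}_\theta,\qquad \ell^\theta_2(f,A)=\{A,f\}_\theta+\gamma^{(1)}(df,A),$$ $$\ell^\theta_{n+1}(f,A^{\otimes n})=(-1)^{\frac{n(n-1)}2}\,\gamma^{(n)}(df,A^{\otimes n})\quad(n\ge2),\qquad \ell^\theta_{n+2}(f,g,A^{\otimes n})=0\quad(n\ge1).$$ It is unique up to $L_\infty$-quasi-isomorphism: for every $L_\infty$-structure $\ell'$ on $C^\infty(U)\oplus\Omega^1(U)$ that induces the Poisson gauge algebroid there is an $L_\infty$-quasi-isomorphism from $\ell'$ to $\ell^\theta$. -/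

import Mathlib

noncomputable section

/-! ## L-infinity algebras and their quasi-isomorphisms -/

namespace LInfty

/-- The Koszul sign `ε(σ; v)` of the rearrangement
`v 0 ⊗ ⋯ ⊗ v (n-1) ↦ v (σ 0) ⊗ ⋯ ⊗ v (σ (n-1))` of homogeneous elements of degrees `d i`:
every pair of elements whose order is reversed contributes `(-1)^(product of the degrees)`. -/
def koszulSign {n : ℕ} (σ : Equiv.Perm (Fin n)) (d : Fin n → ℤ) : ℤˣ :=
  ∏ q : Fin n × Fin n,
    if q.1 < q.2 ∧ σ q.2 < σ q.1 then (d (σ q.1) * d (σ q.2)).negOnePow else 1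

/-- The first `k` of `n` arguments. -/
def headArgs {α : Type*} {n : ℕ} (k : ℕ) (hk : k ≤ n) (v : Fin n → α) : Fin k → α :=
  fun i => v (Fin.castLE hk i)

/-- The last `n - k` of `n` arguments. -/
def tailArgs {α : Type*} {n : ℕ} (k : ℕ) (v : Fin n → α) : Fin (n - k) → α :=
  fun i => v ⟨k + i, by omega⟩

variable {𝕜 : Type*} [Field 𝕜] [CharZero 𝕜]
variable {W : Type*} [AddCommGroup W] [Module 𝕜 W]
variable {W' : Type*} [AddCommGroup W'] [Module 𝕜 W']

/-- `F` has degree `e` with respect to the gradings `𝒱` and `𝒱'`. -/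
def IsOfDegree (𝒱 : ℤ → Submodule 𝕜 W) (𝒱' : ℤ → Submodule 𝕜 W') {n : ℕ}
    (F : MultilinearMap 𝕜 (fun _ : Fin n => W) W') (e : ℤ) : Prop :=
  ∀ (d : Fin n → ℤ) (v : Fin n → W), (∀ i, v i ∈ 𝒱 (d i)) → F v ∈ 𝒱' ((∑ i, d i) + e)

/-- Graded skew-symmetry:
`F (…, vᵢ, vᵢ₊₁, …) = -(-1)^(|vᵢ| |vᵢ₊₁|) F (…, vᵢ₊₁, vᵢ, …)`. -/
def IsGradedSkew (𝒱 : ℤ → Submodule 𝕜 W) {n : ℕ}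
    (F : MultilinearMap 𝕜 (fun _ : Fin n => W) W') : Prop :=
  ∀ (d : Fin n → ℤ) (v : Fin n → W), (∀ i, v i ∈ 𝒱 (d i)) →
    ∀ i j : Fin n, (i : ℕ) + 1 = j →
      F v = -((d i * d j).negOnePow • F (v ∘ Equiv.swap i j))

/-- The homotopy Jacobi expression `𝒥ₙ(v₁, …, vₙ)`, evaluated on homogeneous elements `v i`
of degrees `d i`:
`∑ₖ (-1)^(k(n-k)) / (k! (n-k)!) ∑_σ sgn(σ) ε(σ; v) ℓₙ₋ₖ₊₁(ℓₖ(v_σ(1), …, v_σ(k)), v_σ(k+1), …, v_σ(n))`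
where `k` runs from `1` to `n` (it is `k + 1` in the code) and `σ` over all permutations. -/
def jacobiator (l : (n : ℕ) → MultilinearMap 𝕜 (fun _ : Fin n => W) W) {n : ℕ}
    (d : Fin n → ℤ) (v : Fin n → W) : W :=
  ∑ k : Fin n,
    ((-1 : 𝕜) ^ ((k + 1 : ℕ) * (n - (k + 1))) / ((Nat.factorial (k + 1) : 𝕜) * (Nat.factorial (n - (k + 1)) : 𝕜))) •
      ∑ σ : Equiv.Perm (Fin n), (Equiv.Perm.sign σ * koszulSign σ d) •
        l (n - (k + 1) + 1)
          (Fin.cons (l (k + 1) (headArgs (k + 1) k.isLt (v ∘ σ))) (tailArgs (k + 1) (v ∘ σ)))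

end LInfty

open LInfty in
/-- A (flat) L-infinity structure on the graded vector space `W = ⨁ 𝒱 i`. -/
structure LInftyStructure {𝕜 : Type*} [Field 𝕜] [CharZero 𝕜] {W : Type*} [AddCommGroup W]
    [Module 𝕜 W] (𝒱 : ℤ → Submodule 𝕜 W) where
  /-- The brackets `ℓₙ`. -/
  bracket : (n : ℕ) → MultilinearMap 𝕜 (fun _ : Fin n => W) W
  flat : bracket 0 = 0
  degree : ∀ n : ℕ, IsOfDegree 𝒱 𝒱 (bracket n) (2 - n)
  skew : ∀ n : ℕ, IsGradedSkew 𝒱 (bracket n)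
  jacobi : ∀ (n : ℕ) (d : Fin n → ℤ) (v : Fin n → W), (∀ i, v i ∈ 𝒱 (d i)) →
    jacobiator bracket d v = 0

namespace LInfty

variable {𝕜 : Type*} [Field 𝕜] [CharZero 𝕜]
variable {W : Type*} [AddCommGroup W] [Module 𝕜 W]
variable {W' : Type*} [AddCommGroup W'] [Module 𝕜 W']

/-- Décalage: the value on `s v₁, …, s vₙ` of the graded symmetric map on the shifted space
(where `|s v| = |v| - 1`) corresponding to the graded skew-symmetric map `F`, which is
`(-1)^(∑ᵢ (n-i) |vᵢ|) F(v₁, …, vₙ)` for homogeneous `vᵢ` of degrees `d i`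
(the sign of moving `n` copies of `s` to their places). With these signs the homotopy Jacobi
identities say that the shifted brackets form a square-zero coderivation of the cofree
cocommutative coalgebra on the shifted space. -/
def decalage {n : ℕ} (F : MultilinearMap 𝕜 (fun _ : Fin n => W) W') (d : Fin n → ℤ)
    (v : Fin n → W) : W' :=
  (∑ i : Fin n, ((n : ℤ) - 1 - (i : ℕ)) * d i).negOnePow • F v

/-- The components `φₙ` of a coalgebra morphism composed with the coderivation of the source:
`∑ₖ ∑_σ ε φₙ₋ₖ₊₁(ℓₖ(v_σ(1), …, v_σ(k)), v_σ(k+1), …, v_σ(n))`, in shifted form, the sum over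
unshuffles being written as a sum over all permutations divided by `k! (n-k)!`. -/
def morphismSource (l : (n : ℕ) → MultilinearMap 𝕜 (fun _ : Fin n => W) W)
    (φ : (n : ℕ) → MultilinearMap 𝕜 (fun _ : Fin n => W) W') {n : ℕ}
    (d : Fin n → ℤ) (v : Fin n → W) : W' :=
  ∑ k : Fin n, ((1 : 𝕜) / ((Nat.factorial (k + 1) : 𝕜) * (Nat.factorial (n - (k + 1)) : 𝕜))) •
    ∑ σ : Equiv.Perm (Fin n), koszulSign σ (fun i => d i - 1) •
      decalage (φ (n - (k + 1) + 1))
        (Fin.cons ((∑ i, headArgs (k + 1) k.isLt (d ∘ σ) i) + (2 - ((k + 1 : ℕ) : ℤ)))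
          (tailArgs (k + 1) (d ∘ σ)))
        (Fin.cons (decalage (l (k + 1)) (headArgs (k + 1) k.isLt (d ∘ σ))
            (headArgs (k + 1) k.isLt (v ∘ σ)))
          (tailArgs (k + 1) (v ∘ σ)))

/-- The coderivation of the target composed with a coalgebra morphism with components `φₙ`:
`∑ᵣ 1/r! ∑_{i₁+⋯+iᵣ=n} ∑_σ ε ℓ'ᵣ(φ_{i₁}(v_σ(1), …), …, φ_{iᵣ}(…, v_σ(n)))`, in shifted form, the
sum over unshuffles being written as a sum over all permutations divided by `i₁! ⋯ iᵣ!`. -/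
def morphismTarget (l' : (n : ℕ) → MultilinearMap 𝕜 (fun _ : Fin n => W') W')
    (φ : (n : ℕ) → MultilinearMap 𝕜 (fun _ : Fin n => W) W') {n : ℕ}
    (d : Fin n → ℤ) (v : Fin n → W) : W' :=
  ∑ c : Composition n, ((1 : 𝕜) / ((Nat.factorial c.length : 𝕜) * ∏ j, (Nat.factorial (c.blocksFun j) : 𝕜))) •
    ∑ σ : Equiv.Perm (Fin n), koszulSign σ (fun i => d i - 1) •
      decalage (l' c.length)
        (fun j => (∑ i, d (σ (c.embedding j i))) + (1 - (c.blocksFun j : ℤ)))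
        (fun j => decalage (φ (c.blocksFun j)) (fun i => d (σ (c.embedding j i)))
          (fun i => v (σ (c.embedding j i))))

end LInfty

open LInfty in
/-- An L-infinity morphism between two L-infinity algebras. -/
structure LInftyMorphism {𝕜 : Type*} [Field 𝕜] [CharZero 𝕜]
    {W : Type*} [AddCommGroup W] [Module 𝕜 W] {W' : Type*} [AddCommGroup W'] [Module 𝕜 W']
    {𝒱 : ℤ → Submodule 𝕜 W} {𝒱' : ℤ → Submodule 𝕜 W'}
    (L : LInftyStructure 𝒱) (L' : LInftyStructure 𝒱') where
  /-- The components `φₙ`. -/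
  map : (n : ℕ) → MultilinearMap 𝕜 (fun _ : Fin n => W) W'
  map_zero : map 0 = 0
  degree : ∀ n : ℕ, IsOfDegree 𝒱 𝒱' (map n) (1 - n)
  skew : ∀ n : ℕ, IsGradedSkew 𝒱 (map n)
  compat : ∀ (n : ℕ) (d : Fin n → ℤ) (v : Fin n → W), (∀ i, v i ∈ 𝒱 (d i)) →
    morphismSource L.bracket map d v = morphismTarget L'.bracket map d v

/-- An L-infinity morphism is a quasi-isomorphism if its linear component `φ₁` induces an
isomorphism (first injectivity, then surjectivity) from the cohomology of `ℓ₁` to that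
of `ℓ'₁`, in every degree. -/
def LInftyMorphism.IsQuasiIso {𝕜 : Type*} [Field 𝕜] [CharZero 𝕜]
    {W : Type*} [AddCommGroup W] [Module 𝕜 W] {W' : Type*} [AddCommGroup W'] [Module 𝕜 W']
    {𝒱 : ℤ → Submodule 𝕜 W} {𝒱' : ℤ → Submodule 𝕜 W'}
    {L : LInftyStructure 𝒱} {L' : LInftyStructure 𝒱'} (φ : LInftyMorphism L L') : Prop :=
  (∀ i : ℤ, ∀ v ∈ 𝒱 i, L.bracket 1 ![v] = 0 →
    (∃ w ∈ 𝒱' (i - 1), φ.map 1 ![v] = L'.bracket 1 ![w]) →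
      ∃ u ∈ 𝒱 (i - 1), v = L.bracket 1 ![u]) ∧
  (∀ i : ℤ, ∀ w ∈ 𝒱' i, L'.bracket 1 ![w] = 0 →
    ∃ v ∈ 𝒱 i, L.bracket 1 ![v] = 0 ∧
      ∃ u ∈ 𝒱' (i - 1), w - φ.map 1 ![v] = L'.bracket 1 ![u])

/-! ## Smooth functions and one-forms on an open subset of `ℝᵈ` -/

namespace PoissonGauge

/-- Extension by zero of a function on `U` to `ℝᵈ`. -/
def zeroExtend {d : ℕ} {𝕜 : Type*} [RCLike 𝕜] {U : TopologicalSpace.Opens (Fin d → ℝ)}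
    (f : U → 𝕜) : (Fin d → ℝ) → 𝕜 :=
  Function.extend Subtype.val f 0

section

variable {d : ℕ} {𝕜 : Type*} [RCLike 𝕜] {U : TopologicalSpace.Opens (Fin d → ℝ)}

theorem zeroExtend_apply (f : U → 𝕜) (x : U) : zeroExtend f (x : Fin d → ℝ) = f x :=
  Subtype.val_injective.extend_apply f 0 x

theorem zeroExtend_eqOn {f : U → 𝕜} {g : (Fin d → ℝ) → 𝕜} (h : ∀ x : U, f x = g x) :
    Set.EqOn (zeroExtend f) g (U : Set (Fin d → ℝ)) := fun x hx => by
  rw [zeroExtend_apply f ⟨x, hx⟩, h]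

end

/-- `C^∞(U)`: the algebra of smooth `𝕜`-valued functions on the open set `U ⊆ ℝᵈ`. -/
def smoothFunctions {d : ℕ} (𝕜 : Type*) [RCLike 𝕜] (U : TopologicalSpace.Opens (Fin d → ℝ)) :
    Subalgebra 𝕜 (U → 𝕜) where
  carrier := {f | ContDiffOn ℝ ((⊤ : ℕ∞) : WithTop ℕ∞) (zeroExtend f) (U : Set (Fin d → ℝ))}
  mul_mem' {f g} hf hg := (ContDiffOn.mul hf hg).congr
    (zeroExtend_eqOn fun x => by simp [zeroExtend_apply])
  add_mem' {f g} hf hg := (ContDiffOn.add hf hg).congr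
    (zeroExtend_eqOn fun x => by simp [zeroExtend_apply])
  algebraMap_mem' c := (contDiffOn_const (c := c)).congr
    (zeroExtend_eqOn fun x => by simp)

section

variable {d : ℕ} {𝕜 : Type*} [RCLike 𝕜] {U : TopologicalSpace.Opens (Fin d → ℝ)}

theorem differentiableAt_zeroExtend (f : smoothFunctions 𝕜 U) (x : U) :
    DifferentiableAt ℝ (zeroExtend (f : U → 𝕜)) (x : Fin d → ℝ) :=
  (f.2.contDiffAt (U.isOpen.mem_nhds x.2)).differentiableAt (by simp)

theorem fderiv_zeroExtend {f : U → 𝕜} {g : (Fin d → ℝ) → 𝕜} (h : ∀ x : U, f x = g x) (x : U) :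
    fderiv ℝ (zeroExtend f) (x : Fin d → ℝ) = fderiv ℝ g x :=
  Filter.EventuallyEq.fderiv_eq
    ((zeroExtend_eqOn h).eventuallyEq_of_mem (U.isOpen.mem_nhds x.2))

end

/-- The partial derivative `∂ᵢ = ∂/∂xⁱ` as a derivation of the algebra `smoothFunctions 𝕜 U`. -/
def partialDerivationAux {d : ℕ} (𝕜 : Type*) [RCLike 𝕜] (U : TopologicalSpace.Opens (Fin d → ℝ))
    (i : Fin d) : Derivation 𝕜 (smoothFunctions 𝕜 U) (smoothFunctions 𝕜 U) :=
  Derivation.mk'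
    { toFun := fun f =>
        ⟨fun x => fderiv ℝ (zeroExtend (f : U → 𝕜)) (x : Fin d → ℝ) (Pi.single i 1), by
          have h : ContDiffOn ℝ ((⊤ : ℕ∞) : WithTop ℕ∞)
              (fun y => fderiv ℝ (zeroExtend (f : U → 𝕜)) y (Pi.single i 1))
              (U : Set (Fin d → ℝ)) :=
            (f.2.fderiv_of_isOpen U.isOpen (by simp)).clm_apply contDiffOn_const
          exact h.congr (zeroExtend_eqOn fun x => rfl)⟩
      map_add' := fun f g => by
        refine Subtype.ext (funext fun x => ?_)
        have := fderiv_zeroExtend (f := ((f + g : smoothFunctions 𝕜 U) : U → 𝕜))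
          (g := zeroExtend (f : U → 𝕜) + zeroExtend (g : U → 𝕜))
          (fun x => by simp [zeroExtend_apply]) x
        rw [fderiv_add (differentiableAt_zeroExtend f x) (differentiableAt_zeroExtend g x)] at this
        exact congrArg (fun T => T (Pi.single i 1)) this
      map_smul' := fun c f => by
        refine Subtype.ext (funext fun x => ?_)
        have := fderiv_zeroExtend (f := ((c • f : smoothFunctions 𝕜 U) : U → 𝕜))
          (g := fun y => c * zeroExtend (f : U → 𝕜) y)
          (fun x => by simp [zeroExtend_apply]) x
        rw [fderiv_const_mul (differentiableAt_zeroExtend f x) c] at this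
        exact congrArg (fun T => T (Pi.single i 1)) this }
    (fun f g => by
      refine Subtype.ext (funext fun x => ?_)
      have := fderiv_zeroExtend (f := ((f * g : smoothFunctions 𝕜 U) : U → 𝕜))
        (g := zeroExtend (f : U → 𝕜) * zeroExtend (g : U → 𝕜))
        (fun x => by simp [zeroExtend_apply]) x
      rw [fderiv_mul (differentiableAt_zeroExtend f x) (differentiableAt_zeroExtend g x),
        zeroExtend_apply, zeroExtend_apply] at this
      exact congrArg (fun T => T (Pi.single i 1)) this)

/-- `C^∞(U)` as a type. -/
def SmoothFunction {d : ℕ} (𝕜 : Type*) [RCLike 𝕜] (U : TopologicalSpace.Opens (Fin d → ℝ)) :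
    Type _ :=
  smoothFunctions 𝕜 U

instance {d : ℕ} (𝕜 : Type*) [RCLike 𝕜] (U : TopologicalSpace.Opens (Fin d → ℝ)) :
    CommRing (SmoothFunction 𝕜 U) :=
  inferInstanceAs (CommRing (smoothFunctions 𝕜 U))

instance {d : ℕ} (𝕜 : Type*) [RCLike 𝕜] (U : TopologicalSpace.Opens (Fin d → ℝ)) :
    Algebra 𝕜 (SmoothFunction 𝕜 U) :=
  inferInstanceAs (Algebra 𝕜 (smoothFunctions 𝕜 U))

/-- The partial derivative `∂ᵢ = ∂/∂xⁱ` as a derivation of `C^∞(U)`. -/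
def partialDerivation {d : ℕ} (𝕜 : Type*) [RCLike 𝕜] (U : TopologicalSpace.Opens (Fin d → ℝ))
    (i : Fin d) : Derivation 𝕜 (SmoothFunction 𝕜 U) (SmoothFunction 𝕜 U) :=
  partialDerivationAux 𝕜 U i

/-- The partial derivative `∂ᵢf` of a smooth function on `U`. -/
def partialDeriv {d : ℕ} {𝕜 : Type*} [RCLike 𝕜] {U : TopologicalSpace.Opens (Fin d → ℝ)}
    (i : Fin d) : SmoothFunction 𝕜 U → SmoothFunction 𝕜 U :=
  partialDerivation 𝕜 U i

section

variable {d : ℕ} (𝕜 : Type*) [RCLike 𝕜] (U : TopologicalSpace.Opens (Fin d → ℝ))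

/-- `Ω¹(U)`: the one-form `A = Aᵢ dxⁱ` is given by its components `Aᵢ ∈ C^∞(U)`. -/
abbrev OneForm : Type _ := Fin d → SmoothFunction 𝕜 U

/-- The vector space `V = C^∞(U) ⊕ Ω¹(U)`. -/
abbrev GaugeSpace : Type _ := SmoothFunction 𝕜 U × OneForm 𝕜 U

/-- The grading of `V` by form degree: `C^∞(U)` in degree `0` and `Ω¹(U)` in degree `1`. -/
def formGrading (n : ℤ) : Submodule 𝕜 (GaugeSpace 𝕜 U) :=
  if n = 0 then LinearMap.range (LinearMap.inl 𝕜 (SmoothFunction 𝕜 U) (OneForm 𝕜 U))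
  else if n = 1 then LinearMap.range (LinearMap.inr 𝕜 (SmoothFunction 𝕜 U) (OneForm 𝕜 U))
  else ⊥

theorem isInternal_formGrading : DirectSum.IsInternal (formGrading 𝕜 U) := by
  classical
  rw [DirectSum.isInternal_submodule_iff_iSupIndep_and_iSup_eq_top]
  constructor
  · intro n
    rw [Submodule.disjoint_def]
    intro x hx hx'
    have key : (⨆ j, ⨆ (_ : j ≠ n), formGrading 𝕜 U j) ≤
        if n = 0 then LinearMap.range (LinearMap.inr 𝕜 (SmoothFunction 𝕜 U) (OneForm 𝕜 U))
        else if n = 1 then LinearMap.range (LinearMap.inl 𝕜 (SmoothFunction 𝕜 U) (OneForm 𝕜 U))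
        else ⊤ := by
      refine iSup_le fun j => iSup_le fun hj => ?_
      unfold formGrading
      split_ifs <;> simp_all
    have hx2 := key hx'
    unfold formGrading at hx
    split_ifs at hx hx2 with h0 h1
    · obtain ⟨a, rfl⟩ := hx
      obtain ⟨b, hb⟩ := hx2
      simp [Prod.ext_iff] at hb ⊢
      exact hb.1.symm
    · obtain ⟨a, rfl⟩ := hx
      obtain ⟨b, hb⟩ := hx2
      simp [Prod.ext_iff] at hb ⊢
      exact hb.2.symm
    · simpa using hx
  · rw [eq_top_iff]
    rintro ⟨f, A⟩ -
    have h0 : ((f, 0) : GaugeSpace 𝕜 U) ∈ ⨆ i, formGrading 𝕜 U i :=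
      Submodule.mem_iSup_of_mem 0 ⟨f, rfl⟩
    have h1 : ((0, A) : GaugeSpace 𝕜 U) ∈ ⨆ i, formGrading 𝕜 U i :=
      Submodule.mem_iSup_of_mem 1 ⟨A, rfl⟩
    simpa using add_mem h0 h1

/-- Smooth functions on `T*U` that are polynomial on the fibres: polynomials in the fibre
coordinates `pᵢ` with coefficients in `C^∞(U)`. -/
abbrev PolFunction : Type _ := MvPolynomial (Fin d) (SmoothFunction 𝕜 U)

/-- The ring `C^∞_pol(T*U)[[t]]`; the formal parameter `t` is `PowerSeries.X`. -/
abbrev FormalFunction : Type _ := PowerSeries (PolFunction 𝕜 U)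

/-- Matrices over `C^∞_pol(T*U)[[t]]` indexed by the coordinates `xⁱ` (`Sum.inl i`) and
`pᵢ` (`Sum.inr i`) of `T*U`: the components of formal two-tensor fields on `T*U`. -/
abbrev FormalTensor : Type _ := Matrix (Fin d ⊕ Fin d) (Fin d ⊕ Fin d) (FormalFunction 𝕜 U)

end

section

variable {d : ℕ} {𝕜 : Type*} [RCLike 𝕜] {U : TopologicalSpace.Opens (Fin d → ℝ)}

/-- The exterior derivative `C^∞(U) → Ω¹(U)`. -/
def dForm (f : SmoothFunction 𝕜 U) : OneForm 𝕜 U := fun i => partialDeriv i f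

/-- The bracket `{f, g}_θ = θ^{ij} ∂ᵢf ∂ⱼg`. -/
def poissonBracket (θ : Matrix (Fin d) (Fin d) (SmoothFunction 𝕜 U))
    (f g : SmoothFunction 𝕜 U) : SmoothFunction 𝕜 U :=
  ∑ i, ∑ j, θ i j * partialDeriv i f * partialDeriv j g

/-- The bivector field `θ = ½ θ^{ij} ∂ᵢ ∧ ∂ⱼ` is a Poisson structure on `U`. -/
structure IsPoisson (θ : Matrix (Fin d) (Fin d) (SmoothFunction 𝕜 U)) : Prop where
  skew : ∀ i j, θ i j = -θ j i
  jacobi : ∀ f g h : SmoothFunction 𝕜 U,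
    poissonBracket θ f (poissonBracket θ g h) + poissonBracket θ g (poissonBracket θ h f)
      + poissonBracket θ h (poissonBracket θ f g) = 0

/-- The bracket `{A, f}_θ` of a one-form with a function. Since `{f, A}_θ = θ^{ij} ∂ᵢf L_{∂ⱼ}A`
and `{A, f}_θ = -{f, A}_θ`, its components are `{Aᵢ, f}_θ`. -/
def formBracket (θ : Matrix (Fin d) (Fin d) (SmoothFunction 𝕜 U))
    (A : OneForm 𝕜 U) (f : SmoothFunction 𝕜 U) : OneForm 𝕜 U :=
  fun i => -∑ k, ∑ j, θ k j * partialDeriv k f * partialDeriv j (A i)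

/-! ## Formal symplectic embeddings -/

/-- The derivative `∂ᵢ` of a fibrewise polynomial function in the base direction `xⁱ`
(it acts on the coefficients). -/
def baseDeriv (i : Fin d) (F : PolFunction 𝕜 U) : PolFunction 𝕜 U :=
  ∑ m ∈ F.support, MvPolynomial.monomial m (partialDeriv i (MvPolynomial.coeff m F))

/-- The partial derivatives of formal functions on `T*U` with respect to the coordinates `xⁱ`
(`Sum.inl i`) and `pᵢ` (`Sum.inr i`). -/
def coordDeriv (a : Fin d ⊕ Fin d) (F : FormalFunction 𝕜 U) : FormalFunction 𝕜 U :=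
  PowerSeries.mk fun n => Sum.elim
    (fun i => baseDeriv i (PowerSeries.coeff n F))
    (fun i => MvPolynomial.pderiv i (PowerSeries.coeff n F)) a

/-- The pullback `π^* f` of a function along `π : T*U → U`. -/
def pullback (f : SmoothFunction 𝕜 U) : FormalFunction 𝕜 U :=
  PowerSeries.C (MvPolynomial.C f)

/-- The fibre coordinate function `pᵢ`. -/
def momentum (i : Fin d) : FormalFunction 𝕜 U := PowerSeries.C (MvPolynomial.X i)

/-- The pullback `s_A^*` of formal functions along the section `s_A : U → T*U`,
`x ↦ (x, A(x))`, given by a one-form `A`. -/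
def sectionPullback (A : OneForm 𝕜 U) : FormalFunction 𝕜 U →+* PowerSeries (SmoothFunction 𝕜 U) :=
  PowerSeries.map (MvPolynomial.eval A)

/-- The bracket `{F, G}_P = P^{ab} ∂ₐF ∂_bG` of formal functions on `T*U` defined by a
formal bivector field `P`. -/
def bivectorBracket (P : FormalTensor 𝕜 U) (F G : FormalFunction 𝕜 U) : FormalFunction 𝕜 U :=
  ∑ a, ∑ b, P a b * coordDeriv a F * coordDeriv b G

/-- The formal two-form `ω = ½ ω_{ab} dzᵃ ∧ dz^b` on `T*U` is a symplectic embedding of `(U, θ)`.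
Note that `Matrix.J` is the matrix of the canonical form `ω₀ = dpᵢ ∧ dxⁱ`, so that
`ω` is invertible by `deformation`, and the inverse of `ω₀` gives `{xⁱ, pⱼ} = δⁱⱼ`. -/
structure IsSymplecticEmbedding (θ : Matrix (Fin d) (Fin d) (SmoothFunction 𝕜 U))
    (ω : FormalTensor 𝕜 U) : Prop where
  skew : ∀ a b, ω a b = -ω b a
  closed : ∀ a b c, coordDeriv a (ω b c) + coordDeriv b (ω c a) + coordDeriv c (ω a b) = 0
  deformation : ω.map PowerSeries.constantCoeff = Matrix.J (Fin d) (PolFunction 𝕜 U)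
  restrict : ∀ f g : SmoothFunction 𝕜 U,
    sectionPullback 0 (bivectorBracket ω⁻¹ (pullback f) (pullback g))
      = PowerSeries.X * PowerSeries.C (poissonBracket θ f g)
  lagrangian : ∀ i j, sectionPullback 0 (ω (Sum.inl i) (Sum.inl j)) = 0

/-- The formal two-form `ω` is a local symplectic embedding of the Poisson structure `θ`: a
symplectic embedding with cosymplectic structure
`ω⁻¹ = ½ t θ^{ij}(x) ∂ᵢ ∧ ∂ⱼ + (δⁱⱼ + t γⁱⱼ(x,p)) ∂ᵢ ∧ ∂̃ʲ`, where
`γⁱⱼ(x,p) = ∑ₙ t^{n-1} γⱼ^{i|i₁⋯iₙ}(x) p_{i₁} ⋯ p_{iₙ}` with `n` running from `1` to infinity,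
that is, the coefficient of `t^{n-1}` is homogeneous of degree `n` in `p`.
Here `γ i j` is `γⁱⱼ`. -/
structure IsLocalSymplecticEmbedding (θ : Matrix (Fin d) (Fin d) (SmoothFunction 𝕜 U))
    (ω : FormalTensor 𝕜 U) (γ : Matrix (Fin d) (Fin d) (FormalFunction 𝕜 U)) : Prop
    extends IsSymplecticEmbedding θ ω where
  base_base : ∀ i j, ω⁻¹ (Sum.inl i) (Sum.inl j) = PowerSeries.X * pullback (θ i j)
  base_fibre : ∀ i j, ω⁻¹ (Sum.inl i) (Sum.inr j)
    = (if i = j then 1 else 0) + PowerSeries.X * γ i j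
  fibre_fibre : ∀ i j, ω⁻¹ (Sum.inr i) (Sum.inr j) = 0
  homogeneous : ∀ i j n, (PowerSeries.coeff n (γ i j)).IsHomogeneous (n + 1)

/-- The one-form `γ^{(n)}(α, A^{⊗n})` with components
`n! γᵢ^{j|i₁⋯iₙ} αⱼ A_{i₁} ⋯ A_{iₙ}`, for `n ≥ 1`. -/
def gammaTensor (γ : Matrix (Fin d) (Fin d) (FormalFunction 𝕜 U)) (n : ℕ)
    (α A : OneForm 𝕜 U) : OneForm 𝕜 U :=
  fun i => (Nat.factorial n : 𝕜) • ∑ j, α j * MvPolynomial.eval A (PowerSeries.coeff (n - 1) (γ j i))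

/-! ## The Poisson gauge algebroid and gauge algebroids of L-infinity structures -/

/-- The Poisson gauge variation `δ^θ_f A = s_A^* {π^* f, Φ_A}_{ω⁻¹} ∈ Ω¹(U)[[t]]`, in
components, where `(Φ_A)ᵢ = pᵢ - Aᵢ(x)`. -/
def poissonGaugeVariation (ω : FormalTensor 𝕜 U) (f : SmoothFunction 𝕜 U) (A : OneForm 𝕜 U) :
    Fin d → PowerSeries (SmoothFunction 𝕜 U) :=
  fun i => sectionPullback A
    (bivectorBracket ω⁻¹ (pullback f) (momentum i - pullback (A i)))

/-- The value `ℓₙ₊₁(f, A^{⊗n})`. -/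
def bracketOne (L : LInftyStructure (formGrading 𝕜 U)) (n : ℕ)
    (f : SmoothFunction 𝕜 U) (A : OneForm 𝕜 U) : GaugeSpace 𝕜 U :=
  L.bracket (n + 1) (Fin.cons (f, 0) fun _ => (0, A))

/-- The value `ℓₙ₊₂(f, g, A^{⊗n})`. -/
def bracketTwo (L : LInftyStructure (formGrading 𝕜 U)) (n : ℕ)
    (f g : SmoothFunction 𝕜 U) (A : OneForm 𝕜 U) : GaugeSpace 𝕜 U :=
  L.bracket (n + 2) (Fin.cons (f, 0) (Fin.cons (g, 0) fun _ => (0, A)))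

/-- The gauge variation `δ_f A = ∑ₙ tⁿ/n! (-1)^{n(n-1)/2} ℓₙ₊₁(f, A^{⊗n}) ∈ Ω¹(U)[[t]]`, in
components, of an L-infinity structure on `V`. -/
def gaugeVariation (L : LInftyStructure (formGrading 𝕜 U)) (f : SmoothFunction 𝕜 U)
    (A : OneForm 𝕜 U) : Fin d → PowerSeries (SmoothFunction 𝕜 U) :=
  fun i => PowerSeries.mk fun n =>
    ((-1 : 𝕜) ^ (n * (n - 1) / 2) / (Nat.factorial n : 𝕜)) • (bracketOne L n f A).2 i

/-- The closure bracket
`⟦f, g⟧(A) = -∑ₙ tⁿ/n! (-1)^{n(n-1)/2} ℓₙ₊₂(f, g, A^{⊗n}) ∈ C^∞(U)[[t]]` of an L-infinity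
structure on `V`. -/
def closureBracket (L : LInftyStructure (formGrading 𝕜 U)) (f g : SmoothFunction 𝕜 U)
    (A : OneForm 𝕜 U) : PowerSeries (SmoothFunction 𝕜 U) :=
  -PowerSeries.mk fun n =>
    ((-1 : 𝕜) ^ (n * (n - 1) / 2) / (Nat.factorial n : 𝕜)) • (bracketTwo L n f g A).1

/-- The L-infinity structure `L` induces the Poisson gauge algebroid, i.e. the action algebroid
of the Lie algebra `(C^∞(U), {·,·}_θ)` over `Ω¹(U)` with anchor `(f, A) ↦ δ^θ_f A`: its gauge
variations are the Poisson gauge variations, and its closure bracket is the Poisson bracket. -/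
def InducesPoissonGaugeAlgebroid (θ : Matrix (Fin d) (Fin d) (SmoothFunction 𝕜 U))
    (ω : FormalTensor 𝕜 U) (L : LInftyStructure (formGrading 𝕜 U)) : Prop :=
  (∀ (f : SmoothFunction 𝕜 U) (A : OneForm 𝕜 U),
    gaugeVariation L f A = poissonGaugeVariation ω f A) ∧
  (∀ (f g : SmoothFunction 𝕜 U) (A : OneForm 𝕜 U),
    closureBracket L f g A = PowerSeries.C (poissonBracket θ f g))

end

end PoissonGauge

end

/-! Expand the gauge variation in Taylor coefficients, `δ_f A = ∑ tᵐ/m! Nₘ(f)(A, …, A)`: `N₀(f) =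
df`, `N₁(f)` combines `γ^{(1)}(df, ·)` with `{·, f}_θ`, and `Nₘ(f)` polarizes `γ^{(m)}(df, ·)` for
`m ≥ 2`. Homogeneity of `γ` makes the power of `t` equal to the polynomial degree in `A`.

Existence is a general fact about a Lie algebra `(V₀, b)` acting on a vector space `V₁` by formal
vector fields: the Taylor coefficients, with suitable signs, together with `-b` are the brackets of
an L-infinity structure on `V₀ ⊕ V₁`. For degree reasons only two kinds of homotopy Jacobi identity
are not trivial. On three elements of `V₀` it is the Jacobi identity of `b` (`jacobiator_fst`). On
two elements of `V₀` and `n` of `V₁` it is the part of degree `n` of `[δ_f, δ_g] = δ_{b(f,g)}`,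
expressed by `Closes`; it is checked on equal arguments `A` (`jacobiator_word_snd`) and polarized
(`jacobiator_snd`).

The geometric input is the closure of the Poisson gauge variations (`gaugeVariation_commutator`).
Since `ω` is closed, `ω⁻¹` defines a Poisson bracket. Its Jacobi identity is applied to `π^*f`,
`π^*g` and the constraint `pᵢ - π^*Aᵢ`, and pulled back along the section `A`. There `{π^*f, ·}`
becomes `t {f, ·}_θ` plus the fibre derivative along `δ_f A` (`sectionPullback_bracket`), and
`{π^*f, π^*g} = t π^*{f, g}_θ`. Every term carries a factor `t`; cancelling it gives the commutator
formula, whose coefficients are `closes_gaugeMultilin`.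

Uniqueness is stronger than asserted. A graded skew map of degree `2 - n` on `V₀ ⊕ V₁` can be
nonzero only on words with one or two letters from `V₀`, and by polarization in characteristic zero
its values on `(f, A, …, A)` and `(f, g, A, …, A)` determine it on homogeneous elements. The gauge
algebroid prescribes these values, so any two inducing structures agree there and the identity is a
quasi-isomorphism. -/

noncomputable section

/-! ### Koszul signs, permutations and polarization. -/

namespace LInfty

open Equiv

/-- The sign counts inverted pairs weighted by degrees, and an unordered pair is inverted by `τ * σ`
exactly when one of `σ`, `τ` inverts it but not both. This cocycle identity allows sign arguments to
proceed one adjacent transposition at a time. -/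
theorem koszulSign_mul {n : ℕ} (τ σ : Perm (Fin n)) (d : Fin n → ℤ) :
    koszulSign (τ * σ) d = koszulSign τ d * koszulSign σ (d ∘ τ) := by
  let P : Finset (Fin n × Fin n) := Finset.univ.filter fun q => q.1 < q.2
  have key : ∀ (ρ : Perm (Fin n)) (e : Fin n → ℤ), koszulSign ρ e =
      ∏ q ∈ P, if ρ q.2 < ρ q.1 then (e (ρ q.1) * e (ρ q.2)).negOnePow else 1 := by
    intro ρ e
    rw [Finset.prod_filter]
    refine Finset.prod_congr rfl fun q _ => ?_
    by_cases h : q.1 < q.2 <;> simp [h]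
  -- The action of a permutation on unordered pairs, each represented by its increasing ordering; it
  -- reindexes the product for `τ` by pairs before `σ` is applied.
  let s : Perm (Fin n) → Fin n × Fin n → Fin n × Fin n := fun ρ q =>
    if ρ q.1 < ρ q.2 then (ρ q.1, ρ q.2) else (ρ q.2, ρ q.1)
  have hs : ∀ ρ : Perm (Fin n), ∀ q ∈ P, s ρ q ∈ P := by
    intro ρ q hq
    have hq' : q.1 < q.2 := by simpa [P] using hq
    have : ρ q.1 ≠ ρ q.2 := fun h => hq'.ne (ρ.injective h)
    simp only [s, P, Finset.mem_filter, Finset.mem_univ, true_and]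
    split_ifs with h
    · exact h
    · exact lt_of_le_of_ne (not_lt.mp h) this.symm
  have hinv : ∀ ρ ρ' : Perm (Fin n), (∀ x, ρ' (ρ x) = x) → ∀ q ∈ P, s ρ' (s ρ q) = q := by
    intro ρ ρ' hρ q hq
    have hq' : q.1 < q.2 := by simpa [P] using hq
    simp only [s]
    split_ifs with h h1 h1 <;> simp_all [lt_asymm]
  have re : koszulSign τ d = ∏ q ∈ P,
      if τ (s σ q).2 < τ (s σ q).1 then (d (τ (s σ q).1) * d (τ (s σ q).2)).negOnePow else 1 := by
    rw [key]
    symm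
    exact Finset.prod_nbij' (s σ) (s σ⁻¹) (hs σ) (hs σ⁻¹) (hinv σ σ⁻¹ (by simp))
      (hinv σ⁻¹ σ (by simp)) (fun _ _ => rfl)
  rw [re, key, key, ← Finset.prod_mul_distrib]
  refine Finset.prod_congr rfl fun q hq => ?_
  have hq' : q.1 < q.2 := by simpa [P] using hq
  have hne : σ q.1 ≠ σ q.2 := fun h => hq'.ne (σ.injective h)
  have hne' : τ (σ q.1) ≠ τ (σ q.2) := fun h => hne (τ.injective h)
  simp only [s, Perm.mul_apply, Function.comp]
  -- A pair inverted twice contributes the square of a sign on the right and nothing on the left.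
  rcases lt_or_gt_of_ne hne with h | h <;> rcases lt_or_gt_of_ne hne' with h' | h' <;>
    simp [h, h', h.not_gt, h'.not_gt, mul_comm, Int.units_mul_self]

theorem koszulSign_one {n : ℕ} (d : Fin n → ℤ) : koszulSign 1 d = 1 := by
  refine Finset.prod_eq_one fun q _ => if_neg ?_
  simp only [Perm.one_apply]
  exact fun h => h.1.not_gt h.2

theorem koszulSign_swap {n : ℕ} (d : Fin n → ℤ) (i j : Fin n) (hij : (i : ℕ) + 1 = j) :
    koszulSign (swap i j) d = (d i * d j).negOnePow := by
  unfold koszulSign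
  rw [Finset.prod_eq_single (i, j)]
  · have : i < j := by rw [Fin.lt_def]; omega
    simp [this, mul_comm]
  · rintro ⟨a, b⟩ - hab
    refine if_neg ?_
    rintro ⟨h1, h2⟩
    apply hab
    simp only [Fin.lt_def, swap_apply_def] at h1 h2
    ext <;> simp only <;> split_ifs at h2 <;> simp_all <;> omega
  · simp

/-- The sign `sgn(σ) ε(σ; d)` of a permutation of homogeneous elements. -/
def gradedSign {n : ℕ} (σ : Perm (Fin n)) (d : Fin n → ℤ) : ℤˣ :=
  Perm.sign σ * koszulSign σ d

theorem gradedSign_mul {n : ℕ} (τ σ : Perm (Fin n)) (d : Fin n → ℤ) :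
    gradedSign (τ * σ) d = gradedSign τ d * gradedSign σ (d ∘ τ) := by
  simp only [gradedSign, koszulSign_mul, map_mul]
  exact mul_mul_mul_comm _ _ _ _

theorem gradedSign_one {n : ℕ} (d : Fin n → ℤ) : gradedSign 1 d = 1 := by
  simp [gradedSign, koszulSign_one]

theorem gradedSign_swap {n : ℕ} (d : Fin n → ℤ) (i j : Fin n) (hij : (i : ℕ) + 1 = j) :
    gradedSign (swap i j) d = -(d i * d j).negOnePow := by
  have : i ≠ j := by rintro rfl; omega
  simp [gradedSign, koszulSign_swap d i j hij, Perm.sign_swap this]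

/-- Induction on a permutation by composition with adjacent transpositions on the right. -/
theorem perm_induction {n : ℕ} {p : Perm (Fin n) → Prop} (one : p 1)
    (mul : ∀ (σ : Perm (Fin n)) (i j : Fin n), (i : ℕ) + 1 = j → p σ → p (σ * swap i j))
    (σ : Perm (Fin n)) : p σ := by
  cases n with
  | zero => rwa [Subsingleton.elim σ 1]
  | succ n =>
    have h : σ ∈ Submonoid.closure
        (Set.range fun i : Fin n => swap i.castSucc i.succ) := by
      rw [Perm.mclosure_swap_castSucc_succ]; trivial
    induction h using Submonoid.closure_induction_right with
    | one => exact one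
    | mul_right x _ y hy ih =>
      obtain ⟨i, rfl⟩ := hy
      exact mul _ _ _ (by simp) ih

variable {𝕜 : Type*} [Field 𝕜]
variable {W : Type*} [AddCommGroup W] [Module 𝕜 W]
variable {W' : Type*} [AddCommGroup W'] [Module 𝕜 W']

theorem IsGradedSkew.apply_perm {𝒱 : ℤ → Submodule 𝕜 W} {n : ℕ}
    {F : MultilinearMap 𝕜 (fun _ : Fin n => W) W'} (hF : IsGradedSkew 𝒱 F)
    (σ : Perm (Fin n)) (d : Fin n → ℤ) (v : Fin n → W) (hv : ∀ i, v i ∈ 𝒱 (d i)) :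
    F v = gradedSign σ d • F (v ∘ σ) := by
  induction σ using perm_induction with
  | one => simp [gradedSign_one]
  | mul σ i j hij ih =>
    rw [ih, gradedSign_mul, hF (d ∘ σ) (v ∘ σ) (fun i => hv _) i j hij, mul_smul,
      gradedSign_swap _ _ _ hij]
    simp [Function.comp_def, Units.neg_smul]

/-- The jacobiator is graded skew-symmetric. -/
theorem jacobiator_comp_perm (l : (n : ℕ) → MultilinearMap 𝕜 (fun _ : Fin n => W) W) {n : ℕ}
    (d : Fin n → ℤ) (v : Fin n → W) (τ : Perm (Fin n)) :
    jacobiator l (d ∘ τ) (v ∘ τ) = gradedSign τ d • jacobiator l d v := by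
  unfold jacobiator
  rw [Finset.smul_sum]
  refine Finset.sum_congr rfl fun k _ => ?_
  rw [smul_comm (gradedSign τ d)]
  congr 1
  rw [Finset.smul_sum]
  -- Permuting the arguments only translates the summation variable to `τ * σ`; the cocycle identity
  -- accounts for the sign.
  conv_rhs => rw [← Equiv.sum_comp (Equiv.mulLeft τ)]
  refine Finset.sum_congr rfl fun σ _ => ?_
  have := gradedSign_mul τ σ d
  unfold gradedSign at *
  rw [smul_smul, Equiv.coe_mulLeft, this, ← mul_assoc, Int.units_mul_self, one_mul]
  rfl

/-- A symmetric multilinear map over a field of characteristic zero is determined by its values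
on the diagonal. -/
theorem eq_zero_of_diagonal [CharZero 𝕜] {n : ℕ} (F : MultilinearMap 𝕜 (fun _ : Fin n => W) W')
    (hF : ∀ (σ : Perm (Fin n)) (v : Fin n → W), F (v ∘ σ) = F v)
    (h0 : ∀ x : W, F (fun _ => x) = 0) (v : Fin n → W) : F v = 0 := by
  classical
  -- Inclusion-exclusion: the alternating sum of diagonal values at partial sums of the `v i`
  -- isolates the terms in which every `v i` occurs.
  have h1 : ∑ T : Finset (Fin n), (-1 : ℤ) ^ T.card • F (fun _ => ∑ i ∈ Tᶜ, v i) = 0 :=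
    Finset.sum_eq_zero fun T _ => by rw [h0, smul_zero]
  have h2 : ∀ T : Finset (Fin n), F (fun _ => ∑ i ∈ Tᶜ, v i)
      = ∑ r : Fin n → Fin n, if T ⊆ (Finset.univ.image r)ᶜ then F (v ∘ r) else 0 := by
    intro T
    rw [F.map_sum_finset (fun _ i => v i) (fun _ => Tᶜ), ← Finset.sum_filter]
    refine Finset.sum_congr ?_ fun _ _ => rfl
    ext r
    simp only [Fintype.mem_piFinset, Finset.mem_compl, Finset.mem_filter, Finset.mem_univ,
      true_and, Finset.subset_iff, Finset.mem_image, not_exists]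
    exact ⟨fun h x hx a ha => h a (ha ▸ hx), fun h a ha => h ha a rfl⟩
  simp_rw [h2, Finset.smul_sum] at h1
  rw [Finset.sum_comm] at h1
  -- The alternating sum over subsets of the complement of the image of `r` vanishes unless that
  -- complement is empty. Only permutations survive, and by symmetry they add up to `n!` copies of
  -- `F v`.
  have h3 : ∀ r : Fin n → Fin n, ∑ T : Finset (Fin n), (-1 : ℤ) ^ T.card •
      (if T ⊆ (Finset.univ.image r)ᶜ then F (v ∘ r) else 0)
      = if Function.Bijective r then F (v ∘ r) else 0 := by
    intro r
    have : ∑ T : Finset (Fin n), (-1 : ℤ) ^ T.card •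
      (if T ⊆ (Finset.univ.image r)ᶜ then F (v ∘ r) else 0)
      = (∑ T ∈ ((Finset.univ.image r)ᶜ).powerset, (-1 : ℤ) ^ T.card) • F (v ∘ r) := by
      rw [Finset.sum_smul]
      simp_rw [smul_ite, smul_zero, ← Finset.mem_powerset]
      rw [← Finset.sum_filter]
      congr 1
      ext; simp
    rw [this, Finset.sum_powerset_neg_one_pow_card]
    have hb : (Finset.univ.image r)ᶜ = ∅ ↔ Function.Bijective r := by
      rw [Finset.compl_eq_empty_iff, Finset.eq_univ_iff_forall, ← Finite.surjective_iff_bijective]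
      simp [Function.Surjective]
    simp only [hb]
    split_ifs <;> simp
  simp_rw [h3] at h1
  have h4 : ∑ r : Fin n → Fin n, (if Function.Bijective r then F (v ∘ r) else 0)
      = ∑ σ : Perm (Fin n), F (v ∘ σ) := by
    rw [← Finset.sum_filter]
    symm
    refine Finset.sum_bij (fun σ _ => ⇑σ) (fun σ _ => Finset.mem_filter.mpr ⟨Finset.mem_univ _, σ.bijective⟩)
      (fun σ _ τ _ h => DFunLike.coe_injective h) (fun r hr => ?_) (fun _ _ => rfl)
    exact ⟨Equiv.ofBijective r (Finset.mem_filter.mp hr).2, Finset.mem_univ _, rfl⟩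
  rw [h4] at h1
  simp_rw [hF] at h1
  rw [Finset.sum_const, Finset.card_univ, ← Nat.cast_smul_eq_nsmul 𝕜] at h1
  refine (smul_eq_zero.mp h1).resolve_left ?_
  simp [Fintype.card_perm, Nat.factorial_ne_zero]

/-- A function of the images of two points, summed over all permutations. -/
theorem sum_perm_two_points {M : Type*} [AddCommMonoid M] {n : ℕ}
    (G : Fin (n + 2) → Fin (n + 2) → M) :
    ∑ ρ : Perm (Fin (n + 2)), G (ρ 0) (ρ 1)
      = n.factorial • ∑ a, ∑ b, if a = b then 0 else G a b := by
  have h0 : ∀ (m : ℕ) (g : Fin (m + 1) → M),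
      ∑ e : Perm (Fin (m + 1)), g (e 0) = m.factorial • ∑ c, g c := by
    intro m g
    rw [← Equiv.sum_comp Perm.decomposeFin.symm, Fintype.sum_prod_type, Finset.smul_sum]
    simp [Fintype.card_perm]
  rw [← Equiv.sum_comp Perm.decomposeFin.symm, Fintype.sum_prod_type, Finset.smul_sum]
  refine Finset.sum_congr rfl fun a _ => ?_
  have : ∀ e : Perm (Fin (n + 1)), G (Perm.decomposeFin.symm (a, e) 0)
      (Perm.decomposeFin.symm (a, e) 1) = G a (swap 0 a (e 0).succ) := by
    intro e
    rw [Perm.decomposeFin_symm_apply_zero, Perm.decomposeFin_symm_apply_one]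
  simp_rw [this]
  rw [h0 n (fun c => G a (swap 0 a c.succ))]
  congr 1
  -- After this substitution the excluded value `b = a` sits at index `0`, and the successors run
  -- over the admissible images of `1`.
  conv_rhs => rw [← Equiv.sum_comp (swap 0 a), Fin.sum_univ_succ]
  simp only [swap_apply_left, if_true, zero_add]
  refine Finset.sum_congr rfl fun c _ => ?_
  rw [if_neg]
  intro h
  have := (swap 0 a).injective ((swap_apply_left 0 a).trans h)
  exact absurd this.symm (Fin.succ_ne_zero c)

end LInfty

end

noncomputable section

/-! ### Multilinearity and degree of the homotopy Jacobi expression. -/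

namespace LInfty

open Equiv

variable {𝕜 : Type*} [Field 𝕜]
variable {W : Type*} [AddCommGroup W] [Module 𝕜 W]

/-- The multilinear map `v ↦ F(G(v₀, …, v_{k-1}), v_k, …, v_{n-1})`. -/
def nested {n k : ℕ} (hk : k ≤ n) (F : MultilinearMap 𝕜 (fun _ : Fin (n - k + 1) => W) W)
    (G : MultilinearMap 𝕜 (fun _ : Fin k => W) W) : MultilinearMap 𝕜 (fun _ : Fin n => W) W :=
  MultilinearMap.domDomCongr (finSumFinEquiv.trans (finCongr (Nat.add_sub_cancel' hk)))
    (MultilinearMap.uncurrySum (N := fun _ : Fin k ⊕ Fin (n - k) => W)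
      (F.curryLeft.compMultilinearMap G))

theorem nested_apply {n k : ℕ} (hk : k ≤ n)
    (F : MultilinearMap 𝕜 (fun _ : Fin (n - k + 1) => W) W)
    (G : MultilinearMap 𝕜 (fun _ : Fin k => W) W) (v : Fin n → W) :
    nested hk F G v = F (Fin.cons (G (headArgs k hk v)) (tailArgs k v)) := rfl

/-- The homotopy Jacobi expression as a multilinear map. -/
def jacobiatorMap (l : (n : ℕ) → MultilinearMap 𝕜 (fun _ : Fin n => W) W) {n : ℕ}
    (d : Fin n → ℤ) : MultilinearMap 𝕜 (fun _ : Fin n => W) W :=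
  ∑ k : Fin n,
    ((-1 : 𝕜) ^ ((k + 1 : ℕ) * (n - (k + 1))) / ((Nat.factorial (k + 1) : 𝕜) * (Nat.factorial (n - (k + 1)) : 𝕜))) •
      ∑ σ : Perm (Fin n), (Perm.sign σ * koszulSign σ d) •
        (nested k.isLt (l (n - (k + 1) + 1)) (l (k + 1))).domDomCongr σ

theorem jacobiatorMap_apply (l : (n : ℕ) → MultilinearMap 𝕜 (fun _ : Fin n => W) W) {n : ℕ}
    (d : Fin n → ℤ) (v : Fin n → W) : jacobiatorMap l d v = jacobiator l d v := by
  simp only [jacobiatorMap, jacobiator, sum_apply, smul_apply,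
    MultilinearMap.domDomCongr_apply, nested_apply]
  rfl

/-- For two-term gradings this disposes of arguments of degree other than `0` and `1`, which are
zero. -/
theorem jacobiator_eq_zero_of_apply_eq_zero
    (l : (n : ℕ) → MultilinearMap 𝕜 (fun _ : Fin n => W) W) {n : ℕ}
    (d : Fin n → ℤ) (v : Fin n → W) (i : Fin n) (hi : v i = 0) : jacobiator l d v = 0 := by
  rw [← jacobiatorMap_apply, MultilinearMap.map_coord_zero _ i hi]

theorem sum_headArgs_add_sum_tailArgs {M : Type*} [AddCommMonoid M] {n k : ℕ} (hk : k ≤ n)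
    (d : Fin n → M) : ∑ i, headArgs k hk d i + ∑ i, tailArgs k d i = ∑ i, d i := by
  rw [← Equiv.sum_comp (finSumFinEquiv.trans (finCongr (Nat.add_sub_cancel' hk))) d,
    Fintype.sum_sum_type]
  rfl

/-- The homotopy Jacobi expression has degree `3 - n`. -/
theorem jacobiator_mem {𝒱 : ℤ → Submodule 𝕜 W}
    {l : (n : ℕ) → MultilinearMap 𝕜 (fun _ : Fin n => W) W}
    (hl : ∀ n : ℕ, IsOfDegree 𝒱 𝒱 (l n) (2 - n)) {n : ℕ} (d : Fin n → ℤ) (v : Fin n → W)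
    (hv : ∀ i, v i ∈ 𝒱 (d i)) : jacobiator l d v ∈ 𝒱 ((∑ i, d i) + (3 - n)) := by
  refine Submodule.sum_mem _ fun k _ => Submodule.smul_mem _ _ <|
    Submodule.sum_mem _ fun σ _ => ?_
  rw [Units.smul_def]
  refine zsmul_mem ?_ _
  have hk : (k : ℕ) + 1 ≤ n := k.isLt
  have h1 := hl (k + 1) (headArgs (k + 1) hk (d ∘ σ)) (headArgs (k + 1) hk (v ∘ σ))
    (fun i => hv _)
  have h2 := hl (n - (k + 1) + 1)
    (Fin.cons ((∑ i, headArgs (k + 1) hk (d ∘ σ) i) + (2 - (k + 1 : ℕ)))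
      (tailArgs (k + 1) (d ∘ σ)))
    (Fin.cons (l (k + 1) (headArgs (k + 1) k.isLt (v ∘ σ))) (tailArgs (k + 1) (v ∘ σ)))
    (Fin.cases h1 fun i => hv _)
  convert h2 using 2
  rw [Fin.sum_univ_succ]
  simp only [Fin.cons_zero, Fin.cons_succ]
  have h3 := sum_headArgs_add_sum_tailArgs hk (d ∘ σ)
  have h4 : ∑ i, (d ∘ σ) i = ∑ i, d i := Equiv.sum_comp σ d
  push_cast [Nat.cast_sub hk]
  linarith

end LInfty

/-! ## L-infinity structures on two-term graded vector spaces -/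

namespace TwoTerm

open LInfty Equiv

variable {𝕜 : Type*} [Field 𝕜]
variable {V₀ : Type*} [AddCommGroup V₀] [Module 𝕜 V₀]
variable {V₁ : Type*} [AddCommGroup V₁] [Module 𝕜 V₁]

variable (𝕜 V₀ V₁) in
/-- The grading of `V₀ ⊕ V₁` with `V₀` in degree `0` and `V₁` in degree `1`. -/
def grading (n : ℤ) : Submodule 𝕜 (V₀ × V₁) :=
  if n = 0 then LinearMap.range (LinearMap.inl 𝕜 V₀ V₁)
  else if n = 1 then LinearMap.range (LinearMap.inr 𝕜 V₀ V₁)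
  else ⊥

theorem mem_grading {n : ℤ} {v : V₀ × V₁} :
    v ∈ grading 𝕜 V₀ V₁ n ↔ (n ≠ 0 → v.1 = 0) ∧ (n ≠ 1 → v.2 = 0) := by
  obtain ⟨x, y⟩ := v
  unfold grading
  split_ifs with h0 h1
  · subst h0; simp [eq_comm]
  · subst h1; simp [eq_comm]
  · simp [h0, h1]

/-- The sign `(-1)^(n(n-1)/2)`. -/
def triangleSign (𝕜 : Type*) [Field 𝕜] (n : ℕ) : 𝕜 := (-1) ^ (n * (n - 1) / 2)

theorem triangleSign_succ (n : ℕ) : triangleSign 𝕜 (n + 1) = (-1) ^ n * triangleSign 𝕜 n := by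
  simp only [triangleSign, ← Nat.choose_two_right]
  rw [Nat.choose_succ_succ' n 1, Nat.choose_one_right, pow_add]

/-- Triangular numbers satisfy `T(m + n) = T(m) + T(n) + mn`. The cross term absorbs the sign
`(-1)^(k(n-k))` of the homotopy Jacobi identity. -/
theorem triangleSign_add (m n : ℕ) :
    triangleSign 𝕜 (m + n) = (-1) ^ (m * n) * triangleSign 𝕜 m * triangleSign 𝕜 n := by
  induction n with
  | zero => simp [triangleSign]
  | succ n ih =>
    rw [← add_assoc, triangleSign_succ, ih, triangleSign_succ]
    ring

theorem triangleSign_mul_self (n : ℕ) : triangleSign 𝕜 n * triangleSign 𝕜 n = 1 := by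
  rw [triangleSign, ← mul_pow]; simp


end TwoTerm
end

noncomputable section

/-! ### Brackets on a two-term space built from Taylor coefficients. -/

namespace TwoTerm

open LInfty Equiv

variable {𝕜 : Type*} [Field 𝕜]
variable {V₀ : Type*} [AddCommGroup V₀] [Module 𝕜 V₀]
variable {V₁ : Type*} [AddCommGroup V₁] [Module 𝕜 V₁]

/-- The multilinear map `(v₀, …, v_{n-1}) ↦ -b(v₀, v₁)` on the degree zero parts for `n = 2`,
and zero for `n ≠ 2`. -/
def negBilin (b : V₀ →ₗ[𝕜] V₀ →ₗ[𝕜] V₀) :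
    (n : ℕ) → MultilinearMap 𝕜 (fun _ : Fin n => V₀ × V₁) V₀
  | 2 => LinearMap.uncurryLeft (M := fun _ : Fin 2 => V₀ × V₁)
      ((MultilinearMap.ofSubsingletonₗ 𝕜 𝕜 (V₀ × V₁) V₀ (0 : Fin 1)).toLinearMap ∘ₗ
        (-(b.compl₁₂ (LinearMap.fst 𝕜 V₀ V₁) (LinearMap.fst 𝕜 V₀ V₁))))
  | _ => 0

theorem negBilin_two (b : V₀ →ₗ[𝕜] V₀ →ₗ[𝕜] V₀) (v : Fin 2 → V₀ × V₁) :
    negBilin b 2 v = -b (v 0).1 (v 1).1 := rfl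

theorem negBilin_of_ne_two (b : V₀ →ₗ[𝕜] V₀ →ₗ[𝕜] V₀) {n : ℕ} (hn : n ≠ 2) :
    negBilin (V₁ := V₁) b n = 0 := by
  unfold negBilin
  split
  · exact absurd rfl hn
  · rfl

theorem negBilin_eq_zero (b : V₀ →ₗ[𝕜] V₀ →ₗ[𝕜] V₀) {n : ℕ} (v : Fin n → V₀ × V₁) (i : Fin n)
    (hi : (v i).1 = 0) : negBilin b n v = 0 := by
  by_cases hn : n = 2
  · subst hn
    rw [negBilin_two]
    fin_cases i <;> simp at hi <;> simp [hi]
  · rw [negBilin_of_ne_two b hn]; rfl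

/-- The multilinear map `(v₀, …, vₘ) ↦ N(vₐ)(v₀, …, vₐ₋₁, vₐ₊₁, …, vₘ)`, with `vₐ` replaced by its
part of degree zero and the other arguments by their parts of degree one. -/
def insertAt {m : ℕ} (N : V₀ →ₗ[𝕜] MultilinearMap 𝕜 (fun _ : Fin m => V₁) V₁) (a : Fin (m + 1)) :
    MultilinearMap 𝕜 (fun _ : Fin (m + 1) => V₀ × V₁) V₁ :=
  LinearMap.uncurryMid (M := fun _ : Fin (m + 1) => V₀ × V₁) a
    (MultilinearMap.compLinearMapₗ (fun _ : Fin m => LinearMap.snd 𝕜 V₀ V₁) ∘ₗ N ∘ₗ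
      LinearMap.fst 𝕜 V₀ V₁)

theorem insertAt_apply {m : ℕ} (N : V₀ →ₗ[𝕜] MultilinearMap 𝕜 (fun _ : Fin m => V₁) V₁)
    (a : Fin (m + 1)) (v : Fin (m + 1) → V₀ × V₁) :
    insertAt N a v = N (v a).1 (fun i => (v (a.succAbove i)).2) := rfl

theorem insertAt_eq_zero {m : ℕ} (N : V₀ →ₗ[𝕜] MultilinearMap 𝕜 (fun _ : Fin m => V₁) V₁)
    (a : Fin (m + 1)) (v : Fin (m + 1) → V₀ × V₁) (h : (v a).1 = 0) : insertAt N a v = 0 := by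
  rw [insertAt_apply, h, map_zero]; rfl

theorem insertAt_eq_zero_of_ne {m : ℕ} (N : V₀ →ₗ[𝕜] MultilinearMap 𝕜 (fun _ : Fin m => V₁) V₁)
    (a : Fin (m + 1)) (v : Fin (m + 1) → V₀ × V₁) {i : Fin (m + 1)} (hi : i ≠ a)
    (h : (v i).2 = 0) : insertAt N a v = 0 := by
  obtain ⟨j, rfl⟩ := Fin.exists_succAbove_eq hi
  rw [insertAt_apply, MultilinearMap.map_coord_zero _ j h]

variable (N : (m : ℕ) → V₀ →ₗ[𝕜] MultilinearMap 𝕜 (fun _ : Fin m => V₁) V₁)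
variable (b : V₀ →ₗ[𝕜] V₀ →ₗ[𝕜] V₀)

/-- The graded skew-symmetric brackets on `V₀ ⊕ V₁` with
`ℓₘ₊₁(f, A₁, …, Aₘ) = (-1)^(m(m-1)/2) Nₘ(f)(A₁, …, Aₘ)`, `ℓ₂(f, g) = -b(f, g)` and no other
components. -/
def bracket : (n : ℕ) → MultilinearMap 𝕜 (fun _ : Fin n => V₀ × V₁) (V₀ × V₁)
  | 0 => 0
  | m + 1 => (LinearMap.inl 𝕜 V₀ V₁).compMultilinearMap (negBilin b (m + 1)) +
      (LinearMap.inr 𝕜 V₀ V₁).compMultilinearMap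
        -- Moving the degree zero argument from position `a` to the front passes `a` arguments of
        -- degree one, each at the cost of `-1`.
        (∑ a : Fin (m + 1), ((-1) ^ (a : ℕ) * triangleSign 𝕜 m) • insertAt (N m) a)

theorem bracket_succ_fst {m : ℕ} (v : Fin (m + 1) → V₀ × V₁) :
    (bracket N b (m + 1) v).1 = negBilin b (m + 1) v := by
  simp [bracket, Prod.fst_sum]

theorem bracket_fst {n : ℕ} (v : Fin n → V₀ × V₁) : (bracket N b n v).1 = negBilin b n v := by
  cases n with
  | zero => simp [bracket, negBilin]
  | succ n => exact bracket_succ_fst N b v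

theorem bracket_succ_snd {m : ℕ} (v : Fin (m + 1) → V₀ × V₁) :
    (bracket N b (m + 1) v).2
      = ∑ a : Fin (m + 1), ((-1) ^ (a : ℕ) * triangleSign 𝕜 m) • insertAt (N m) a v := by
  simp [bracket, Prod.snd_sum]

/-- Brackets with all arguments but one of degree one. -/
theorem bracket_snd_of_fst_eq_zero {m : ℕ} (v : Fin (m + 1) → V₀ × V₁) (c : Fin (m + 1))
    (hv : ∀ i, i ≠ c → (v i).1 = 0) :
    (bracket N b (m + 1) v).2 = ((-1) ^ (c : ℕ) * triangleSign 𝕜 m) •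
      N m (v c).1 (fun i => (v (c.succAbove i)).2) := by
  rw [bracket_succ_snd, Finset.sum_eq_single c]
  · rw [insertAt_apply]
  · intro a _ ha
    rw [insertAt_eq_zero _ _ _ (hv a ha), smul_zero]
  · simp

theorem bracket_fst_of_fst_eq_zero {m : ℕ} (v : Fin (m + 1) → V₀ × V₁) (c : Fin (m + 1))
    (hv : ∀ i, i ≠ c → (v i).1 = 0) : (bracket N b (m + 1) v).1 = 0 := by
  rw [bracket_fst]
  by_cases h : m + 1 = 2
  · obtain rfl : m = 1 := by omega
    obtain ⟨i, hi⟩ := exists_ne c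
    exact negBilin_eq_zero b v i (hv i hi)
  · rw [negBilin_of_ne_two b h]; rfl

/-- Brackets with all arguments of degree one vanish. -/
theorem bracket_eq_zero {n : ℕ} (v : Fin n → V₀ × V₁) (hv : ∀ i, (v i).1 = 0) :
    bracket N b n v = 0 := by
  cases n with
  | zero => rfl
  | succ m =>
    refine Prod.ext (bracket_fst_of_fst_eq_zero N b v 0 fun i _ => hv i) ?_
    rw [bracket_succ_snd]
    exact Finset.sum_eq_zero fun a _ => by rw [insertAt_eq_zero _ _ _ (hv a), smul_zero]

/-- Brackets with two arguments of degree zero take values in degree zero. -/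
theorem bracket_snd_eq_zero {n : ℕ} (v : Fin n → V₀ × V₁) {i j : Fin n} (hij : i ≠ j)
    (hi : (v i).2 = 0) (hj : (v j).2 = 0) : (bracket N b n v).2 = 0 := by
  cases n with
  | zero => exact i.elim0
  | succ m =>
    rw [bracket_succ_snd]
    refine Finset.sum_eq_zero fun a _ => ?_
    by_cases h : i = a
    · rw [insertAt_eq_zero_of_ne _ _ _ (h ▸ hij.symm) hj, smul_zero]
    · rw [insertAt_eq_zero_of_ne _ _ _ h hi, smul_zero]

/-- The component in `V₀` needs two inputs of degree `0` and `n = 2`, hence total degree `0`. The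
component in `V₁` needs one input of degree `0` and `n - 1` of degree `1`, hence total degree `(n -
1) + 2 - n = 1`. -/
theorem bracket_degree (n : ℕ) :
    IsOfDegree (grading 𝕜 V₀ V₁) (grading 𝕜 V₀ V₁) (bracket N b n) (2 - n) := by
  intro d v hv
  simp only [mem_grading] at hv
  rw [mem_grading]
  constructor
  · intro h
    rw [bracket_fst]
    by_cases hn : n = 2
    · subst hn
      simp only [Fin.sum_univ_two] at h
      by_cases h0 : d 0 = 0
      · exact negBilin_eq_zero b v 1 ((hv 1).1 (by push_cast at h; omega))
      · exact negBilin_eq_zero b v 0 ((hv 0).1 h0)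
    · rw [negBilin_of_ne_two b hn]; rfl
  · intro h
    cases n with
    | zero => rfl
    | succ m =>
      rw [bracket_succ_snd]
      refine Finset.sum_eq_zero fun a _ => ?_
      by_cases h0 : d a = 0
      · by_cases h1 : ∃ i, d (a.succAbove i) ≠ 1
        · obtain ⟨i, hi⟩ := h1
          rw [insertAt_eq_zero_of_ne _ _ _ (Fin.succAbove_ne a i) ((hv _).2 hi), smul_zero]
        · push Not at h1
          rw [Fin.sum_univ_succAbove _ a] at h
          simp only [h0, h1] at h
          simp at h
          omega
      · rw [insertAt_eq_zero _ _ _ ((hv a).1 h0), smul_zero]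

variable {N b}

/-- If the transposition moves the slot `a`, the remaining arguments keep their order, `(-1)^a`
changes sign, and the Koszul sign is trivial unless both terms vanish. If it fixes `a`, either both
exchanged letters have degree one and the symmetry of `N` applies, or both terms vanish. -/
theorem insertAt_swap (hN : ∀ m f (σ : Perm (Fin m)) (x : Fin m → V₁), N m f (x ∘ σ) = N m f x)
    {m : ℕ} (d : Fin (m + 1) → ℤ) (v : Fin (m + 1) → V₀ × V₁)
    (hv : ∀ i, v i ∈ grading 𝕜 V₀ V₁ (d i)) (i j : Fin (m + 1)) (hij : (i : ℕ) + 1 = j)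
    (a : Fin (m + 1)) :
    (-1 : 𝕜) ^ (a : ℕ) • insertAt (N m) a v = -((d i * d j).negOnePow •
      (-1 : 𝕜) ^ (swap i j a : ℕ) • insertAt (N m) (swap i j a) (v ∘ swap i j)) := by
  simp only [mem_grading] at hv
  have hne : i ≠ j := by rintro rfl; omega
  have hval : (-1 : 𝕜) ^ (j : ℕ) = -(-1) ^ (i : ℕ) := by rw [← hij, pow_succ]; ring
  rcases eq_or_ne a i with rfl | hai
  · rw [swap_apply_left]
    have h1 : insertAt (N m) j (v ∘ swap a j) = insertAt (N m) a v := by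
      rw [insertAt_apply, insertAt_apply]
      simp only [Function.comp, swap_apply_right]
      congr 2
      ext k : 1
      congr 2
      rcases lt_trichotomy (k : ℕ) a with h | h | h
      · rw [Fin.succAbove_of_castSucc_lt a k (by simpa [Fin.lt_def] using h),
          Fin.succAbove_of_castSucc_lt j k (by simp [Fin.lt_def]; omega),
          swap_apply_of_ne_of_ne] <;> (intro hh; rw [Fin.ext_iff] at hh; simp at hh; omega)
      · rw [Fin.succAbove_of_le_castSucc a k (by simp [Fin.le_def]; omega),
          Fin.succAbove_of_castSucc_lt j k (by simp [Fin.lt_def]; omega)]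
        have h1 : k.castSucc = a := by ext; simpa using h
        have h2 : k.succ = j := by ext; simp; omega
        rw [h1, h2, swap_apply_left]
      · rw [Fin.succAbove_of_le_castSucc a k (by simp [Fin.le_def]; omega),
          Fin.succAbove_of_le_castSucc j k (by simp [Fin.le_def]; omega),
          swap_apply_of_ne_of_ne] <;> (intro hh; rw [Fin.ext_iff] at hh; simp at hh; omega)
    rw [h1, hval]
    by_cases h0 : d a = 0
    · simp [h0]
    · rw [insertAt_eq_zero _ _ _ ((hv a).1 h0)]; simp
  rcases eq_or_ne a j with rfl | haj
  · rw [swap_apply_right]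
    have h1 : insertAt (N m) i (v ∘ swap i a) = insertAt (N m) a v := by
      rw [insertAt_apply, insertAt_apply]
      simp only [Function.comp, swap_apply_left]
      congr 2
      ext k : 1
      congr 2
      rcases lt_trichotomy (k : ℕ) i with h | h | h
      · rw [Fin.succAbove_of_castSucc_lt i k (by simpa [Fin.lt_def] using h),
          Fin.succAbove_of_castSucc_lt a k (by simp [Fin.lt_def]; omega),
          swap_apply_of_ne_of_ne] <;> (intro hh; rw [Fin.ext_iff] at hh; simp at hh; omega)
      · rw [Fin.succAbove_of_le_castSucc i k (by simp [Fin.le_def]; omega),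
          Fin.succAbove_of_castSucc_lt a k (by simp [Fin.lt_def]; omega)]
        have h1 : k.castSucc = i := by ext; simpa using h
        have h2 : k.succ = a := by ext; simp; omega
        rw [h1, h2, swap_apply_right]
      · rw [Fin.succAbove_of_le_castSucc i k (by simp [Fin.le_def]; omega),
          Fin.succAbove_of_le_castSucc a k (by simp [Fin.le_def]; omega),
          swap_apply_of_ne_of_ne] <;> (intro hh; rw [Fin.ext_iff] at hh; simp at hh; omega)
    rw [h1, hval]
    by_cases h0 : d a = 0
    · simp [h0]
    · rw [insertAt_eq_zero _ _ _ ((hv a).1 h0)]; simp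
  · rw [swap_apply_of_ne_of_ne hai haj]
    by_cases h1 : d i = 1 ∧ d j = 1
    · have : insertAt (N m) a (v ∘ swap i j) = insertAt (N m) a v := by
        obtain ⟨i', rfl⟩ := Fin.exists_succAbove_eq hai.symm
        obtain ⟨j', rfl⟩ := Fin.exists_succAbove_eq haj.symm
        rw [insertAt_apply, insertAt_apply, ← hN m _ (swap i' j')]
        simp only [Function.comp_def, swap_apply_of_ne_of_ne hai haj,
          ← Fin.succAbove_right_injective.swap_apply, ← Perm.mul_apply, swap_mul_self,
          Perm.one_apply]
      rw [this, h1.1, h1.2]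
      simp [Units.neg_smul]
    · have : insertAt (N m) a v = 0 ∧ insertAt (N m) a (v ∘ swap i j) = 0 := by
        rw [not_and_or] at h1
        rcases h1 with h1 | h1
        · exact ⟨insertAt_eq_zero_of_ne _ _ _ hai.symm ((hv _).2 h1),
            insertAt_eq_zero_of_ne _ _ _ haj.symm (by simpa using (hv _).2 h1)⟩
        · exact ⟨insertAt_eq_zero_of_ne _ _ _ haj.symm ((hv _).2 h1),
            insertAt_eq_zero_of_ne _ _ _ hai.symm (by simpa using (hv _).2 h1)⟩
      rw [this.1, this.2]; simp

theorem bracket_skew (hN : ∀ m f (σ : Perm (Fin m)) (x : Fin m → V₁), N m f (x ∘ σ) = N m f x)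
    (hb : ∀ f g, b f g = -b g f) (n : ℕ) :
    IsGradedSkew (grading 𝕜 V₀ V₁) (bracket N b n) := by
  intro d v hv i j hij
  cases n with
  | zero => exact i.elim0
  | succ m =>
    refine Prod.ext ?_ ?_
    · rw [Prod.fst_neg, Units.smul_def, Prod.smul_fst, ← Units.smul_def, bracket_fst, bracket_fst]
      by_cases hm : m = 1
      · subst hm
        obtain ⟨rfl, rfl⟩ : i = 0 ∧ j = 1 := by constructor <;> ext <;> simp <;> omega
        simp only [mem_grading] at hv
        by_cases h0 : d 0 = 0
        · rw [h0, negBilin_two, negBilin_two, hb]; simp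
        · rw [negBilin_eq_zero b v 0 ((hv 0).1 h0),
            negBilin_eq_zero b _ 1 (by simpa using (hv 0).1 h0)]
          simp
      · rw [negBilin_of_ne_two b (by omega)]; simp
    · rw [Prod.snd_neg, Units.smul_def, Prod.smul_snd, ← Units.smul_def, bracket_succ_snd,
        bracket_succ_snd, Finset.smul_sum, ← Finset.sum_neg_distrib]
      conv_rhs => rw [← Equiv.sum_comp (swap i j)]
      refine Finset.sum_congr rfl fun a _ => ?_
      rw [mul_comm, mul_smul, insertAt_swap hN d v hv i j hij a, mul_comm ((-1 : 𝕜) ^ _), mul_smul,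
        smul_neg, smul_comm (triangleSign 𝕜 m)]

end TwoTerm
end

noncomputable section

/-! ### Homotopy Jacobi terms on words with two letters of degree zero. -/

namespace TwoTerm

open LInfty Equiv

variable {𝕜 : Type*} [Field 𝕜]
variable {V₀ : Type*} [AddCommGroup V₀] [Module 𝕜 V₀]
variable {V₁ : Type*} [AddCommGroup V₁] [Module 𝕜 V₁]

/-- The word with letters `(f, 0)` at position `a`, `(g, 0)` at position `b` and `(0, A)`
elsewhere. -/
def word {n : ℕ} (f g : V₀) (A : V₁) (a b : Fin n) : Fin n → V₀ × V₁ := fun i =>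
  if i = a then (f, 0) else if i = b then (g, 0) else (0, A)

theorem word_comm {n : ℕ} (f g : V₀) (A : V₁) {a b : Fin n} (hab : a ≠ b) :
    word f g A a b = word g f A b a := by
  ext1 i
  unfold word
  split_ifs with h1 h2
  · exact absurd (h1.symm.trans h2) hab
  · rfl
  · rfl
  · rfl

/-- The degrees of the letters of the word with two letters of degree zero in front. -/
def wordDegree (n : ℕ) : Fin (n + 2) → ℤ := fun i => if i = 0 then 0 else if i = 1 then 0 else 1

/-- The sign of moving two elements of degree zero at positions `a` and `b` to the front of
a word in elements of degree one. -/
def wordSign {n : ℕ} (a b : Fin n) : ℤˣ := (-1) ^ ((a : ℕ) + b) * if a < b then -1 else 1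

theorem wordSign_comm {n : ℕ} {a b : Fin n} (hab : a ≠ b) : wordSign b a = -wordSign a b := by
  unfold wordSign
  rw [add_comm]
  rcases lt_or_gt_of_ne hab with h | h <;> simp [h, h.not_gt]

/-- Exchanging adjacent letters of degree one has total sign `+1`. Exchanging letters of degrees
zero and one shifts one position by one and gives `-1`. Exchanging the two letters of degree zero
preserves the sum of the positions, reverses their order and gives `-1`. So only the positions of
the two special letters matter. -/
theorem gradedSign_wordDegree {n : ℕ} (σ : Perm (Fin (n + 2))) :
    gradedSign σ (wordDegree n) = wordSign (σ⁻¹ 0) (σ⁻¹ 1) := by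
  induction σ using perm_induction with
  | one => simp [gradedSign_one, wordSign]
  | mul σ i j hij ih =>
    rw [gradedSign_mul, ih, gradedSign_swap _ i j hij, mul_inv_rev, swap_inv, Perm.mul_apply,
      Perm.mul_apply]
    have hne : σ⁻¹ 0 ≠ σ⁻¹ 1 := fun h => by simpa using σ⁻¹.injective h
    -- The rearranged degrees vanish exactly at `σ⁻¹ 0` and `σ⁻¹ 1`, so the cases depend on how `i`
    -- and `j` meet these two positions.
    have hd : ∀ k, (wordDegree n ∘ σ) k = if k = σ⁻¹ 0 then 0 else if k = σ⁻¹ 1 then 0 else 1 := by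
      intro k
      simp only [Function.comp, wordDegree, Perm.eq_inv_iff_eq]
    rw [hd, hd]
    generalize σ⁻¹ 0 = a at *
    generalize σ⁻¹ 1 = b at *
    have hij' : i ≠ j := by rintro rfl; omega
    have hsgn : (-1 : ℤˣ) ^ (j : ℕ) = -(-1) ^ (i : ℕ) := by rw [← hij, pow_succ]; simp
    unfold wordSign
    rcases eq_or_ne a i with rfl | hai
    · rcases eq_or_ne b j with rfl | hbj
      · have h1 : a < b := by rw [Fin.lt_def]; omega
        simp [h1, h1.not_gt, add_comm]
      · have h1 : a < b ↔ j < b := by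
          rw [Fin.lt_def, Fin.lt_def, ← hij]; rw [Ne, Fin.ext_iff] at hbj; omega
        simp [swap_apply_of_ne_of_ne hne.symm hbj, h1, pow_add, hsgn]
        split_ifs <;> simp
    rcases eq_or_ne a j with rfl | haj
    · rcases eq_or_ne b i with rfl | hbi
      · have h1 : b < a := by rw [Fin.lt_def]; omega
        simp [h1, h1.not_gt, add_comm]
      · have h1 : a < b ↔ i < b := by
          rw [Fin.lt_def, Fin.lt_def, ← hij]; rw [Ne, Fin.ext_iff] at hne; omega
        simp [swap_apply_of_ne_of_ne hbi hne.symm, h1, pow_add, hsgn]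
        split_ifs <;> simp
    rw [swap_apply_of_ne_of_ne hai haj, if_neg hai.symm, if_neg haj.symm]
    rcases eq_or_ne b i with rfl | hbi
    · have h1 : a < b ↔ a < j := by
        rw [Fin.lt_def, Fin.lt_def, ← hij]; rw [Ne, Fin.ext_iff] at hne; omega
      simp [h1, pow_add, hsgn]
      split_ifs <;> simp
    rcases eq_or_ne b j with rfl | hbj
    · have h1 : a < b ↔ a < i := by
        rw [Fin.lt_def, Fin.lt_def, ← hij]; rw [Ne, Fin.ext_iff] at hai; omega
      simp [h1, pow_add, hsgn]
      split_ifs <;> simp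
    rw [swap_apply_of_ne_of_ne hbi hbj, if_neg hbi.symm, if_neg hbj.symm]
    simp

variable {N : (m : ℕ) → V₀ →ₗ[𝕜] MultilinearMap 𝕜 (fun _ : Fin m => V₁) V₁}
variable {b : V₀ →ₗ[𝕜] V₀ →ₗ[𝕜] V₀}

/-- The arguments `B, A, …, A`. -/
def consConst (m : ℕ) (B A : V₁) : Fin m → V₁ := fun i => if (i : ℕ) = 0 then B else A

theorem map_consConst_smul {m : ℕ} (hm : 0 < m)
    (F : MultilinearMap 𝕜 (fun _ : Fin m => V₁) V₁) (c : 𝕜) (B A : V₁) :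
    F (consConst m (c • B) A) = c • F (consConst m B A) := by
  have : ∀ B, consConst m B A = Function.update (fun _ => A) ⟨0, hm⟩ B := by
    intro B
    ext1 i
    simp [consConst, Function.update_apply, Fin.ext_iff]
  rw [this, this, F.map_update_smul]

/-- The terms of the homotopy Jacobi expression in which the inner bracket contains exactly one
element of degree zero. -/
theorem nested_word_snd {n : ℕ} (f g : V₀) (A : V₁) {p q : Fin (n + 2)} {k : ℕ}
    (hk : k + 1 ≤ n + 2) (hp : (p : ℕ) ≤ k) (hq : k < q) :
    (bracket N b (n + 2 - (k + 1) + 1) (Fin.cons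
      (bracket N b (k + 1) (headArgs (k + 1) hk (word f g A p q)))
      (tailArgs (k + 1) (word f g A p q)))).2
    = ((-1) ^ ((q : ℕ) - k) * triangleSign 𝕜 (n + 2 - (k + 1)) * ((-1) ^ (p : ℕ)
        * triangleSign 𝕜 k)) • N (n + 2 - (k + 1)) g
        (consConst _ (N k f fun _ => A) A) := by
  have hqn : (q : ℕ) < n + 2 := q.isLt
  obtain ⟨m, hm⟩ : ∃ m, n + 2 - (k + 1) = m := ⟨_, rfl⟩
  have hinner : bracket N b (k + 1) (headArgs (k + 1) hk (word f g A p q))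
      = (0, ((-1) ^ (p : ℕ) * triangleSign 𝕜 k) • N k f fun _ => A) := by
    have hv : ∀ i : Fin (k + 1), headArgs (k + 1) hk (word f g A p q) i
        = if (i : ℕ) = p then (f, 0) else (0, A) := by
      intro i
      have := i.isLt
      have h2 : (i : ℕ) ≠ q := by omega
      simp [headArgs, word, Fin.ext_iff, h2]
    refine Prod.ext (bracket_fst_of_fst_eq_zero N b _ ⟨p, by omega⟩ ?_) ?_
    · intro i hi
      rw [hv, if_neg (fun h => hi (Fin.ext h))]
    · rw [bracket_snd_of_fst_eq_zero N b _ ⟨p, by omega⟩]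
      · simp only [hv, if_true]
        congr 2
        ext1 i
        rw [if_neg (fun h => Fin.succAbove_ne _ i (Fin.ext h))]
      · intro i hi
        rw [hv, if_neg (fun h => hi (Fin.ext h))]
  rw [hinner]
  have ht : ∀ i : Fin (n + 2 - (k + 1)), tailArgs (k + 1) (word f g A p q) i
      = if (i : ℕ) + 1 = q - k then (g, 0) else (0, A) := by
    intro i
    have h1 : k + 1 + i ≠ p := by omega
    simp only [tailArgs, word, Fin.ext_iff, h1, if_false]
    congr 1
    rw [eq_iff_iff]; omega
  generalize tailArgs (k + 1) (word f g A p q) = w at ht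
  revert w
  rw [hm]
  intro w ht
  -- The inner bracket fills slot `0` of the outer one, so the tail letter `g` of index `q - k - 1`
  -- moves to slot `q - k`.
  rw [bracket_snd_of_fst_eq_zero N b _ ⟨q - k, by omega⟩]
  · have h0 : ∀ i : Fin (m + 1), (Fin.cons (0, ((-1) ^ (p : ℕ) * triangleSign 𝕜 k) • N k f fun _ => A)
        w : Fin (m + 1) → V₀ × V₁) i = if (i : ℕ) = 0 then
          (0, ((-1) ^ (p : ℕ) * triangleSign 𝕜 k) • N k f fun _ => A)
          else if (i : ℕ) = q - k then (g, 0) else (0, A) := by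
      intro i
      refine Fin.cases ?_ (fun i => ?_) i
      · simp
      · simp [ht]
    simp only [h0]
    have h1 : (q : ℕ) - k ≠ 0 := by omega
    simp only [h1, if_false, if_true]
    rw [mul_smul (_ * _) (_ * _), ← map_consConst_smul (by omega)]
    congr 2
    ext1 i
    have h2 : ((Fin.succAbove ⟨(q : ℕ) - k, by omega⟩ i : Fin (m + 1)) : ℕ) = 0 ↔ (i : ℕ) = 0 := by
      rcases Nat.lt_or_ge (i : ℕ) (q - k) with h | h
      · rw [Fin.succAbove_of_castSucc_lt _ _ (by simpa [Fin.lt_def] using h)]; simp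
      · rw [Fin.succAbove_of_le_castSucc _ _ (by simpa [Fin.le_def] using h)]; simp; omega
    have h3 : ((Fin.succAbove ⟨(q : ℕ) - k, by omega⟩ i : Fin (m + 1)) : ℕ) ≠ q - k :=
      fun h => Fin.succAbove_ne _ i (Fin.ext h)
    simp only [h2, h3, if_false, consConst]
    split_ifs <;> rfl
  · intro i
    refine Fin.cases ?_ (fun i hi => ?_) i
    · simp
    · rw [Fin.cons_succ, ht, if_neg]
      intro h
      exact hi (Fin.ext (by simpa using h))

/-- The terms of the homotopy Jacobi expression in which the inner bracket contains both
elements of degree zero. -/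
theorem nested_word_snd_of_le (hb : ∀ f g, b f g = -b g f) {n : ℕ} (f g : V₀) (A : V₁) {p q : Fin (n + 2)} {k : ℕ}
    (hk : k + 1 ≤ n + 2) (hpq : p ≠ q) (hp : (p : ℕ) ≤ k) (hq : (q : ℕ) ≤ k) :
    (bracket N b (n + 2 - (k + 1) + 1) (Fin.cons
      (bracket N b (k + 1) (headArgs (k + 1) hk (word f g A p q)))
      (tailArgs (k + 1) (word f g A p q)))).2
    = if k = 1 then triangleSign 𝕜 n • (if p < q then -N n (b f g) (fun _ => A) else N n (b f g) fun _ => A)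
      else 0 := by
  have hpq' : (p : ℕ) ≠ q := fun h => hpq (Fin.ext h)
  have hv : ∀ i : Fin (k + 1), headArgs (k + 1) hk (word f g A p q) i
      = if (i : ℕ) = p then (f, 0) else if (i : ℕ) = q then (g, 0) else (0, A) := by
    intro i
    simp [headArgs, word, Fin.ext_iff]
  -- With two entries of degree zero the inner bracket has no component in `V₁`; its component in
  -- `V₀` requires arity two, that is `k = 1`.
  have h2 : (bracket N b (k + 1) (headArgs (k + 1) hk (word f g A p q))).2 = 0 := by
    refine bracket_snd_eq_zero N b _ (i := ⟨p, by omega⟩) (j := ⟨q, by omega⟩)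
      (by simpa [Fin.ext_iff] using hpq') ?_ ?_
    · simp [hv]
    · simp [hv, hpq'.symm]
  by_cases hk1 : k = 1
  · rw [if_pos hk1]
    subst hk1
    have h1 : (bracket N b (1 + 1) (headArgs (1 + 1) hk (word f g A p q))).1
        = if p < q then -b f g else b f g := by
      rw [bracket_fst, negBilin_two, hv, hv]
      simp only [Fin.lt_def]
      have : (p : ℕ) = 0 ∧ (q : ℕ) = 1 ∨ (p : ℕ) = 1 ∧ (q : ℕ) = 0 := by omega
      rcases this with h | h <;> simp [h.1, h.2, ← hb]
    have ht : ∀ i : Fin (n + 2 - (1 + 1)), tailArgs (1 + 1) (word f g A p q) i = (0, A) := by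
      intro i
      simp only [tailArgs, word, Fin.ext_iff]
      rw [if_neg (by omega), if_neg (by omega)]
    generalize bracket N b (1 + 1) (headArgs (1 + 1) hk (word f g A p q)) = y at h1 h2
    generalize tailArgs (1 + 1) (word f g A p q) = w at ht
    obtain ⟨m, hm⟩ : ∃ m, n + 2 - (1 + 1) = m := ⟨_, rfl⟩
    revert w
    rw [hm]
    intro w ht
    obtain rfl : m = n := by omega
    rw [bracket_snd_of_fst_eq_zero N b _ 0]
    · simp only [Fin.cons_zero, h1, Fin.val_zero, pow_zero, one_mul, Fin.zero_succAbove,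
        Fin.cons_succ, ht]
      split_ifs <;> simp
    · intro i
      refine Fin.cases (fun h => absurd rfl h) (fun i _ => ?_) i
      rw [Fin.cons_succ, ht]
  · have h1 : bracket N b (k + 1) (headArgs (k + 1) hk (word f g A p q)) = 0 := by
      refine Prod.ext ?_ h2
      rw [bracket_fst, negBilin_of_ne_two b (by omega)]
      rfl
    rw [h1, MultilinearMap.map_coord_zero _ 0 (by simp), if_neg hk1]
    rfl

/-- The terms of the homotopy Jacobi expression in which the inner bracket contains no element of
degree zero. -/
theorem nested_word_of_lt {n : ℕ} (f g : V₀) (A : V₁) {p q : Fin (n + 2)} {k : ℕ}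
    (hk : k + 1 ≤ n + 2) (hp : k < (p : ℕ)) (hq : k < (q : ℕ)) :
    bracket N b (n + 2 - (k + 1) + 1) (Fin.cons
      (bracket N b (k + 1) (headArgs (k + 1) hk (word f g A p q)))
      (tailArgs (k + 1) (word f g A p q))) = 0 := by
  rw [MultilinearMap.map_coord_zero _ 0]
  rw [Fin.cons_zero]
  refine bracket_eq_zero N b _ fun i => ?_
  simp only [headArgs, word, Fin.ext_iff, Fin.val_castLE]
  rw [if_neg (by omega), if_neg (by omega)]

/-- The closure identity `[δ_f, δ_g] = δ_{b(f, g)}` for the vector fields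
`δ_f A = ∑ₙ Nₙ(f)(A, …, A) / n!`, in every polynomial degree. -/
def Closes (N : (m : ℕ) → V₀ →ₗ[𝕜] MultilinearMap 𝕜 (fun _ : Fin m => V₁) V₁)
    (b : V₀ →ₗ[𝕜] V₀ →ₗ[𝕜] V₀) : Prop :=
  ∀ (n : ℕ) (f g : V₀) (A : V₁),
    -- Differentiating `Nₘ(g)(A, …, A) / m!` in a direction `B` gives `Nₘ(g)(B, A, …, A) / (m-1)!`;
    -- here `m = n - j + 1`, whence the factor `(n - j)!`.
    ∑ j ∈ Finset.range (n + 1), ((j.factorial : 𝕜) * ((n - j).factorial : 𝕜))⁻¹ •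
      (N (n - j + 1) g (consConst _ (N j f fun _ => A) A)
        - N (n - j + 1) f (consConst _ (N j g fun _ => A) A))
    = (n.factorial : 𝕜)⁻¹ • N n (b f g) fun _ => A

theorem sum_ite_le {M : Type*} [AddCommMonoid M] {n : ℕ} (k : Fin n) (x : M) :
    ∑ p : Fin n, (if p ≤ k then x else 0) = ((k : ℕ) + 1) • x := by
  rw [← Finset.sum_filter, Finset.sum_const]
  congr 1
  rw [← Fin.card_Iic k]
  congr 1
  ext; simp

theorem sum_ite_lt {M : Type*} [AddCommMonoid M] {n : ℕ} (k : Fin n) (x : M) :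
    ∑ p : Fin n, (if k < p then x else 0) = (n - ((k : ℕ) + 1)) • x := by
  rw [← Finset.sum_filter, Finset.sum_const]
  congr 1
  rw [Nat.sub_add_eq, Nat.sub_right_comm, ← Fin.card_Ioi k]
  congr 1
  ext; simp

/-- The summand of the homotopy Jacobi expression with inner bracket of arity `k + 1`. -/
theorem sum_nested_word_snd (hb : ∀ f g, b f g = -b g f) {n : ℕ} (f g : V₀) (A : V₁)
    (k : Fin (n + 2)) :
    ∑ p, ∑ q, (if p = q then 0 else wordSign p q •
      (bracket N b (n + 2 - (k + 1) + 1) (Fin.cons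
        (bracket N b (k + 1) (headArgs (k + 1) k.isLt (word f g A p q)))
        (tailArgs (k + 1) (word f g A p q)))).2)
    = (((k + 1 : ℕ) : 𝕜) * ((n + 2 - (k + 1) : ℕ) : 𝕜)) • (((-1 : 𝕜) ^ ((k : ℕ) + 1)
        * triangleSign 𝕜 k * triangleSign 𝕜 (n + 2 - (k + 1))) •
        (N (n + 2 - (k + 1)) g (consConst _ (N k f fun _ => A) A)
          - N (n + 2 - (k + 1)) f (consConst _ (N k g fun _ => A) A)))
      - if (k : ℕ) = 1 then (2 : 𝕜) • triangleSign 𝕜 n • N n (b f g) (fun _ => A) else 0 := by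
  let c : 𝕜 := (-1) ^ ((k : ℕ) + 1) * triangleSign 𝕜 k * triangleSign 𝕜 (n + 2 - (k + 1))
  let X : V₀ → V₀ → V₁ := fun f g =>
    c • N (n + 2 - (k + 1)) g (consConst _ (N k f fun _ => A) A)
  let Z : V₁ := triangleSign 𝕜 n • N n (b f g) (fun _ => A)
  have hX : ∀ (f g : V₀) (p q : Fin (n + 2)), p ≤ k → k < q → wordSign p q •
      (bracket N b (n + 2 - (k + 1) + 1) (Fin.cons
        (bracket N b (k + 1) (headArgs (k + 1) k.isLt (word f g A p q)))
        (tailArgs (k + 1) (word f g A p q)))).2 = X f g := by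
    intro f g p q hp hq
    rw [nested_word_snd f g A k.isLt hp hq, wordSign, if_pos (hp.trans_lt hq)]
    -- In terms of `p` and `r` the signs `(-1)^p` and `(-1)^r` each occur twice, so the contribution
    -- does not depend on the positions.
    obtain ⟨r, hr⟩ : ∃ r, (q : ℕ) = k + r := ⟨q - k, (Nat.add_sub_cancel' hq.le).symm⟩
    rw [hr, Nat.add_sub_cancel_left]
    simp only [X, c, Units.smul_def, ← Int.cast_smul_eq_zsmul 𝕜, smul_smul]
    congr 1
    generalize triangleSign 𝕜 (n + 2 - (k + 1)) = t
    push_cast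
    have h1 : ((-1 : 𝕜) ^ (p : ℕ)) * (-1) ^ (p : ℕ) = 1 := by rw [← mul_pow]; simp
    have h2 : ((-1 : 𝕜) ^ r) * (-1) ^ r = 1 := by rw [← mul_pow]; simp
    linear_combination (-(-1 : 𝕜) ^ (k : ℕ) * triangleSign 𝕜 k * t) *
      (h1 * ((-1 : 𝕜) ^ r * (-1) ^ r) + h2)
  -- Split by which of the two special letters lie in the inner block. Exactly one inside gives `X f
  -- g` or, by antisymmetry of the sign, `-X g f`, with `(k + 1)(n + 2 - (k + 1))` placements each.
  -- Both inside contribute only for `k = 1`, at two placements. None inside gives zero.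
  have key : ∀ p q : Fin (n + 2), (if p = q then 0 else wordSign p q •
      (bracket N b (n + 2 - (k + 1) + 1) (Fin.cons
        (bracket N b (k + 1) (headArgs (k + 1) k.isLt (word f g A p q)))
        (tailArgs (k + 1) (word f g A p q)))).2)
      = (if p ≤ k then if k < q then X f g else 0 else 0)
        - (if k < p then if q ≤ k then X g f else 0 else 0)
        - ((if p = 0 then if q = 1 then if (k : ℕ) = 1 then Z else 0 else 0 else 0)
          + (if p = 1 then if q = 0 then if (k : ℕ) = 1 then Z else 0 else 0 else 0)) := by
    intro p q
    have hZ : ¬ (p ≤ k ∧ q ≤ k) →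
        ((if p = 0 then if q = 1 then if (k : ℕ) = 1 then Z else 0 else 0 else 0)
          + (if p = 1 then if q = 0 then if (k : ℕ) = 1 then Z else 0 else 0 else 0)) = 0 := by
      intro h
      have h01 : (k : ℕ) = 1 → (0 : Fin (n + 2)) ≤ k ∧ (1 : Fin (n + 2)) ≤ k := by
        intro h
        simp [Fin.le_def, h]
      split_ifs <;> simp_all
    rcases le_or_gt p k with hp | hp <;> rcases le_or_gt q k with hq | hq
    · simp only [hp, hq, hp.not_gt, hq.not_gt, if_true, if_false, sub_zero, zero_sub]
      by_cases hpq : p = q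
      · subst hpq
        have : ¬ (p = 0 ∧ p = 1) := by rintro ⟨rfl, h⟩; simp at h
        split_ifs <;> simp_all
      rw [if_neg hpq, nested_word_snd_of_le hb f g A k.isLt hpq hp hq]
      by_cases hk1 : (k : ℕ) = 1
      · rw [Fin.le_def] at hp hq
        rw [Fin.ext_iff] at hpq
        have : p = 0 ∧ q = 1 ∨ p = 1 ∧ q = 0 := by
          simp only [Fin.ext_iff, Fin.val_zero, Fin.val_one]
          omega
        rcases this with ⟨rfl, rfl⟩ | ⟨rfl, rfl⟩ <;> simp [hk1, wordSign, Z]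
      · simp [hk1]
    · rw [if_neg (hp.trans_lt hq).ne, hX f g p q hp hq, hZ (fun h => hq.not_ge h.2)]
      simp [hp, hq, hp.not_gt]
    · have hpq : p ≠ q := (hq.trans_lt hp).ne'
      rw [if_neg hpq, wordSign_comm hpq.symm, word_comm f g A hpq, Units.neg_smul,
        hX g f q p hq hp, hZ (fun h => hp.not_ge h.1)]
      simp [hp, hq, hp.not_ge]
    · rw [nested_word_of_lt f g A k.isLt hp hq, hZ (fun h => hp.not_ge h.1)]
      simp [hp, hq.not_ge, hp.not_ge]
  have hite : ∀ (P : Prop) [Decidable P] (G : Fin (n + 2) → V₁),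
      ∑ q, (if P then G q else 0) = if P then ∑ q, G q else 0 := by
    intro P _ G
    split_ifs <;> simp
  simp_rw [key]
  simp only [Finset.sum_sub_distrib, Finset.sum_add_distrib, hite, sum_ite_le, sum_ite_lt,
    Finset.sum_ite_eq', Finset.mem_univ, if_true]
  simp only [smul_sub, ← Nat.cast_smul_eq_nsmul 𝕜, smul_smul, X, Z]
  congr 1
  · congr 2
    · ring
    · ring
  · split_ifs
    · rw [← add_smul]; ring_nf
    · simp

end TwoTerm
end

noncomputable section

/-! ### The homotopy Jacobi identities and the resulting L-infinity structure. -/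

namespace TwoTerm

open LInfty Equiv

variable {𝕜 : Type*} [Field 𝕜] [CharZero 𝕜]
variable {V₀ : Type*} [AddCommGroup V₀] [Module 𝕜 V₀]
variable {V₁ : Type*} [AddCommGroup V₁] [Module 𝕜 V₁]
variable {N : (m : ℕ) → V₀ →ₗ[𝕜] MultilinearMap 𝕜 (fun _ : Fin m => V₁) V₁}
variable {b : V₀ →ₗ[𝕜] V₀ →ₗ[𝕜] V₀}

theorem word_comp_perm {n : ℕ} (f g : V₀) (A : V₁) (σ : Perm (Fin n)) (p q : Fin n) :
    word f g A p q ∘ σ = word f g A (σ⁻¹ p) (σ⁻¹ q) := by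
  ext1 i
  simp only [Function.comp, word, Perm.eq_inv_iff_eq]

/-- The homotopy Jacobi identity for two elements `f`, `g` of degree zero and copies of an element
`A` of degree one. -/
theorem jacobiator_word_snd (hb : ∀ f g, b f g = -b g f) (hc : Closes N b) {n : ℕ} (f g : V₀)
    (A : V₁) : (jacobiator (bracket N b) (wordDegree n) (word f g A 0 1)).2 = 0 := by
  have h1 : (jacobiator (bracket N b) (wordDegree n) (word f g A 0 1)).2
      = ∑ k : Fin (n + 2), ((-1 : 𝕜) ^ ((k + 1 : ℕ) * (n + 2 - (k + 1))) /
        ((Nat.factorial (k + 1) : 𝕜) * (Nat.factorial (n + 2 - (k + 1)) : 𝕜))) • n.factorial •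
        ∑ p, ∑ q, (if p = q then 0 else wordSign p q •
      (bracket N b (n + 2 - (k + 1) + 1) (Fin.cons
        (bracket N b (k + 1) (headArgs (k + 1) k.isLt (word f g A p q)))
        (tailArgs (k + 1) (word f g A p q)))).2) := by
    rw [jacobiator, Prod.snd_sum]
    refine Finset.sum_congr rfl fun k _ => ?_
    -- Sign and summand depend on `σ` only through `σ⁻¹ 0` and `σ⁻¹ 1`. Summing over inverses turns
    -- these into `σ 0` and `σ 1`, and each pair of positions is hit `n!` times.
    rw [Prod.smul_snd, Prod.snd_sum, ← sum_perm_two_points (fun p q => wordSign p q •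
      (bracket N b (n + 2 - (k + 1) + 1) (Fin.cons
        (bracket N b (k + 1) (headArgs (k + 1) k.isLt (word f g A p q)))
        (tailArgs (k + 1) (word f g A p q)))).2), ← Equiv.sum_comp (Equiv.inv (Perm (Fin (n + 2))))]
    congr 1
    refine Finset.sum_congr rfl fun σ _ => ?_
    have := gradedSign_wordDegree σ⁻¹
    rw [gradedSign] at this
    rw [Equiv.inv_apply, this, Units.smul_def, Prod.smul_snd, ← Units.smul_def, word_comp_perm,
      inv_inv]
  rw [h1]
  obtain ⟨E, hE⟩ : ∃ E : ℕ → ℕ → V₁, ∀ m j, N m g (consConst _ (N j f fun _ => A) A)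
      - N m f (consConst _ (N j g fun _ => A) A) = E m j := ⟨_, fun _ _ => rfl⟩
  simp_rw [sum_nested_word_snd hb, hE, smul_sub]
  rw [Finset.sum_sub_distrib, sub_eq_zero]
  have h2 : ∀ m : ℕ, (m.factorial : 𝕜) ≠ 0 := fun m => by exact_mod_cast m.factorial_ne_zero
  have h3 := congrArg (fun x => (triangleSign 𝕜 n * n.factorial) • x) (hc n f g A)
  simp only [smul_smul, Finset.smul_sum, hE] at h3
  trans triangleSign 𝕜 n • N n (b f g) fun _ => A
  · rw [mul_assoc, mul_inv_cancel₀ (h2 n), mul_one] at h3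
    rw [← h3, Fin.sum_univ_castSucc, ← Fin.sum_univ_eq_sum_range (fun j =>
      (triangleSign 𝕜 n * n.factorial * ((j.factorial : 𝕜) * ((n - j).factorial : 𝕜))⁻¹) • E (n - j + 1) j)]
    -- The full inner bracket leaves no room for a letter outside, so this index contributes nothing
    -- and the range matches that of `Closes`.
    rw [show ((Fin.last (n + 1) : Fin (n + 2)) : ℕ) = n + 1 from rfl]
    rw [show n + 2 - (n + 1 + 1) = 0 by omega]
    simp only [Nat.cast_zero, mul_zero, zero_smul, smul_zero, add_zero]
    refine Finset.sum_congr rfl fun k _ => ?_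
    rw [Fin.val_castSucc]
    obtain ⟨j, hj⟩ := k
    simp only
    obtain ⟨m, rfl⟩ : ∃ m, n = j + m := ⟨n - j, by omega⟩
    rw [show j + m + 2 - (j + 1) = m + 1 by omega, show j + m - j = m by omega,
      ← Nat.cast_smul_eq_nsmul 𝕜, smul_smul, smul_smul, smul_smul]
    congr 1
    rw [triangleSign_succ, triangleSign_add, Nat.factorial_succ, Nat.factorial_succ]
    have h4 := h2 j
    have h5 := h2 m
    have h6 : ((j + 1 : ℕ) : 𝕜) ≠ 0 := by exact_mod_cast Nat.succ_ne_zero j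
    have h7 : ((m + 1 : ℕ) : 𝕜) ≠ 0 := by exact_mod_cast Nat.succ_ne_zero m
    -- The sign left after extracting the triangle signs is `(-1)^(jm)`, exactly the cross term in
    -- `triangleSign (j + m)`.
    have h8 : ((-1 : 𝕜)) ^ ((j + 1) * (m + 1)) * (-1) ^ (j + 1) * (-1) ^ m = (-1) ^ (j * m) := by
      have e1 : ((-1 : 𝕜) ^ j) * (-1) ^ j = 1 := by rw [← mul_pow]; simp
      have e2 : ((-1 : 𝕜) ^ m) * (-1) ^ m = 1 := by rw [← mul_pow]; simp
      rw [show (j + 1) * (m + 1) = j * m + j + m + 1 by ring]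
      simp only [pow_succ, pow_add]
      linear_combination ((-1 : 𝕜) ^ (j * m)) * (e1 * ((-1) ^ m * (-1) ^ m) + e2)
    rw [← h8]
    push_cast at h6 h7 ⊢
    field_simp
  -- Only inner arity two contributes `b f g`; its two placements cancel the factor `2!`, and the
  -- multiplicity `n!` cancels the other factorial.
  · rw [Finset.sum_eq_single (1 : Fin (n + 2))]
    · rw [Fin.val_one, if_pos rfl, ← Nat.cast_smul_eq_nsmul 𝕜, smul_smul, smul_smul, smul_smul]
      congr 1
      rw [show n + 2 - (1 + 1) = n by omega, show (1 + 1) * n = 2 * n by ring, pow_mul]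
      have := h2 n
      simp
      field_simp
    · intro k _ hk
      rw [if_neg (fun h => hk (Fin.ext (by simpa using h)))]
      simp
    · simp

end TwoTerm
end

noncomputable section

namespace TwoTerm

open LInfty Equiv

variable {𝕜 : Type*} [Field 𝕜]
variable {V₀ : Type*} [AddCommGroup V₀] [Module 𝕜 V₀]
variable {V₁ : Type*} [AddCommGroup V₁] [Module 𝕜 V₁]
variable {N : (m : ℕ) → V₀ →ₗ[𝕜] MultilinearMap 𝕜 (fun _ : Fin m => V₁) V₁}
variable {b : V₀ →ₗ[𝕜] V₀ →ₗ[𝕜] V₀}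

/-- The component in `V₀` sees only `b`, so inner and outer brackets must both have arity two. This
forces `n = 3`, where the expression is a multiple of the Jacobi sum of `b`. -/
theorem jacobiator_fst (hb : ∀ f g, b f g = -b g f)
    (hJ : ∀ f g h, b f (b g h) + b g (b h f) + b h (b f g) = 0) {n : ℕ} (d : Fin n → ℤ)
    (v : Fin n → V₀ × V₁) (hv : ∀ i, v i ∈ grading 𝕜 V₀ V₁ (d i)) :
    (jacobiator (bracket N b) d v).1 = 0 := by
  simp only [jacobiator, Prod.fst_sum, Prod.smul_fst, Units.smul_def]
  simp only [bracket_fst]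
  by_cases hn : n = 3
  · subst hn
    rw [Finset.sum_eq_single (1 : Fin 3)]
    · have h1 : ∀ σ : Perm (Fin 3), negBilin b (3 - ((1 : Fin 3) + 1) + 1) (Fin.cons
          (bracket N b ((1 : Fin 3) + 1) (headArgs ((1 : Fin 3) + 1) (1 : Fin 3).isLt (v ∘ σ)))
          (tailArgs ((1 : Fin 3) + 1) (v ∘ σ))) = b (b (v (σ 0)).1 (v (σ 1)).1) (v (σ 2)).1 := by
        intro σ
        have h2 : (bracket N b ((1 : Fin 3) + 1)
            (headArgs ((1 : Fin 3) + 1) (1 : Fin 3).isLt (v ∘ σ))).1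
            = -b (v (σ 0)).1 (v (σ 1)).1 := bracket_fst N b _
        have h3 : ∀ y : Fin 2 → V₀ × V₁, negBilin b (3 - ((1 : Fin 3) + 1) + 1) y
            = -b (y 0).1 (y 1).1 := fun y => rfl
        refine (h3 _).trans ?_
        rw [Fin.cons_zero, h2, map_neg, LinearMap.neg_apply, neg_neg]
        rfl
      simp_rw [h1]
      by_cases hd : ∀ i, d i = 0
      · have h2 : ∀ σ : Perm (Fin 3), koszulSign σ d = 1 := by
          intro σ
          refine Finset.prod_eq_one fun q _ => ?_
          simp [hd]
        have h3 : (Finset.univ : Finset (Perm (Fin 3))) = {1, swap 0 1, swap 0 2, swap 1 2,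
          swap 0 1 * swap 1 2, swap 1 2 * swap 0 1} := by decide
        simp_rw [h2]
        rw [h3]
        rw [Finset.sum_insert (by decide), Finset.sum_insert (by decide),
          Finset.sum_insert (by decide), Finset.sum_insert (by decide),
          Finset.sum_insert (by decide), Finset.sum_singleton]
        have e1 : (swap 0 1 * swap 1 2 : Perm (Fin 3)) 0 = 1 ∧ (swap 0 1 * swap 1 2 : Perm (Fin 3)) 1 = 2
          ∧ (swap 0 1 * swap 1 2 : Perm (Fin 3)) 2 = 0 := by decide
        have e2 : (swap 1 2 * swap 0 1 : Perm (Fin 3)) 0 = 2 ∧ (swap 1 2 * swap 0 1 : Perm (Fin 3)) 1 = 0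
          ∧ (swap 1 2 * swap 0 1 : Perm (Fin 3)) 2 = 1 := by decide
        have e3 : (swap 0 1 : Perm (Fin 3)) 2 = 2 ∧ (swap 0 2 : Perm (Fin 3)) 1 = 1 ∧
          (swap 1 2 : Perm (Fin 3)) 0 = 0 := by decide
        have e4 : Perm.sign (swap (0 : Fin 3) 1) = -1 ∧ Perm.sign (swap (0 : Fin 3) 2) = -1 ∧
          Perm.sign (swap (1 : Fin 3) 2) = -1 :=
          ⟨Perm.sign_swap (by decide), Perm.sign_swap (by decide), Perm.sign_swap (by decide)⟩
        simp only [e1, e2, e3, e4, Perm.sign_mul, Perm.sign_one, swap_apply_left, swap_apply_right,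
          Perm.one_apply, mul_one, mul_neg, neg_neg, Units.val_one, Units.val_neg, one_smul,
          neg_smul]
        have key := hJ (v 0).1 (v 1).1 (v 2).1
        rw [hb (v 0).1 (b _ _), hb (v 1).1 (b _ _), hb (v 2).1 (b _ _)] at key
        rw [hb (v 1).1 (v 0).1, hb (v 2).1 (v 1).1, hb (v 0).1 (v 2).1]
        simp only [map_neg, LinearMap.neg_apply]
        convert smul_zero _ using 2
        -- Each of the three cyclic terms occurs twice among the six permutations; the minus sign
        -- comes from moving the inner bracket to the first argument.
        have key2 := congrArg (fun x => (-2 : ℤ) • x) key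
        refine Eq.trans ?_ (key2.trans (smul_zero _))
        abel
      · push Not at hd
        obtain ⟨i, hi⟩ := hd
        have hvi := (mem_grading.mp (hv i)).1 hi
        convert smul_zero _ using 2
        refine Finset.sum_eq_zero fun σ _ => ?_
        obtain ⟨j, rfl⟩ := σ.surjective i
        fin_cases j <;> simp only [Fin.mk_zero, Fin.mk_one, Fin.reduceFinMk] at hvi <;> simp [hvi]
    · intro k _ hk
      convert smul_zero _ using 2
      refine Finset.sum_eq_zero fun σ _ => ?_
      rw [negBilin_of_ne_two]
      · simp
      · fin_cases k <;> simp at hk ⊢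
    · simp
  · refine Finset.sum_eq_zero fun k _ => ?_
    convert smul_zero _ using 2
    refine Finset.sum_eq_zero fun σ _ => ?_
    convert smul_zero _ using 2
    have hk := k.isLt
    by_cases h : (k : ℕ) + 1 = 2
    · rw [negBilin_of_ne_two _ (by omega)]; rfl
    · refine negBilin_eq_zero b _ 0 ?_
      rw [Fin.cons_zero, bracket_fst, negBilin_of_ne_two _ h]; rfl

/-- With `f` and `g` fixed, the expression is symmetric in the degree one arguments, since a graded
skew expression has sign `+1` under exchange of two such letters. Polarization therefore reduces it
to `jacobiator_word_snd`. -/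
theorem jacobiator_snd [CharZero 𝕜] (hb : ∀ f g, b f g = -b g f) (hc : Closes N b) {n : ℕ} (f g : V₀) (A : Fin n → V₁) :
    (jacobiator (bracket N b) (wordDegree n)
      (Fin.cons (f, 0) (Fin.cons (g, 0) fun i => (0, A i)))).2 = 0 := by
  let F : MultilinearMap 𝕜 (fun _ : Fin n => V₁) V₁ :=
    (LinearMap.snd 𝕜 V₀ V₁).compMultilinearMap
      ((((jacobiatorMap (bracket N b) (wordDegree n)).curryLeft (f, 0)).curryLeft
        (g, 0)).compLinearMap fun _ => LinearMap.inr 𝕜 V₀ V₁)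
  have hF : ∀ A, F A = (jacobiator (bracket N b) (wordDegree n)
      (Fin.cons (f, 0) (Fin.cons (g, 0) fun i => (0, A i)))).2 := by
    intro A
    rw [← jacobiatorMap_apply]
    rfl
  rw [← hF]
  refine eq_zero_of_diagonal F (fun σ => ?_) (fun A => ?_) A
  · induction σ using perm_induction with
    | one => intro v; rfl
    | mul σ i j hij ih =>
      intro A
      rw [← ih A, hF, hF, Perm.coe_mul, ← Function.comp_assoc]
      generalize A ∘ σ = A
      have hij' : (i.succ.succ : ℕ) + 1 = j.succ.succ := by simp [hij]
      have h1 := jacobiator_comp_perm (bracket N b) (wordDegree n)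
        (Fin.cons (f, 0) (Fin.cons (g, 0) fun i => (0, A i))) (swap i.succ.succ j.succ.succ)
      rw [gradedSign_swap _ _ _ hij'] at h1
      have h2 : ∀ k : Fin n, wordDegree n k.succ.succ = 1 := by
        intro k
        simp [wordDegree, Fin.ext_iff]
      have hs : ∀ k : Fin n, swap i.succ.succ j.succ.succ k.succ.succ = (swap i j k).succ.succ := by
        intro k
        rw [(Fin.succ_injective _).swap_apply, (Fin.succ_injective _).swap_apply]
      have hs0 : swap i.succ.succ j.succ.succ 0 = 0 :=
        swap_apply_of_ne_of_ne (Fin.succ_ne_zero _).symm (Fin.succ_ne_zero _).symm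
      have hs1 : swap i.succ.succ j.succ.succ 1 = 1 :=
        swap_apply_of_ne_of_ne (by simp [Fin.ext_iff]) (by simp [Fin.ext_iff])
      have h3 : wordDegree n ∘ swap i.succ.succ j.succ.succ = wordDegree n := by
        ext k
        refine Fin.cases (by simp [hs0]) (fun k => Fin.cases (by simp [hs1]) (fun k => ?_) k) k
        simp [hs, h2]
      have h4 : (Fin.cons (f, 0) (Fin.cons (g, 0) fun i => (0, A i)) : Fin (n + 2) → V₀ × V₁)
          ∘ swap i.succ.succ j.succ.succ
          = Fin.cons (f, 0) (Fin.cons (g, 0) fun k => (0, (A ∘ swap i j) k)) := by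
        ext1 k
        refine Fin.cases (by simp [hs0]) (fun k => Fin.cases ?_ (fun k => ?_) k) k
        · rw [Function.comp, Fin.succ_zero_eq_one, hs1]; rfl
        · rw [Function.comp, hs]; rfl
      rw [h2, h2, h3, h4] at h1
      rw [h1]
      simp
  · rw [hF]
    have h1 : (Fin.cons (f, 0) (Fin.cons (g, 0) fun _ => (0, A)) : Fin (n + 2) → V₀ × V₁)
        = word f g A 0 1 := by
      ext1 k
      refine Fin.cases (by simp [word]) (fun k => Fin.cases ?_ (fun k => ?_) k) k
      · simp [word]
      · simp [word, Fin.ext_iff]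
    rw [h1]
    exact jacobiator_word_snd hb hc f g A

/-- The sum condition says that exactly two entries are zero, and monotonicity puts them in front.
-/
theorem eq_wordDegree {n : ℕ} {d : Fin n → ℤ} (hd : Monotone d) (h01 : ∀ i, d i = 0 ∨ d i = 1)
    (hs : (∑ i, d i) + 2 = n) : ∃ m, ∃ h : n = m + 2, d = wordDegree m ∘ Fin.cast h := by
  have hle : ∀ i, d i ≤ 1 := fun i => by rcases h01 i with h | h <;> omega
  have hge : ∀ i, 0 ≤ d i := fun i => by rcases h01 i with h | h <;> omega
  obtain _ | _ | m := n
  · simp at hs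
  · have := hge 0
    simp at hs
    omega
  refine ⟨m, rfl, ?_⟩
  rw [Fin.sum_univ_succ, Fin.sum_univ_succ] at hs
  have h2 : ∑ i : Fin m, d i.succ.succ ≤ m := by
    refine (Finset.sum_le_card_nsmul _ _ 1 fun i _ => hle _).trans ?_
    simp
  rw [Fin.succ_zero_eq_one] at hs
  push_cast at hs
  have hd0 := hge 0
  have hd1 := hge 1
  have h1 : d 0 ≤ d 1 := hd (Fin.zero_le _)
  have h3 : d 1 * m ≤ ∑ i : Fin m, d i.succ.succ := by
    have := Finset.card_nsmul_le_sum Finset.univ (fun i : Fin m => d i.succ.succ) (d 1)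
      fun i _ => hd (by simp [Fin.le_def])
    simpa [mul_comm] using this
  have h0 : d 0 = 0 ∧ d 1 = 0 := by
    -- If the second entry were `1`, so would be all later ones, and the sum would be too large.
    rcases h01 1 with h | h
    · omega
    · rw [h] at h3 hs; omega
  have h3 : ∑ i : Fin m, (1 - d i.succ.succ) = 0 := by
    rw [Finset.sum_sub_distrib]; simp; omega
  rw [Finset.sum_eq_zero_iff_of_nonneg (fun i _ => by have := hle i.succ.succ; omega)] at h3
  ext i
  refine Fin.cases ?_ (fun i => Fin.cases ?_ (fun i => ?_) i) i
  · simpa [wordDegree] using h0.1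
  · simpa [wordDegree] using h0.2
  · have := h3 i (Finset.mem_univ _)
    simp [wordDegree, Fin.ext_iff]
    omega

/-- The expression has degree `∑ dᵢ + 3 - n`, so its component in `V₁` can be nonzero only if this
is `1`, that is with two letters of degree zero. Graded skewness allows these to be sorted to the
front. -/
theorem bracket_jacobi [CharZero 𝕜]
    (hb : ∀ f g, b f g = -b g f)
    (hJ : ∀ f g h, b f (b g h) + b g (b h f) + b h (b f g) = 0) (hc : Closes N b) (n : ℕ)
    (d : Fin n → ℤ) (v : Fin n → V₀ × V₁) (hv : ∀ i, v i ∈ grading 𝕜 V₀ V₁ (d i)) :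
    jacobiator (bracket N b) d v = 0 := by
  by_cases h01 : ∀ i, d i = 0 ∨ d i = 1
  swap
  · push Not at h01
    obtain ⟨i, hi⟩ := h01
    have := mem_grading.mp (hv i)
    exact jacobiator_eq_zero_of_apply_eq_zero _ d v i (Prod.ext (this.1 hi.1) (this.2 hi.2))
  refine Prod.ext (jacobiator_fst hb hJ d v hv) ?_
  by_cases hs : (∑ i, d i) + 2 = n
  swap
  · exact (mem_grading.mp (jacobiator_mem (bracket_degree N b) d v hv)).2 (by omega)
  have hcomp := jacobiator_comp_perm (bracket N b) d v (Tuple.sort d)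
  suffices h : (jacobiator (bracket N b) (d ∘ Tuple.sort d) (v ∘ Tuple.sort d)).2 = 0 by
    rw [hcomp, Units.smul_def, Prod.smul_snd, ← Units.smul_def] at h
    exact (smul_eq_zero_iff_eq _).mp h
  obtain ⟨m, rfl, hm⟩ := eq_wordDegree (Tuple.monotone_sort d) (fun i => h01 _)
    (by rw [← hs]; congr 1; exact Equiv.sum_comp _ d)
  have hv' : ∀ i, (v ∘ Tuple.sort d) i ∈ grading 𝕜 V₀ V₁ ((d ∘ Tuple.sort d) i) := fun i => hv _
  generalize v ∘ Tuple.sort d = w at *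
  generalize d ∘ Tuple.sort d = e at *
  obtain rfl : e = wordDegree m := hm
  have h1 : w = Fin.cons ((w 0).1, 0) (Fin.cons ((w 1).1, 0) fun i => (0, (w i.succ.succ).2)) := by
    ext1 i
    refine Fin.cases ?_ (fun i => Fin.cases ?_ (fun i => ?_) i) i
    · exact Prod.ext rfl ((mem_grading.mp (hv' 0)).2 (by simp [wordDegree]))
    · exact Prod.ext rfl ((mem_grading.mp (hv' 1)).2 (by simp [wordDegree]))
    · exact Prod.ext ((mem_grading.mp (hv' i.succ.succ)).1 (by simp [wordDegree, Fin.ext_iff])) rfl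
  rw [h1]
  exact jacobiator_snd hb hc _ _ _

/-- The L-infinity structure of an action of the Lie algebra `(V₀, b)` on `V₁` by formal vector
fields `∑ₙ Nₙ(f)(A, …, A) / n!`. -/
def lInftyStructure [CharZero 𝕜]
    (hN : ∀ m f (σ : Perm (Fin m)) (x : Fin m → V₁), N m f (x ∘ σ) = N m f x)
    (hb : ∀ f g, b f g = -b g f)
    (hJ : ∀ f g h, b f (b g h) + b g (b h f) + b h (b f g) = 0) (hc : Closes N b) :
    LInftyStructure (grading 𝕜 V₀ V₁) where
  bracket := bracket N b
  flat := rfl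
  degree := bracket_degree N b
  skew := bracket_skew hN hb
  jacobi := bracket_jacobi hb hJ hc

end TwoTerm
end

noncomputable section

/-! ### The identity as an L-infinity morphism. -/

namespace LInfty

open Equiv

variable {𝕜 : Type*} [Field 𝕜]
variable {W : Type*} [AddCommGroup W] [Module 𝕜 W]
variable {W' : Type*} [AddCommGroup W'] [Module 𝕜 W']

variable (𝕜 W) in
/-- The components of the identity morphism. -/
def idComponent : (n : ℕ) → MultilinearMap 𝕜 (fun _ : Fin n => W) W
  | 1 => MultilinearMap.ofSubsingleton 𝕜 W W (0 : Fin 1) LinearMap.id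
  | _ => 0

theorem idComponent_one (v : Fin 1 → W) : idComponent 𝕜 W 1 v = v 0 := rfl

theorem idComponent_of_ne_one {n : ℕ} (hn : n ≠ 1) : idComponent 𝕜 W n = 0 := by
  unfold idComponent
  split
  · exact absurd rfl hn
  · rfl

theorem decalage_idComponent {n : ℕ} (hn : n = 1) (d : Fin n → ℤ) (v : Fin n → W) :
    decalage (idComponent 𝕜 W n) d v = v ⟨0, by omega⟩ := by
  subst hn
  simp [decalage, idComponent_one]

theorem decalage_eq_zero {n : ℕ} (F : MultilinearMap 𝕜 (fun _ : Fin n => W) W') (d : Fin n → ℤ)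
    (v : Fin n → W) (i : Fin n) (hi : v i = 0) : decalage F d v = 0 := by
  rw [decalage, F.map_coord_zero i hi, smul_zero]

theorem decalage_idComponent_of_ne_one {n : ℕ} (hn : n ≠ 1) (d : Fin n → ℤ) (v : Fin n → W) :
    decalage (idComponent 𝕜 W n) d v = 0 := by
  rw [idComponent_of_ne_one hn]
  simp [decalage]

/-- Needed because the length of `Composition.ones n` equals `n` only propositionally. -/
theorem decalage_cast (l : (n : ℕ) → MultilinearMap 𝕜 (fun _ : Fin n => W) W') {m n : ℕ}
    (h : n = m) (d : Fin m → ℤ) (v : Fin m → W) :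
    decalage (l m) d v = decalage (l n) (d ∘ Fin.cast h) (v ∘ Fin.cast h) := by
  subst h; rfl

theorem sum_fin_of_eq_one {M : Type*} [AddCommMonoid M] {n : ℕ} (hn : n = 1) (f : Fin n → M) :
    ∑ i, f i = f ⟨0, by omega⟩ := by
  subst hn; simp

/-- Only the linear component is nonzero, so the inner bracket must take all arguments. -/
theorem morphismSource_idComponent (l : (n : ℕ) → MultilinearMap 𝕜 (fun _ : Fin n => W) W) {n : ℕ}
    (hn : n ≠ 0) (d : Fin n → ℤ) (v : Fin n → W) :
    morphismSource l (idComponent 𝕜 W) d v = ((1 : 𝕜) / (n.factorial : 𝕜)) •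
      ∑ σ : Perm (Fin n), koszulSign σ (fun i => d i - 1) • decalage (l n) (d ∘ σ) (v ∘ σ) := by
  obtain ⟨m, rfl⟩ := Nat.exists_eq_succ_of_ne_zero hn
  unfold morphismSource
  rw [Finset.sum_eq_single (Fin.last m)]
  · congr 1
    · simp
    · refine Finset.sum_congr rfl fun σ _ => ?_
      rw [decalage_idComponent (by simp)]
      rfl
  · intro k _ hk
    have h1 : (k : ℕ) ≠ m := fun h => hk (Fin.ext h)
    have h2 := k.isLt
    convert smul_zero _ using 2
    refine Finset.sum_eq_zero fun σ _ => ?_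
    rw [decalage_idComponent_of_ne_one (by omega), smul_zero]
  · simp

/-- Every block must have size one, leaving the composition into ones and the same symmetrized
bracket as on the source side. -/
theorem morphismTarget_idComponent (l : (n : ℕ) → MultilinearMap 𝕜 (fun _ : Fin n => W) W) {n : ℕ}
    (d : Fin n → ℤ) (v : Fin n → W) :
    morphismTarget l (idComponent 𝕜 W) d v = ((1 : 𝕜) / (n.factorial : 𝕜)) •
      ∑ σ : Perm (Fin n), koszulSign σ (fun i => d i - 1) • decalage (l n) (d ∘ σ) (v ∘ σ) := by
  unfold morphismTarget
  rw [Finset.sum_eq_single (Composition.ones n)]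
  · congr 1
    · simp
    · refine Finset.sum_congr rfl fun σ _ => ?_
      rw [decalage_cast l (Composition.ones_length n).symm]
      congr 2
      · ext j
        simp only [Function.comp]
        rw [sum_fin_of_eq_one (by simp), Composition.ones_embedding]
        simp
      · ext1 j
        simp only [Function.comp]
        rw [decalage_idComponent (by simp), Composition.ones_embedding]
        rfl
  · intro c _ hc
    obtain ⟨j, hj⟩ : ∃ j, c.blocksFun j ≠ 1 := by
      by_contra! h
      refine hc (Composition.eq_ones_iff.mpr fun i hi => ?_)
      obtain ⟨j, rfl⟩ := List.mem_iff_get.mp hi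
      exact h j
    convert smul_zero _ using 2
    refine Finset.sum_eq_zero fun σ _ => ?_
    rw [decalage_eq_zero _ _ _ j (decalage_idComponent_of_ne_one hj _ _), smul_zero]
  · simp

/-- Two L-infinity structures with the same brackets are quasi-isomorphic via the identity. -/
theorem exists_isQuasiIso_of_bracket_eq [CharZero 𝕜] {𝒱 : ℤ → Submodule 𝕜 W} (L L' : LInftyStructure 𝒱)
    (h : ∀ (n : ℕ) (d : Fin n → ℤ) (v : Fin n → W), (∀ i, v i ∈ 𝒱 (d i)) →
      L.bracket n v = L'.bracket n v) : ∃ φ : LInftyMorphism L L', φ.IsQuasiIso := by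
  have h1 : ∀ (i : ℤ) (x : W), x ∈ 𝒱 i → L.bracket 1 ![x] = L'.bracket 1 ![x] := fun i x hx =>
    h 1 (fun _ => i) _ fun j => by fin_cases j; exact hx
  refine ⟨⟨idComponent 𝕜 W, rfl, ?_, ?_, ?_⟩, ?_, ?_⟩
  · intro n d v hv
    by_cases hn : n = 1
    · subst hn
      rw [idComponent_one]
      simpa using hv 0
    · rw [idComponent_of_ne_one hn]
      exact Submodule.zero_mem _
  · intro n d v hv i j hij
    by_cases hn : n = 1
    · omega
    · rw [idComponent_of_ne_one hn]
      simp
  · intro n d v hv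
    rw [morphismTarget_idComponent]
    -- In arity zero the source sum is empty while the target has the term `ℓ'₀`, which is zero by
    -- flatness.
    by_cases hn : n = 0
    · subst hn
      simp [morphismSource, decalage, L'.flat]
    · rw [morphismSource_idComponent _ hn]
      congr 1
      refine Finset.sum_congr rfl fun σ _ => ?_
      rw [decalage, decalage, h n (d ∘ σ) (v ∘ σ) fun i => hv _]
  · rintro i v hv - ⟨w, hw, hvw⟩
    exact ⟨w, hw, by rw [h1 _ w hw]; exact hvw⟩
  · intro i w hw hw0
    refine ⟨w, hw, by rw [h1 _ w hw, hw0], 0, Submodule.zero_mem _, ?_⟩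
    rw [(L'.bracket 1).map_coord_zero 0 rfl]
    exact sub_self w

end LInfty

/-! ### Graded skew brackets are determined by their diagonal values. -/

namespace TwoTerm

open LInfty Equiv

variable {𝕜 : Type*} [Field 𝕜]
variable {V₀ : Type*} [AddCommGroup V₀] [Module 𝕜 V₀]
variable {V₁ : Type*} [AddCommGroup V₁] [Module 𝕜 V₁]

/-- A bracket of degree `2 - n` lands in `V₁` exactly when `∑ dᵢ + 1 = n`; sorted degrees in `{0,
1}` then have one zero, in front. -/
theorem eq_cons_zero_one {n : ℕ} {d : Fin n → ℤ} (hd : Monotone d) (h01 : ∀ i, d i = 0 ∨ d i = 1)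
    (hs : (∑ i, d i) + 1 = n) :
    ∃ m, ∃ h : n = m + 1, d = (Fin.cons 0 fun _ => 1 : Fin (m + 1) → ℤ) ∘ Fin.cast h := by
  have hle : ∀ i, d i ≤ 1 := fun i => by rcases h01 i with h | h <;> omega
  obtain _ | m := n
  · simp at hs
  refine ⟨m, rfl, ?_⟩
  rw [Fin.sum_univ_succ] at hs
  push_cast at hs
  have h3 : d 0 * m ≤ ∑ i : Fin m, d i.succ := by
    have := Finset.card_nsmul_le_sum Finset.univ (fun i : Fin m => d i.succ) (d 0)
      fun i _ => hd (Fin.zero_le _)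
    simpa [mul_comm] using this
  have h0 : d 0 = 0 := by
    rcases h01 0 with h | h
    · exact h
    · rw [h] at h3 hs; omega
  have h4 : ∑ i : Fin m, (1 - d i.succ) = 0 := by
    rw [Finset.sum_sub_distrib]; simp; omega
  rw [Finset.sum_eq_zero_iff_of_nonneg (fun i _ => by have := hle i.succ; omega)] at h4
  ext i
  refine Fin.cases (by simpa using h0) (fun i => ?_) i
  have := h4 i (Finset.mem_univ _)
  simp
  omega

/-- A graded skew-symmetric multilinear map vanishes on `(f, A₁, …, Aₙ)` if it does so on
`(f, A, …, A)`. -/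
theorem apply_cons_eq_zero [CharZero 𝕜] {n : ℕ} {H : MultilinearMap 𝕜 (fun _ : Fin (n + 1) => V₀ × V₁) (V₀ × V₁)}
    (hskew : IsGradedSkew (grading 𝕜 V₀ V₁) H) (f : V₀)
    (h : ∀ A : V₁, H (Fin.cons (f, 0) fun _ => (0, A)) = 0) (A : Fin n → V₁) :
    H (Fin.cons (f, 0) fun i => (0, A i)) = 0 := by
  let F : MultilinearMap 𝕜 (fun _ : Fin n => V₁) (V₀ × V₁) :=
    (H.curryLeft (f, 0)).compLinearMap fun _ => LinearMap.inr 𝕜 V₀ V₁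
  refine eq_zero_of_diagonal F (fun σ => ?_) h A
  induction σ using perm_induction with
  | one => intro v; rfl
  | mul σ i j hij ih =>
    intro A
    rw [← ih A, Perm.coe_mul, ← Function.comp_assoc]
    generalize A ∘ σ = A
    have hij' : (i.succ : ℕ) + 1 = j.succ := by simp [hij]
    have h1 := hskew (Fin.cons 0 fun _ => 1) (Fin.cons (f, 0) fun i => (0, A i))
      (Fin.cases (by simp [mem_grading]) fun i => by simp [mem_grading]) i.succ j.succ hij'
    have hs0 : swap i.succ j.succ 0 = 0 :=
      swap_apply_of_ne_of_ne (Fin.succ_ne_zero _).symm (Fin.succ_ne_zero _).symm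
    have h4 : (Fin.cons (f, 0) fun i => (0, A i) : Fin (n + 1) → V₀ × V₁) ∘ swap i.succ j.succ
        = Fin.cons (f, 0) fun k => (0, (A ∘ swap i j) k) := by
      ext1 k
      refine Fin.cases (by simp [hs0]) (fun k => ?_) k
      rw [Function.comp, (Fin.succ_injective _).swap_apply]; rfl
    rw [h4] at h1
    simp only [Fin.cons_succ, mul_one, Int.negOnePow_one, Units.neg_smul, one_smul, neg_neg] at h1
    exact h1.symm

/-- A graded skew-symmetric multilinear map vanishes on `(f, g, A₁, …, Aₙ)` if it does so on
`(f, g, A, …, A)`. -/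
theorem apply_cons_cons_eq_zero [CharZero 𝕜] {n : ℕ}
    {H : MultilinearMap 𝕜 (fun _ : Fin (n + 2) => V₀ × V₁) (V₀ × V₁)}
    (hskew : IsGradedSkew (grading 𝕜 V₀ V₁) H) (f g : V₀)
    (h : ∀ A : V₁, H (Fin.cons (f, 0) (Fin.cons (g, 0) fun _ => (0, A))) = 0) (A : Fin n → V₁) :
    H (Fin.cons (f, 0) (Fin.cons (g, 0) fun i => (0, A i))) = 0 := by
  -- Fixing the first argument preserves graded skewness in the remaining ones, which reduces the
  -- claim to the case of one function.
  have hskew' : IsGradedSkew (grading 𝕜 V₀ V₁) (H.curryLeft (f, 0)) := by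
    intro d v hv i j hij
    have h1 := hskew (Fin.cons 0 d) (Fin.cons (f, 0) v)
      (Fin.cases (by simp [mem_grading]) fun i => by simpa using hv i) i.succ j.succ
      (by simp [hij])
    have hs0 : swap i.succ j.succ 0 = 0 :=
      swap_apply_of_ne_of_ne (Fin.succ_ne_zero _).symm (Fin.succ_ne_zero _).symm
    have h4 : (Fin.cons (f, 0) v : Fin (n + 2) → V₀ × V₁) ∘ swap i.succ j.succ
        = Fin.cons (f, 0) (v ∘ swap i j) := by
      ext1 k
      refine Fin.cases (by simp [hs0]) (fun k => ?_) k
      rw [Function.comp, (Fin.succ_injective _).swap_apply]; rfl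
    rw [h4] at h1
    exact h1
  exact apply_cons_eq_zero hskew' g h A

/-- A graded skew-symmetric multilinear map of degree `2 - n` is determined by its values on
`(f, A, …, A)` and `(f, g, A, …, A)`. -/
theorem eq_zero_of_diagonals [CharZero 𝕜] {H : (n : ℕ) → MultilinearMap 𝕜 (fun _ : Fin n => V₀ × V₁) (V₀ × V₁)}
    (hdeg : ∀ n : ℕ, IsOfDegree (grading 𝕜 V₀ V₁) (grading 𝕜 V₀ V₁) (H n) (2 - n))
    (hskew : ∀ n : ℕ, IsGradedSkew (grading 𝕜 V₀ V₁) (H n))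
    (h1 : ∀ n (f : V₀) (A : V₁), H (n + 1) (Fin.cons (f, 0) fun _ => (0, A)) = 0)
    (h2 : ∀ n (f g : V₀) (A : V₁),
      H (n + 2) (Fin.cons (f, 0) (Fin.cons (g, 0) fun _ => (0, A))) = 0)
    (n : ℕ) (d : Fin n → ℤ) (v : Fin n → V₀ × V₁) (hv : ∀ i, v i ∈ grading 𝕜 V₀ V₁ (d i)) :
    H n v = 0 := by
  by_cases h01 : ∀ i, d i = 0 ∨ d i = 1
  swap
  · push Not at h01
    obtain ⟨i, hi⟩ := h01
    have := mem_grading.mp (hv i)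
    exact MultilinearMap.map_coord_zero _ i (Prod.ext (this.1 hi.1) (this.2 hi.2))
  suffices h : H n (v ∘ Tuple.sort d) = 0 by
    rw [(hskew n).apply_perm (Tuple.sort d) d v hv, h, smul_zero]
  have hmon := Tuple.monotone_sort d
  have h01' : ∀ i, (d ∘ Tuple.sort d) i = 0 ∨ (d ∘ Tuple.sort d) i = 1 := fun i => h01 _
  have hv' : ∀ i, (v ∘ Tuple.sort d) i ∈ grading 𝕜 V₀ V₁ ((d ∘ Tuple.sort d) i) := fun i => hv _
  generalize v ∘ Tuple.sort d = w at *
  generalize d ∘ Tuple.sort d = e at *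
  have hmem := mem_grading.mp (hdeg n e w hv')
  by_cases hs1 : (∑ i, e i) + 1 = n
  · obtain ⟨m, rfl, hm⟩ := eq_cons_zero_one hmon h01' hs1
    obtain rfl : e = Fin.cons 0 fun _ => 1 := hm
    have : w = Fin.cons ((w 0).1, 0) fun i => (0, (w i.succ).2) := by
      ext1 i
      refine Fin.cases ?_ (fun i => ?_) i
      · exact Prod.ext rfl ((mem_grading.mp (hv' 0)).2 (by simp))
      · exact Prod.ext ((mem_grading.mp (hv' i.succ)).1 (by simp)) rfl
    rw [this]
    exact apply_cons_eq_zero (hskew _) _ (h1 _ _) _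
  by_cases hs2 : (∑ i, e i) + 2 = n
  · obtain ⟨m, rfl, hm⟩ := eq_wordDegree hmon h01' hs2
    obtain rfl : e = wordDegree m := hm
    have : w = Fin.cons ((w 0).1, 0) (Fin.cons ((w 1).1, 0) fun i => (0, (w i.succ.succ).2)) := by
      ext1 i
      refine Fin.cases ?_ (fun i => Fin.cases ?_ (fun i => ?_) i) i
      · exact Prod.ext rfl ((mem_grading.mp (hv' 0)).2 (by simp [wordDegree]))
      · exact Prod.ext rfl ((mem_grading.mp (hv' 1)).2 (by simp [wordDegree]))
      · exact Prod.ext ((mem_grading.mp (hv' i.succ.succ)).1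
          (by simp [wordDegree, Fin.ext_iff])) rfl
    rw [this]
    exact apply_cons_cons_eq_zero (hskew _) _ _ (h2 _ _ _) _
  -- With any other number of functions the value has degree outside `{0, 1}`.
  · exact Prod.ext (hmem.1 (by omega)) (hmem.2 (by omega))

/-- L-infinity structures on `V₀ ⊕ V₁` with the same values on `(f, A, …, A)` and
`(f, g, A, …, A)` agree on homogeneous elements. -/
theorem bracket_eq_of_diagonals [CharZero 𝕜] (L L' : LInftyStructure (grading 𝕜 V₀ V₁))
    (h1 : ∀ n (f : V₀) (A : V₁), L.bracket (n + 1) (Fin.cons (f, 0) fun _ => (0, A))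
      = L'.bracket (n + 1) (Fin.cons (f, 0) fun _ => (0, A)))
    (h2 : ∀ n (f g : V₀) (A : V₁),
      L.bracket (n + 2) (Fin.cons (f, 0) (Fin.cons (g, 0) fun _ => (0, A)))
        = L'.bracket (n + 2) (Fin.cons (f, 0) (Fin.cons (g, 0) fun _ => (0, A))))
    (n : ℕ) (d : Fin n → ℤ) (v : Fin n → V₀ × V₁) (hv : ∀ i, v i ∈ grading 𝕜 V₀ V₁ (d i)) :
    L.bracket n v = L'.bracket n v := by
  rw [← sub_eq_zero]
  refine eq_zero_of_diagonals (H := fun n => L.bracket n - L'.bracket n) (fun n d v hv => ?_)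
    (fun n d v hv i j hij => ?_) (fun n f A => ?_) (fun n f g A => ?_) n d v hv
  · exact Submodule.sub_mem _ (L.degree n d v hv) (L'.degree n d v hv)
  · rw [sub_apply, sub_apply, smul_sub, neg_sub',
      L.skew n d v hv i j hij, L'.skew n d v hv i j hij]
  · exact sub_eq_zero.mpr (h1 n f A)
  · exact sub_eq_zero.mpr (h2 n f g A)

end TwoTerm
end

noncomputable section

/-! ## The Poisson bracket defined by a symplectic form -/

namespace PoissonAlgebra

variable {R : Type*} [CommRing R] {ι : Type*} [Fintype ι] [DecidableEq ι]

theorem inv_skew {ω : Matrix ι ι R} (hs : ∀ a b, ω a b = -ω b a) (hu : IsUnit ω.det) (a b : ι) :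
    ω⁻¹ a b = -ω⁻¹ b a := by
  have h1 : ω.transpose = -ω := by
    ext a b
    exact hs b a
  have h2 : -ω⁻¹.transpose = ω⁻¹ := by
    symm
    refine Matrix.inv_eq_left_inv ?_
    rw [Matrix.neg_mul, ← Matrix.mul_neg, ← h1, ← Matrix.transpose_mul, Matrix.mul_nonsing_inv _ hu,
      Matrix.transpose_one]
  exact (congrFun (congrFun h2 a) b).symm

/-- Apply `D` to `ω⁻¹ ω = 1` and multiply by `ω⁻¹` on the right. -/
theorem derivation_inv (D : R →+ R)
    (hL : ∀ F G, D (F * G) = F * D G + G * D F) {ω : Matrix ι ι R} (hu : IsUnit ω.det) (b c : ι) :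
    D (ω⁻¹ b c) = -∑ e, ∑ f, ω⁻¹ b e * D (ω e f) * ω⁻¹ f c := by
  have h1 : ω⁻¹.map D * ω + ω⁻¹ * ω.map D = 0 := by
    ext i j
    have := congrArg D (congrFun (congrFun (Matrix.nonsing_inv_mul ω hu) i) j)
    rw [Matrix.mul_apply, map_sum] at this
    simp only [hL, Finset.sum_add_distrib] at this
    have h3 : D 1 = 0 := by simpa using hL 1 1
    have h2 : D ((1 : Matrix ι ι R) i j) = 0 := by
      rw [Matrix.one_apply]
      split_ifs <;> simp [h3]
    rw [h2] at this
    simp only [Matrix.add_apply, Matrix.mul_apply, Matrix.map_apply, Matrix.zero_apply]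
    rw [← this, add_comm]
    simp only [mul_comm]
  have h2 : ω⁻¹.map D = -(ω⁻¹ * ω.map D * ω⁻¹) := by
    rw [← Matrix.neg_mul, ← eq_neg_of_add_eq_zero_left h1, Matrix.mul_assoc,
      Matrix.mul_nonsing_inv _ hu, Matrix.mul_one]
  have h3 := congrFun (congrFun h2 b) c
  rw [Matrix.map_apply] at h3
  rw [h3, Matrix.neg_apply, Matrix.mul_apply]
  simp only [Matrix.mul_apply, Finset.sum_mul, Matrix.map_apply]
  rw [Finset.sum_comm]

/-- The Schouten bracket of the inverse of a closed two-form with itself vanishes. -/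
theorem jacobi_inv (D : ι → R →+ R) (hL : ∀ a F G, D a (F * G) = F * D a G + G * D a F)
    {ω : Matrix ι ι R} (hs : ∀ a b, ω a b = -ω b a)
    (hu : IsUnit ω.det) (hc : ∀ a b c, D a (ω b c) + D b (ω c a) + D c (ω a b) = 0) (a b c : ι) :
    ∑ e, (ω⁻¹ a e * D e (ω⁻¹ b c) + ω⁻¹ b e * D e (ω⁻¹ c a) + ω⁻¹ c e * D e (ω⁻¹ a b)) = 0 := by
  -- Each cyclic term is a derivative of `ω` with all three indices raised; the sign of
  -- `derivation_inv` is absorbed by skewness of `ω⁻¹`. After cyclic relabelling the sum is `dω`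
  -- with indices raised.
  have key : ∀ a b c, ∑ e, ω⁻¹ a e * D e (ω⁻¹ b c)
      = ∑ x, ∑ y, ∑ z, ω⁻¹ a x * ω⁻¹ b y * ω⁻¹ c z * D x (ω y z) := by
    intro a b c
    refine Finset.sum_congr rfl fun x _ => ?_
    rw [derivation_inv _ (hL _) hu, mul_neg, Finset.mul_sum, ← Finset.sum_neg_distrib]
    refine Finset.sum_congr rfl fun y _ => ?_
    rw [Finset.mul_sum, ← Finset.sum_neg_distrib]
    refine Finset.sum_congr rfl fun z _ => ?_
    rw [inv_skew hs hu z c]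
    ring
  rw [Finset.sum_add_distrib, Finset.sum_add_distrib, key, key, key]
  have h2 : ∑ x, ∑ y, ∑ z, ω⁻¹ b x * ω⁻¹ c y * ω⁻¹ a z * D x (ω y z)
      = ∑ x, ∑ y, ∑ z, ω⁻¹ a x * ω⁻¹ b y * ω⁻¹ c z * D y (ω z x) := by
    simp_rw [← Finset.sum_product']
    refine Finset.sum_nbij' (fun p => (p.2.2, p.1, p.2.1)) (fun p => (p.2.1, p.2.2, p.1)) ?_ ?_ ?_ ?_ ?_
      <;> intros <;> simp
    ring
  have h3 : ∑ x, ∑ y, ∑ z, ω⁻¹ c x * ω⁻¹ a y * ω⁻¹ b z * D x (ω y z)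
      = ∑ x, ∑ y, ∑ z, ω⁻¹ a x * ω⁻¹ b y * ω⁻¹ c z * D z (ω x y) := by
    simp_rw [← Finset.sum_product']
    refine Finset.sum_nbij' (fun p => (p.2.1, p.2.2, p.1)) (fun p => (p.2.2, p.1, p.2.1)) ?_ ?_ ?_ ?_ ?_
      <;> intros <;> simp
    ring
  rw [h2, h3]
  simp_rw [← Finset.sum_add_distrib, ← mul_add, hc, mul_zero, Finset.sum_const_zero]

/-- The bracket `P^{ab} ∂ₐF ∂_bG`. -/
def bracket (D : ι → R →+ R) (P : Matrix ι ι R) (F G : R) : R :=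
  ∑ a, ∑ b, P a b * D a F * D b G

omit [DecidableEq ι] in
theorem bracket_skew (D : ι → R →+ R) {P : Matrix ι ι R} (hP : ∀ a b, P a b = -P b a)
    (F G : R) : bracket D P F G = -bracket D P G F := by
  unfold bracket
  rw [Finset.sum_comm, ← Finset.sum_neg_distrib]
  refine Finset.sum_congr rfl fun a _ => ?_
  rw [← Finset.sum_neg_distrib]
  refine Finset.sum_congr rfl fun b _ => ?_
  rw [hP]
  ring

section jacobi

variable (D : ι → R →+ R) {P : Matrix ι ι R}

-- Leibniz expansion. The last sum is rewritten using skewness of `P` so that both second-derivative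
-- sums have the same shape and can cancel after cyclic summation.
omit [DecidableEq ι] in
theorem bracket_bracket (hL : ∀ a F G, D a (F * G) = F * D a G + G * D a F)
    (hP : ∀ a b, P a b = -P b a) (F G H : R) :
    bracket D P F (bracket D P G H)
      = ∑ a, ∑ b, ∑ c, (∑ e, P a e * D e (P b c)) * D a F * D b G * D c H
        + ∑ a, ∑ e, ∑ b, ∑ c, P a e * P b c * D a F * D e (D b G) * D c H
        - ∑ a, ∑ e, ∑ b, ∑ c, P a e * P b c * D a F * D e (D b H) * D c G := by
  have h1 : ∑ a, ∑ b, ∑ c, (∑ e, P a e * D e (P b c)) * D a F * D b G * D c H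
      = ∑ a, ∑ e, ∑ b, ∑ c, P a e * D e (P b c) * D a F * D b G * D c H := by
    refine Finset.sum_congr rfl fun a _ => ?_
    simp_rw [Finset.sum_mul]
    conv_rhs => rw [Finset.sum_comm]
    refine Finset.sum_congr rfl fun b _ => ?_
    rw [Finset.sum_comm]
  have h2 : ∑ a, ∑ e, ∑ b, ∑ c, P a e * P b c * D a F * D e (D b H) * D c G
      = -∑ a, ∑ e, ∑ b, ∑ c, P a e * P b c * D a F * D b G * D e (D c H) := by
    simp_rw [← Finset.sum_neg_distrib]
    refine Finset.sum_congr rfl fun a _ => Finset.sum_congr rfl fun e _ => ?_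
    rw [Finset.sum_comm]
    refine Finset.sum_congr rfl fun b _ => Finset.sum_congr rfl fun c _ => ?_
    rw [hP b c]
    ring
  rw [h1, h2, sub_neg_eq_add]
  simp_rw [← Finset.sum_add_distrib]
  refine Finset.sum_congr rfl fun a _ => Finset.sum_congr rfl fun e _ => ?_
  rw [bracket, map_sum, Finset.mul_sum]
  refine Finset.sum_congr rfl fun b _ => ?_
  rw [map_sum, Finset.mul_sum]
  refine Finset.sum_congr rfl fun c _ => ?_
  simp only [hL]
  ring

-- The first-derivative terms form the cyclic expression that `hJ` annihilates. Reversing the order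
-- of the four indices shows the second-derivative terms to be symmetric in their outer functions,
-- so the six of them cancel in pairs.
omit [DecidableEq ι] in
theorem bracket_jacobi (hL : ∀ a F G, D a (F * G) = F * D a G + G * D a F)
    (hD : ∀ a b F, D a (D b F) = D b (D a F)) (hP : ∀ a b, P a b = -P b a)
    (hJ : ∀ a b c, ∑ e, (P a e * D e (P b c) + P b e * D e (P c a) + P c e * D e (P a b)) = 0)
    (F G H : R) : bracket D P F (bracket D P G H) + bracket D P G (bracket D P H F)
      + bracket D P H (bracket D P F G) = 0 := by
  have hT : ∀ F G H : R, ∑ a, ∑ e, ∑ b, ∑ c, P a e * P b c * D a F * D e (D b G) * D c H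
      = ∑ a, ∑ e, ∑ b, ∑ c, P a e * P b c * D a H * D e (D b G) * D c F := by
    intro F G H
    simp_rw [← Finset.sum_product']
    refine Finset.sum_nbij' (fun p => (p.2.2.2, p.2.2.1, p.2.1, p.1))
      (fun p => (p.2.2.2, p.2.2.1, p.2.1, p.1)) ?_ ?_ ?_ ?_ ?_ <;> intros <;> simp
    rename_i p _
    rw [hP p.2.2.2 p.2.2.1, hP p.2.1 p.1, hD p.2.2.1 p.2.1]
    ring
  have hK : ∑ a, ∑ b, ∑ c, (∑ e, P a e * D e (P b c)) * D a F * D b G * D c H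
      + ∑ a, ∑ b, ∑ c, (∑ e, P a e * D e (P b c)) * D a G * D b H * D c F
      + ∑ a, ∑ b, ∑ c, (∑ e, P a e * D e (P b c)) * D a H * D b F * D c G = 0 := by
    have h2 : ∑ a, ∑ b, ∑ c, (∑ e, P a e * D e (P b c)) * D a G * D b H * D c F
        = ∑ a, ∑ b, ∑ c, (∑ e, P b e * D e (P c a)) * D a F * D b G * D c H := by
      simp_rw [← Finset.sum_product']
      refine Finset.sum_nbij' (fun p => (p.2.2, p.1, p.2.1)) (fun p => (p.2.1, p.2.2, p.1))
        ?_ ?_ ?_ ?_ ?_ <;> intros <;> simp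
      ring
    have h3 : ∑ a, ∑ b, ∑ c, (∑ e, P a e * D e (P b c)) * D a H * D b F * D c G
        = ∑ a, ∑ b, ∑ c, (∑ e, P c e * D e (P a b)) * D a F * D b G * D c H := by
      simp_rw [← Finset.sum_product']
      refine Finset.sum_nbij' (fun p => (p.2.1, p.2.2, p.1)) (fun p => (p.2.2, p.1, p.2.1))
        ?_ ?_ ?_ ?_ ?_ <;> intros <;> simp
      ring
    rw [h2, h3]
    simp_rw [← Finset.sum_add_distrib, ← add_mul, ← Finset.sum_add_distrib, hJ, zero_mul,
      Finset.sum_const_zero]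
  simp only [bracket_bracket D hL hP]
  rw [hT G F H, hT F G H, hT F H G]
  linear_combination hK

end jacobi

end PoissonAlgebra

/-! ## Polarization of homogeneous polynomials -/

namespace HomogeneousPolar

variable {𝕜 : Type*} [Field 𝕜]
variable {C : Type*} [CommRing C] [Algebra 𝕜 C] {ι : Type*} [Fintype ι]

/-- The coefficient of a polynomial at `m`, times `∏ mⱼ!`. -/
def scaledCoeff (F : MvPolynomial ι C) (m : ι →₀ ℕ) : C :=
  (∏ j, (m j).factorial : ℕ) * MvPolynomial.coeff m F

/-- Scaling by the multi-index factorial turns differentiation into a shift of the index. -/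
theorem scaledCoeff_pderiv [DecidableEq ι] (F : MvPolynomial ι C) (j : ι) (m : ι →₀ ℕ) :
    scaledCoeff (MvPolynomial.pderiv j F) m = scaledCoeff F (Finsupp.single j 1 + m) := by
  unfold scaledCoeff
  rw [MvPolynomial.coeff_pderiv, add_comm m, ← Finset.mul_prod_erase _ _ (Finset.mem_univ j),
    ← Finset.mul_prod_erase _ _ (Finset.mem_univ j)]
  have : ∏ x ∈ Finset.univ.erase j, ((Finsupp.single j 1 + m : ι →₀ ℕ) x).factorial
      = ∏ x ∈ Finset.univ.erase j, (m x).factorial := by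
    refine Finset.prod_congr rfl fun x hx => ?_
    rw [Finsupp.add_apply, Finsupp.single_eq_of_ne (Finset.ne_of_mem_erase hx), zero_add]
  rw [this, Finsupp.add_apply, Finsupp.single_eq_same, add_comm 1 (m j), Nat.factorial_succ]
  push_cast
  ring

variable (𝕜) in
/-- The symmetric multilinear form associated with a homogeneous polynomial of degree `n`. -/
def polar (n : ℕ) (F : MvPolynomial ι C) : MultilinearMap 𝕜 (fun _ : Fin n => ι → C) C :=
  (n.factorial : 𝕜)⁻¹ • ∑ r : Fin n → ι,
    (LinearMap.mulRight 𝕜 (scaledCoeff F (∑ i, Finsupp.single (r i) 1))).compMultilinearMap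
      ((MultilinearMap.mkPiAlgebra 𝕜 (Fin n) C).compLinearMap fun i => LinearMap.proj (r i))

theorem polar_apply (n : ℕ) (F : MvPolynomial ι C) (A : Fin n → ι → C) :
    polar 𝕜 n F A = (n.factorial : 𝕜)⁻¹ • ∑ r : Fin n → ι,
      (∏ i, A i (r i)) * scaledCoeff F (∑ i, Finsupp.single (r i) 1) := by
  simp [polar]

theorem polar_comp_perm (n : ℕ) (F : MvPolynomial ι C) (σ : Equiv.Perm (Fin n))
    (A : Fin n → ι → C) : polar 𝕜 n F (A ∘ σ) = polar 𝕜 n F A := by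
  rw [polar_apply, polar_apply]
  congr 1
  rw [← Equiv.sum_comp (Equiv.arrowCongr σ.symm (Equiv.refl ι))]
  refine Finset.sum_congr rfl fun r _ => ?_
  congr 1
  · exact Equiv.prod_comp σ fun i => A i (r i)
  · exact congrArg (scaledCoeff F) (Equiv.sum_comp σ fun i => Finsupp.single (r i) 1)

/-- Placing `B` in one slot amounts to differentiating `F` along `B`. This links the insertions in
`Closes` with fibre derivatives of `γ`. -/
theorem polar_cons [DecidableEq ι] [CharZero 𝕜] (n : ℕ) (F : MvPolynomial ι C) (B : ι → C) (A : Fin n → ι → C) :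
    polar 𝕜 (n + 1) F (Fin.cons B A)
      = ((n + 1 : ℕ) : 𝕜)⁻¹ • ∑ j, B j * polar 𝕜 n (MvPolynomial.pderiv j F) A := by
  simp_rw [polar_apply, mul_smul_comm, ← Finset.smul_sum, smul_smul]
  congr 1
  · rw [Nat.factorial_succ, Nat.cast_mul, mul_inv]
  · rw [← (Fin.consEquiv fun _ => ι).sum_comp, Fintype.sum_prod_type]
    refine Finset.sum_congr rfl fun j _ => ?_
    rw [Finset.mul_sum]
    refine Finset.sum_congr rfl fun r _ => ?_
    rw [scaledCoeff_pderiv, Fin.prod_univ_succ, Fin.sum_univ_succ]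
    simp [Fin.consEquiv, mul_assoc]

/-- Induction on the degree: `polar_cons` followed by Euler's identity for homogeneous polynomials.
-/
theorem polar_diagonal [DecidableEq ι] [CharZero 𝕜] (n : ℕ) {F : MvPolynomial ι C} (hF : F.IsHomogeneous n)
    (A : ι → C) : polar 𝕜 n F (fun _ => A) = MvPolynomial.eval A F := by
  induction n generalizing F with
  | zero =>
    obtain ⟨c, rfl⟩ : ∃ c, F = MvPolynomial.C c :=
      ⟨_, MvPolynomial.totalDegree_eq_zero_iff_eq_C.mp (Nat.le_zero.mp hF.totalDegree_le)⟩
    rw [polar_apply]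
    simp [scaledCoeff]
  | succ n ih =>
    have h1 : (fun _ => A : Fin (n + 1) → ι → C) = Fin.cons A fun _ => A := by
      ext1 i
      refine Fin.cases rfl (fun _ => rfl) i
    have h2 : ∀ j, polar 𝕜 n (MvPolynomial.pderiv j F) (fun _ => A)
        = MvPolynomial.eval A (MvPolynomial.pderiv j F) := fun j => ih (by simpa using hF.pderiv)
    have h3 := congrArg (MvPolynomial.eval A) hF.sum_X_mul_pderiv
    simp only [map_sum, map_mul, MvPolynomial.eval_X, map_nsmul] at h3
    rw [h1, polar_cons]
    simp_rw [h2]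
    rw [h3, ← Nat.cast_smul_eq_nsmul 𝕜, smul_smul, inv_mul_cancel₀ (by exact_mod_cast n.succ_ne_zero), one_smul]

end HomogeneousPolar
end

noncomputable section

/-! ### Differential calculus on `U` and on `T*U`. -/

namespace PoissonGauge

variable {d : ℕ} {𝕜 : Type*} [RCLike 𝕜] {U : TopologicalSpace.Opens (Fin d → ℝ)}

/-! ### Derivatives of functions on `U` -/

theorem partialDeriv_add (i : Fin d) (f g : SmoothFunction 𝕜 U) :
    partialDeriv i (f + g) = partialDeriv i f + partialDeriv i g := map_add _ f g

theorem partialDeriv_smul (i : Fin d) (c : 𝕜) (f : SmoothFunction 𝕜 U) :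
    partialDeriv i (c • f) = c • partialDeriv i f := (partialDerivation 𝕜 U i).map_smul c f

theorem partialDeriv_zero (i : Fin d) : partialDeriv i (0 : SmoothFunction 𝕜 U) = 0 :=
  map_zero (partialDerivation 𝕜 U i)

theorem partialDeriv_one (i : Fin d) : partialDeriv i (1 : SmoothFunction 𝕜 U) = 0 :=
  (partialDerivation 𝕜 U i).map_one_eq_zero

theorem partialDeriv_sum {ι : Type*} (i : Fin d) (s : Finset ι) (f : ι → SmoothFunction 𝕜 U) :
    partialDeriv i (∑ j ∈ s, f j) = ∑ j ∈ s, partialDeriv i (f j) :=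
  map_sum (partialDerivation 𝕜 U i) f s

theorem partialDeriv_mul (i : Fin d) (f g : SmoothFunction 𝕜 U) :
    partialDeriv i (f * g) = f * partialDeriv i g + g * partialDeriv i f :=
  (partialDerivation 𝕜 U i).leibniz f g

theorem partialDeriv_comm (i j : Fin d) (f : SmoothFunction 𝕜 U) :
    partialDeriv i (partialDeriv j f) = partialDeriv j (partialDeriv i f) := by
  let F : smoothFunctions 𝕜 U := f
  have key : ∀ (i j : Fin d) (x : U),
      fderiv ℝ (zeroExtend fun y : U => fderiv ℝ (zeroExtend (F : U → 𝕜)) y (Pi.single j 1))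
        (x : Fin d → ℝ) (Pi.single i 1)
      = fderiv ℝ (fderiv ℝ (zeroExtend (F : U → 𝕜))) x (Pi.single i 1) (Pi.single j 1) := by
    intro i j x
    rw [fderiv_zeroExtend (g := fun y => fderiv ℝ (zeroExtend (F : U → 𝕜)) y (Pi.single j 1))
      (fun _ => rfl) x]
    have h1 : DifferentiableAt ℝ (fderiv ℝ (zeroExtend (F : U → 𝕜))) (x : Fin d → ℝ) := by
      have : ContDiffOn ℝ ((⊤ : ℕ∞) : WithTop ℕ∞) (fderiv ℝ (zeroExtend (F : U → 𝕜)))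
          (U : Set (Fin d → ℝ)) := F.2.fderiv_of_isOpen U.isOpen (by simp)
      exact (this.contDiffAt (U.isOpen.mem_nhds x.2)).differentiableAt (by simp)
    rw [fderiv_clm_apply h1 (differentiableAt_const _)]
    simp
  -- The extension by zero is smooth near every point of the open set `U`, so Schwarz's theorem
  -- applies there.
  have h2 : ∀ x : U, IsSymmSndFDerivAt ℝ (zeroExtend (F : U → 𝕜)) (x : Fin d → ℝ) := fun x =>
    (F.2.contDiffAt (U.isOpen.mem_nhds x.2)).isSymmSndFDerivAt (by
      rw [minSmoothness_of_isRCLikeNormedField]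
      exact WithTop.coe_le_coe.mpr (le_top : (2 : ℕ∞) ≤ ⊤))
  refine Subtype.ext (funext fun x => ?_)
  exact (key i j x).trans (((h2 x).eq _ _).trans (key j i x).symm)

/-! ### Derivatives of fibrewise polynomial functions -/

theorem coeff_baseDeriv (i : Fin d) (F : PolFunction 𝕜 U) (m : Fin d →₀ ℕ) :
    MvPolynomial.coeff m (baseDeriv i F) = partialDeriv i (MvPolynomial.coeff m F) := by
  classical
  rw [baseDeriv, MvPolynomial.coeff_sum]
  simp_rw [MvPolynomial.coeff_monomial]
  rw [Finset.sum_ite_eq']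
  split_ifs with h
  · rfl
  · rw [MvPolynomial.notMem_support_iff.mp h, partialDeriv_zero]

/-- The derivative in the base direction `xⁱ` as a derivation. -/
def baseDerivation (i : Fin d) : Derivation ℤ (PolFunction 𝕜 U) (PolFunction 𝕜 U) :=
  Derivation.mk'
    (AddMonoidHom.toIntLinearMap
      { toFun := baseDeriv i
        map_zero' := by ext m; simp [coeff_baseDeriv, partialDeriv_zero]
        map_add' := fun F G => by ext m; simp [coeff_baseDeriv, partialDeriv_add] })
    (fun F G => by
      ext m
      simp only [AddMonoidHom.coe_toIntLinearMap, AddMonoidHom.coe_mk, ZeroHom.coe_mk, smul_eq_mul,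
        MvPolynomial.coeff_add, coeff_baseDeriv]
      rw [mul_comm G, MvPolynomial.coeff_mul, MvPolynomial.coeff_mul, MvPolynomial.coeff_mul,
        partialDeriv_sum, ← Finset.sum_add_distrib]
      refine Finset.sum_congr rfl fun p _ => ?_
      rw [partialDeriv_mul, coeff_baseDeriv, coeff_baseDeriv]
      ring)

/-- The derivatives of fibrewise polynomial functions in the directions `xⁱ` and `pᵢ`. -/
def polDerivation : Fin d ⊕ Fin d → Derivation ℤ (PolFunction 𝕜 U) (PolFunction 𝕜 U) :=
  Sum.elim baseDerivation fun i => (MvPolynomial.pderiv i).restrictScalars ℤ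

theorem polDerivation_inl (i : Fin d) (F : PolFunction 𝕜 U) :
    polDerivation (Sum.inl i) F = baseDeriv i F := rfl

theorem polDerivation_inr (i : Fin d) (F : PolFunction 𝕜 U) :
    polDerivation (Sum.inr i) F = MvPolynomial.pderiv i F := rfl

theorem polDerivation_comm (a b : Fin d ⊕ Fin d) (F : PolFunction 𝕜 U) :
    polDerivation a (polDerivation b F) = polDerivation b (polDerivation a F) := by
  have h1 : ∀ (i j : Fin d), baseDeriv i (MvPolynomial.pderiv j F)
      = MvPolynomial.pderiv j (baseDeriv i F) := by
    intro i j
    ext m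
    rw [coeff_baseDeriv, MvPolynomial.coeff_pderiv, MvPolynomial.coeff_pderiv, coeff_baseDeriv,
      partialDeriv_mul, partialDeriv_add, partialDeriv_one]
    have : partialDeriv i ((m j : ℕ) : SmoothFunction 𝕜 U) = 0 :=
      (partialDerivation 𝕜 U i).map_natCast _
    rw [this]
    ring
  rcases a with i | i <;> rcases b with j | j
  · ext m
    simp only [polDerivation_inl, coeff_baseDeriv, partialDeriv_comm i j]
  · exact h1 i j
  · exact (h1 j i).symm
  · ext m
    simp only [polDerivation_inr, MvPolynomial.coeff_pderiv, Finsupp.add_apply]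
    rw [add_right_comm m]
    rcases eq_or_ne i j with rfl | hij
    · rfl
    · rw [Finsupp.single_eq_of_ne hij, Finsupp.single_eq_of_ne hij.symm]
      push_cast
      ring

theorem coeff_coordDeriv (a : Fin d ⊕ Fin d) (F : FormalFunction 𝕜 U) (n : ℕ) :
    PowerSeries.coeff n (coordDeriv a F) = polDerivation a (PowerSeries.coeff n F) := by
  rw [coordDeriv, PowerSeries.coeff_mk]
  rcases a with i | i <;> rfl

/-- The derivatives of formal functions as additive maps. -/
def coordDerivation (a : Fin d ⊕ Fin d) : FormalFunction 𝕜 U →+ FormalFunction 𝕜 U where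
  toFun := coordDeriv a
  map_zero' := by ext1 n; simp [coeff_coordDeriv]
  map_add' := fun F G => by ext1 n; simp [coeff_coordDeriv]

theorem coordDerivation_apply (a : Fin d ⊕ Fin d) (F : FormalFunction 𝕜 U) :
    coordDerivation a F = coordDeriv a F := rfl

theorem coordDerivation_mul (a : Fin d ⊕ Fin d) (F G : FormalFunction 𝕜 U) :
    coordDerivation a (F * G) = F * coordDerivation a G + G * coordDerivation a F := by
  ext1 n
  simp only [coordDerivation_apply]
  rw [mul_comm G, map_add, coeff_coordDeriv, PowerSeries.coeff_mul, PowerSeries.coeff_mul,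
    PowerSeries.coeff_mul, map_sum, ← Finset.sum_add_distrib]
  refine Finset.sum_congr rfl fun p _ => ?_
  rw [Derivation.leibniz, coeff_coordDeriv, coeff_coordDeriv]
  simp only [smul_eq_mul]
  ring

theorem coordDerivation_one (a : Fin d ⊕ Fin d) :
    coordDerivation a (1 : FormalFunction 𝕜 U) = 0 := by
  simpa using coordDerivation_mul a (1 : FormalFunction 𝕜 U) 1

theorem coordDerivation_comm (a b : Fin d ⊕ Fin d) (F : FormalFunction 𝕜 U) :
    coordDerivation a (coordDerivation b F) = coordDerivation b (coordDerivation a F) := by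
  ext1 n
  simp only [coordDerivation_apply, coeff_coordDeriv, polDerivation_comm a b]

theorem baseDeriv_C (i : Fin d) (f : SmoothFunction 𝕜 U) :
    baseDeriv i (MvPolynomial.C f) = MvPolynomial.C (partialDeriv i f) := by
  classical
  ext m
  rw [coeff_baseDeriv, MvPolynomial.coeff_C, MvPolynomial.coeff_C]
  split_ifs
  · rfl
  · exact partialDeriv_zero i

theorem baseDeriv_X (i j : Fin d) : baseDeriv i (MvPolynomial.X j : PolFunction 𝕜 U) = 0 := by
  classical
  ext m
  rw [coeff_baseDeriv, MvPolynomial.coeff_X, MvPolynomial.coeff_zero]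
  split_ifs
  · exact partialDeriv_one i
  · exact partialDeriv_zero i

theorem coordDerivation_C (a : Fin d ⊕ Fin d) (p : PolFunction 𝕜 U) :
    coordDerivation a (PowerSeries.C p) = PowerSeries.C (polDerivation a p) := by
  ext1 n
  rw [coordDerivation_apply, coeff_coordDeriv, PowerSeries.coeff_C, PowerSeries.coeff_C]
  split_ifs <;> simp

theorem coordDerivation_X (a : Fin d ⊕ Fin d) :
    coordDerivation a (PowerSeries.X : FormalFunction 𝕜 U) = 0 := by
  ext1 n
  rw [coordDerivation_apply, coeff_coordDeriv, PowerSeries.coeff_X]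
  split_ifs <;> simp

theorem coordDerivation_inl_pullback (i : Fin d) (f : SmoothFunction 𝕜 U) :
    coordDerivation (Sum.inl i) (pullback f) = pullback (partialDeriv i f) := by
  rw [pullback, coordDerivation_C, polDerivation_inl, baseDeriv_C]; rfl

theorem coordDerivation_inr_pullback (i : Fin d) (f : SmoothFunction 𝕜 U) :
    coordDerivation (Sum.inr i) (pullback f) = 0 := by
  rw [pullback, coordDerivation_C, polDerivation_inr, MvPolynomial.pderiv_C, map_zero]

theorem coordDerivation_inl_momentum (i j : Fin d) :
    coordDerivation (Sum.inl i) (momentum j : FormalFunction 𝕜 U) = 0 := by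
  rw [momentum, coordDerivation_C, polDerivation_inl, baseDeriv_X, map_zero]

theorem coordDerivation_inr_momentum (i j : Fin d) :
    coordDerivation (Sum.inr i) (momentum j : FormalFunction 𝕜 U) = if j = i then 1 else 0 := by
  rw [momentum, coordDerivation_C, polDerivation_inr, MvPolynomial.pderiv_X, Pi.single_apply]
  split_ifs <;> simp

/-! ### Pullback along sections -/

/-- The partial derivative of formal power series with coefficients in `C^∞(U)`. -/
def seriesDeriv (i : Fin d) (F : PowerSeries (SmoothFunction 𝕜 U)) :
    PowerSeries (SmoothFunction 𝕜 U) :=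
  PowerSeries.mk fun n => partialDeriv i (PowerSeries.coeff n F)

/-- The chain rule for `x ↦ F(x, A(x))`, by induction on the polynomial `F`. -/
theorem partialDeriv_eval (i : Fin d) (A : OneForm 𝕜 U) (F : PolFunction 𝕜 U) :
    partialDeriv i (MvPolynomial.eval A F) = MvPolynomial.eval A (baseDeriv i F)
      + ∑ j, partialDeriv i (A j) * MvPolynomial.eval A (MvPolynomial.pderiv j F) := by
  induction F using MvPolynomial.induction_on with
  | C f => simp [baseDeriv_C]
  | add F G hF hG =>
    have h1 : baseDeriv i (F + G) = baseDeriv i F + baseDeriv i G := map_add (baseDerivation i) F G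
    simp only [map_add, partialDeriv_add, hF, hG, h1, mul_add, Finset.sum_add_distrib]
    ring
  | mul_X F k hF =>
    have h1 : baseDeriv i (F * MvPolynomial.X k)
        = F * baseDeriv i (MvPolynomial.X k) + MvPolynomial.X k * baseDeriv i F :=
      (baseDerivation i).leibniz F _
    rw [baseDeriv_X, mul_zero, zero_add] at h1
    rw [map_mul, partialDeriv_mul, hF, h1, MvPolynomial.eval_X]
    have h2 : ∀ j, partialDeriv i (A j) *
        MvPolynomial.eval A (MvPolynomial.pderiv j (F * MvPolynomial.X k))
        = (if k = j then MvPolynomial.eval A F * partialDeriv i (A j) else 0) + A k * (partialDeriv i (A j)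
          * MvPolynomial.eval A (MvPolynomial.pderiv j F)) := by
      intro j
      rw [Derivation.leibniz, MvPolynomial.pderiv_X, Pi.single_apply]
      split_ifs with h <;> simp [h, eq_comm] <;> ring
    simp_rw [h2]
    rw [Finset.sum_add_distrib, Finset.sum_ite_eq, ← Finset.mul_sum]
    simp
    ring

theorem seriesDeriv_sectionPullback (i : Fin d) (A : OneForm 𝕜 U) (F : FormalFunction 𝕜 U) :
    seriesDeriv i (sectionPullback A F) = sectionPullback A (coordDerivation (Sum.inl i) F)
      + ∑ j, PowerSeries.C (partialDeriv i (A j)) *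
        sectionPullback A (coordDerivation (Sum.inr j) F) := by
  ext1 n
  rw [seriesDeriv, PowerSeries.coeff_mk, sectionPullback, PowerSeries.coeff_map, partialDeriv_eval,
    map_add, map_sum, PowerSeries.coeff_map, coordDerivation_apply, coeff_coordDeriv]
  simp only [PowerSeries.coeff_C_mul, PowerSeries.coeff_map, coordDerivation_apply,
    coeff_coordDeriv]
  rfl

theorem sectionPullback_pullback (A : OneForm 𝕜 U) (f : SmoothFunction 𝕜 U) :
    sectionPullback A (pullback f) = PowerSeries.C f := by
  simp [sectionPullback, pullback]

theorem sectionPullback_X (A : OneForm 𝕜 U) :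
    sectionPullback A PowerSeries.X = PowerSeries.X := by
  simp [sectionPullback]

end PoissonGauge
end

noncomputable section

/-! ### Closure of the Poisson gauge variations. -/

namespace PoissonGauge

variable {d : ℕ} {𝕜 : Type*} [RCLike 𝕜] {U : TopologicalSpace.Opens (Fin d → ℝ)}

theorem bivectorBracket_eq (P : FormalTensor 𝕜 U) (F G : FormalFunction 𝕜 U) :
    bivectorBracket P F G = PoissonAlgebra.bracket coordDerivation P F G := rfl

variable {θ : Matrix (Fin d) (Fin d) (SmoothFunction 𝕜 U)} {ω : FormalTensor 𝕜 U}
  {γ : Matrix (Fin d) (Fin d) (FormalFunction 𝕜 U)}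

/-- A power series is invertible when its constant term is, and at `t = 0` the matrix is the
canonical one. -/
theorem IsSymplecticEmbedding.isUnit_det (hω : IsSymplecticEmbedding θ ω) : IsUnit ω.det := by
  rw [PowerSeries.isUnit_iff_constantCoeff, RingHom.map_det]
  have h1 : (PowerSeries.constantCoeff (R := PolFunction 𝕜 U)).mapMatrix ω
      = Matrix.J (Fin d) (PolFunction 𝕜 U) := hω.deformation
  rw [h1]
  exact Matrix.isUnit_det_J (Fin d) _

theorem IsSymplecticEmbedding.inv_skew (hω : IsSymplecticEmbedding θ ω) (a b : Fin d ⊕ Fin d) :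
    ω⁻¹ a b = -ω⁻¹ b a := PoissonAlgebra.inv_skew hω.skew hω.isUnit_det a b

theorem IsSymplecticEmbedding.bracket_skew (hω : IsSymplecticEmbedding θ ω)
    (F G : FormalFunction 𝕜 U) : bivectorBracket ω⁻¹ F G = -bivectorBracket ω⁻¹ G F := by
  rw [bivectorBracket_eq, bivectorBracket_eq,
    PoissonAlgebra.bracket_skew coordDerivation hω.inv_skew]

/-- The Jacobi identity for the inverse of a symplectic embedding. -/
theorem IsSymplecticEmbedding.bracket_jacobi (hω : IsSymplecticEmbedding θ ω)
    (F G H : FormalFunction 𝕜 U) :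
    bivectorBracket ω⁻¹ F (bivectorBracket ω⁻¹ G H) + bivectorBracket ω⁻¹ G (bivectorBracket ω⁻¹ H F)
      + bivectorBracket ω⁻¹ H (bivectorBracket ω⁻¹ F G) = 0 :=
  PoissonAlgebra.bracket_jacobi coordDerivation coordDerivation_mul coordDerivation_comm hω.inv_skew
    (PoissonAlgebra.jacobi_inv coordDerivation coordDerivation_mul hω.skew hω.isUnit_det hω.closed) F G H

variable (hω : IsLocalSymplecticEmbedding θ ω γ)

include hω

theorem bracket_pullback (f : SmoothFunction 𝕜 U) (F : FormalFunction 𝕜 U) :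
    bivectorBracket ω⁻¹ (pullback f) F = ∑ k, pullback (partialDeriv k f) *
      (∑ l, PowerSeries.X * pullback (θ k l) * coordDerivation (Sum.inl l) F
        + ∑ j, ω⁻¹ (Sum.inl k) (Sum.inr j) * coordDerivation (Sum.inr j) F) := by
  rw [bivectorBracket_eq, PoissonAlgebra.bracket]
  simp only [Fintype.sum_sum_type, coordDerivation_inl_pullback, coordDerivation_inr_pullback,
    mul_zero, zero_mul, Finset.sum_const_zero, add_zero]
  refine Finset.sum_congr rfl fun k _ => ?_
  rw [mul_add, Finset.mul_sum, Finset.mul_sum]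
  simp only [hω.base_base]
  refine congrArg₂ (· + ·) (Finset.sum_congr rfl fun _ _ => ?_) (Finset.sum_congr rfl fun _ _ => ?_)
    <;> ring

theorem bracket_pullback_pullback (f g : SmoothFunction 𝕜 U) :
    bivectorBracket ω⁻¹ (pullback f) (pullback g)
      = PowerSeries.X * pullback (poissonBracket θ f g) := by
  rw [bracket_pullback hω]
  simp only [coordDerivation_inl_pullback, coordDerivation_inr_pullback, mul_zero,
    Finset.sum_const_zero, add_zero]
  have h1 : pullback (poissonBracket θ f g)
      = ∑ i, ∑ j, pullback (θ i j) * pullback (partialDeriv i f) * pullback (partialDeriv j g) := by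
    simp [pullback, poissonBracket, map_sum, map_mul]
  rw [h1]
  simp only [Finset.mul_sum]
  exact Finset.sum_congr rfl fun _ _ => Finset.sum_congr rfl fun _ _ => by ring

theorem bracket_pullback_constraint (f : SmoothFunction 𝕜 U) (A : OneForm 𝕜 U) (i : Fin d) :
    bivectorBracket ω⁻¹ (pullback f) (momentum i - pullback (A i))
      = ∑ k, pullback (partialDeriv k f) *
        (-∑ l, PowerSeries.X * pullback (θ k l) * pullback (partialDeriv l (A i))
          + ω⁻¹ (Sum.inl k) (Sum.inr i)) := by
  rw [bracket_pullback hω]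
  refine Finset.sum_congr rfl fun k _ => ?_
  simp only [map_sub, coordDerivation_inl_pullback, coordDerivation_inr_pullback,
    coordDerivation_inl_momentum, coordDerivation_inr_momentum, zero_sub, sub_zero, mul_neg,
    Finset.sum_neg_distrib, mul_ite, mul_one, mul_zero, Finset.sum_ite_eq, Finset.mem_univ, if_true]

theorem poissonGaugeVariation_eq (f : SmoothFunction 𝕜 U) (A : OneForm 𝕜 U) (i : Fin d) :
    poissonGaugeVariation ω f A i = ∑ k, PowerSeries.C (partialDeriv k f) *
      (-∑ l, PowerSeries.X * PowerSeries.C (θ k l) * PowerSeries.C (partialDeriv l (A i))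
        + sectionPullback A (ω⁻¹ (Sum.inl k) (Sum.inr i))) := by
  rw [poissonGaugeVariation, bracket_pullback_constraint hω]
  simp only [map_sum, map_mul, map_add, map_neg, sectionPullback_pullback, sectionPullback_X]

/-- The restriction of `{π^*f, F}` to a section in terms of the restriction of `F`. -/
theorem sectionPullback_bracket (f : SmoothFunction 𝕜 U) (A : OneForm 𝕜 U)
    (F : FormalFunction 𝕜 U) :
    sectionPullback A (bivectorBracket ω⁻¹ (pullback f) F)
      = PowerSeries.X * ∑ k, ∑ l, PowerSeries.C (θ k l) * PowerSeries.C (partialDeriv k f)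
          * seriesDeriv l (sectionPullback A F)
        + ∑ j, poissonGaugeVariation ω f A j * sectionPullback A (coordDerivation (Sum.inr j) F) := by
  simp only [poissonGaugeVariation_eq hω, bracket_pullback hω, seriesDeriv_sectionPullback]
  simp only [map_sum, map_mul, map_add, sectionPullback_pullback, sectionPullback_X]
  simp only [Finset.sum_mul]
  conv_rhs =>
    arg 2
    rw [Finset.sum_comm]
  rw [Finset.mul_sum, ← Finset.sum_add_distrib]
  refine Finset.sum_congr rfl fun k _ => ?_
  generalize PowerSeries.C (partialDeriv k f) = c
  -- By the chain rule, differentiating the restriction of `F` produces extra terms with `∂ₗAⱼ`;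
  -- they cancel the `θ`-part of the gauge variation, leaving only its `ω⁻¹`-part.
  have h1 : ∑ j, c * (-∑ l, PowerSeries.X * PowerSeries.C (θ k l) * PowerSeries.C (partialDeriv l (A j))
        + sectionPullback A (ω⁻¹ (Sum.inl k) (Sum.inr j)))
        * sectionPullback A (coordDerivation (Sum.inr j) F)
      = c * ∑ j, sectionPullback A (ω⁻¹ (Sum.inl k) (Sum.inr j))
        * sectionPullback A (coordDerivation (Sum.inr j) F)
        - c * PowerSeries.X * ∑ l, ∑ j, PowerSeries.C (θ k l) * PowerSeries.C (partialDeriv l (A j))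
        * sectionPullback A (coordDerivation (Sum.inr j) F) := by
    rw [Finset.sum_comm, Finset.mul_sum, Finset.mul_sum, ← Finset.sum_sub_distrib]
    refine Finset.sum_congr rfl fun j _ => ?_
    rw [mul_add, add_mul, mul_neg, neg_mul, neg_add_eq_sub, mul_assoc]
    congr 1
    rw [Finset.mul_sum, Finset.mul_sum, Finset.sum_mul]
    exact Finset.sum_congr rfl fun _ _ => by ring
  rw [h1]
  simp only [mul_add, Finset.sum_add_distrib, Finset.mul_sum]
  have h2 : ∑ l, ∑ j, PowerSeries.X * (PowerSeries.C (θ k l) * c *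
        (PowerSeries.C (partialDeriv l (A j)) * sectionPullback A (coordDerivation (Sum.inr j) F)))
      = ∑ l, ∑ j, c * PowerSeries.X * (PowerSeries.C (θ k l) * PowerSeries.C (partialDeriv l (A j))
        * sectionPullback A (coordDerivation (Sum.inr j) F)) :=
    Finset.sum_congr rfl fun _ _ => Finset.sum_congr rfl fun _ _ => by ring
  have h3 : ∑ l, PowerSeries.X * (PowerSeries.C (θ k l) * c *
        sectionPullback A (coordDerivation (Sum.inl l) F))
      = ∑ l, c * (PowerSeries.X * PowerSeries.C (θ k l)
        * sectionPullback A (coordDerivation (Sum.inl l) F)) :=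
    Finset.sum_congr rfl fun _ _ => by ring
  rw [h2, h3]
  ring

/-- Apart from `t γ`, every term of the constraint bracket is constant along the fibres, so the
fibre derivative carries a factor `t`. -/
theorem coordDerivation_inr_bracket (g : SmoothFunction 𝕜 U) (A : OneForm 𝕜 U) (i j : Fin d) :
    coordDerivation (Sum.inr j) (bivectorBracket ω⁻¹ (pullback g) (momentum i - pullback (A i)))
      = PowerSeries.X * ∑ k, pullback (partialDeriv k g) * coordDerivation (Sum.inr j) (γ k i) := by
  rw [bracket_pullback_constraint hω, Finset.mul_sum, map_sum]
  refine Finset.sum_congr rfl fun k _ => ?_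
  have h1 : coordDerivation (Sum.inr j) (if k = i then (1 : FormalFunction 𝕜 U) else 0) = 0 := by
    split_ifs <;> simp [coordDerivation_one]
  simp only [hω.base_fibre, coordDerivation_mul, map_add, map_neg, map_sum,
    coordDerivation_inr_pullback, coordDerivation_X, h1, mul_zero, add_zero,
    Finset.sum_const_zero, neg_zero, zero_add]
  ring

/-- The commutator of two gauge variations. -/
theorem gaugeVariation_commutator (f g : SmoothFunction 𝕜 U) (A : OneForm 𝕜 U) (i : Fin d) :
    (∑ k, ∑ l, PowerSeries.C (θ k l) * PowerSeries.C (partialDeriv k f)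
          * seriesDeriv l (poissonGaugeVariation ω g A i)
      + ∑ j, poissonGaugeVariation ω f A j * ∑ k, PowerSeries.C (partialDeriv k g)
          * sectionPullback A (coordDerivation (Sum.inr j) (γ k i)))
      - (∑ k, ∑ l, PowerSeries.C (θ k l) * PowerSeries.C (partialDeriv k g)
          * seriesDeriv l (poissonGaugeVariation ω f A i)
      + ∑ j, poissonGaugeVariation ω g A j * ∑ k, PowerSeries.C (partialDeriv k f)
          * sectionPullback A (coordDerivation (Sum.inr j) (γ k i)))
      = poissonGaugeVariation ω (poissonBracket θ f g) A i := by
  have h1 : ∀ f g : SmoothFunction 𝕜 U, sectionPullback A (bivectorBracket ω⁻¹ (pullback f)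
      (bivectorBracket ω⁻¹ (pullback g) (momentum i - pullback (A i)))) = PowerSeries.X *
      (∑ k, ∑ l, PowerSeries.C (θ k l) * PowerSeries.C (partialDeriv k f)
          * seriesDeriv l (poissonGaugeVariation ω g A i)
      + ∑ j, poissonGaugeVariation ω f A j * ∑ k, PowerSeries.C (partialDeriv k g)
          * sectionPullback A (coordDerivation (Sum.inr j) (γ k i))) := by
    intro f g
    rw [sectionPullback_bracket hω, mul_add]
    congr 1
    rw [Finset.mul_sum]
    refine Finset.sum_congr rfl fun j _ => ?_
    rw [coordDerivation_inr_bracket hω]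
    simp only [map_mul, map_sum, sectionPullback_X, sectionPullback_pullback]
    ring
  have h2 : bivectorBracket ω⁻¹ (PowerSeries.X * pullback (poissonBracket θ f g))
      (momentum i - pullback (A i)) = PowerSeries.X * bivectorBracket ω⁻¹
      (pullback (poissonBracket θ f g)) (momentum i - pullback (A i)) := by
    simp only [bivectorBracket_eq, PoissonAlgebra.bracket, coordDerivation_mul, coordDerivation_X,
      mul_zero, add_zero, Finset.mul_sum]
    exact Finset.sum_congr rfl fun _ _ => Finset.sum_congr rfl fun _ _ => by ring
  -- Restricted to the section, the nested brackets are `t` times the two halves of the commutator,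
  -- and the bracket of `{π^*f, π^*g}` is `t` times the variation along `{f, g}_θ`.
  have h3 := hω.bracket_jacobi (pullback f) (pullback g) (momentum i - pullback (A i))
  rw [hω.bracket_skew (momentum i - pullback (A i)) (pullback f),
    hω.bracket_skew (momentum i - pullback (A i)) (bivectorBracket _ _ _),
    bracket_pullback_pullback hω, h2] at h3
  have h4 : ∀ F : FormalFunction 𝕜 U, bivectorBracket ω⁻¹ (pullback g) (-F)
      = -bivectorBracket ω⁻¹ (pullback g) F := by
    intro F
    simp only [bivectorBracket_eq, PoissonAlgebra.bracket, map_neg, mul_neg,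
      Finset.sum_neg_distrib]
  rw [h4] at h3
  have h5 := congrArg (sectionPullback A) h3
  rw [map_add, map_add, map_neg, map_neg, map_zero, map_mul, h1, h1, sectionPullback_X] at h5
  have h6 : (PowerSeries.X : PowerSeries (SmoothFunction 𝕜 U)) * _ = PowerSeries.X * _ :=
    (mul_sub _ _ _).trans ((sub_eq_add_neg _ _).trans (eq_of_sub_eq_zero ((sub_eq_add_neg _ _).trans h5)))
  -- The common factor `t` is cancelled by comparing coefficients of `tⁿ⁺¹`.
  ext1 n
  have := congrArg (PowerSeries.coeff (n + 1)) h6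
  rwa [PowerSeries.coeff_succ_X_mul, PowerSeries.coeff_succ_X_mul] at this

end PoissonGauge
end

noncomputable section

namespace PoissonGauge

open TwoTerm HomogeneousPolar

variable {d : ℕ} {𝕜 : Type*} [RCLike 𝕜] {U : TopologicalSpace.Opens (Fin d → ℝ)}

/-! ### The multilinear maps of the gauge variations -/

theorem poissonBracket_add_left (θ : Matrix (Fin d) (Fin d) (SmoothFunction 𝕜 U))
    (f f' g : SmoothFunction 𝕜 U) :
    poissonBracket θ (f + f') g = poissonBracket θ f g + poissonBracket θ f' g := by
  simp only [poissonBracket, partialDeriv_add, ← Finset.sum_add_distrib]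
  exact Finset.sum_congr rfl fun _ _ => Finset.sum_congr rfl fun _ _ => by ring

theorem poissonBracket_smul_left (θ : Matrix (Fin d) (Fin d) (SmoothFunction 𝕜 U)) (c : 𝕜)
    (f g : SmoothFunction 𝕜 U) : poissonBracket θ (c • f) g = c • poissonBracket θ f g := by
  simp only [poissonBracket, partialDeriv_smul, mul_smul_comm, smul_mul_assoc, ← Finset.smul_sum]

theorem poissonBracket_add_right (θ : Matrix (Fin d) (Fin d) (SmoothFunction 𝕜 U))
    (f g g' : SmoothFunction 𝕜 U) :
    poissonBracket θ f (g + g') = poissonBracket θ f g + poissonBracket θ f g' := by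
  simp only [poissonBracket, partialDeriv_add, mul_add, ← Finset.sum_add_distrib]

theorem poissonBracket_smul_right (θ : Matrix (Fin d) (Fin d) (SmoothFunction 𝕜 U)) (c : 𝕜)
    (f g : SmoothFunction 𝕜 U) : poissonBracket θ f (c • g) = c • poissonBracket θ f g := by
  simp only [poissonBracket, partialDeriv_smul, mul_smul_comm, ← Finset.smul_sum]

theorem IsPoisson.bracket_skew {θ : Matrix (Fin d) (Fin d) (SmoothFunction 𝕜 U)}
    (hθ : IsPoisson θ) (f g : SmoothFunction 𝕜 U) :
    poissonBracket θ f g = -poissonBracket θ g f := by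
  simp only [poissonBracket]
  rw [Finset.sum_comm, ← Finset.sum_neg_distrib]
  refine Finset.sum_congr rfl fun a _ => ?_
  rw [← Finset.sum_neg_distrib]
  refine Finset.sum_congr rfl fun b _ => ?_
  rw [hθ.skew]
  ring

theorem formBracket_apply (θ : Matrix (Fin d) (Fin d) (SmoothFunction 𝕜 U))
    (A : OneForm 𝕜 U) (f : SmoothFunction 𝕜 U) (i : Fin d) :
    formBracket θ A f i = -poissonBracket θ f (A i) := rfl

/-- The Poisson bracket as a bilinear map. -/
def poissonBilin (θ : Matrix (Fin d) (Fin d) (SmoothFunction 𝕜 U)) :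
    SmoothFunction 𝕜 U →ₗ[𝕜] SmoothFunction 𝕜 U →ₗ[𝕜] SmoothFunction 𝕜 U :=
  LinearMap.mk₂ 𝕜 (poissonBracket θ) (poissonBracket_add_left θ) (poissonBracket_smul_left θ)
    (poissonBracket_add_right θ) (poissonBracket_smul_right θ)

theorem poissonBilin_apply (θ : Matrix (Fin d) (Fin d) (SmoothFunction 𝕜 U))
    (f g : SmoothFunction 𝕜 U) : poissonBilin θ f g = poissonBracket θ f g := rfl

/-- The bracket `(f, A) ↦ {A, f}_θ` as a bilinear map. -/
def formBilin (θ : Matrix (Fin d) (Fin d) (SmoothFunction 𝕜 U)) :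
    SmoothFunction 𝕜 U →ₗ[𝕜] OneForm 𝕜 U →ₗ[𝕜] OneForm 𝕜 U :=
  LinearMap.mk₂ 𝕜 (fun f A => formBracket θ A f)
    (fun f f' A => by
      ext1 i
      simp only [formBracket_apply, Pi.add_apply, poissonBracket_add_left, neg_add])
    (fun c f A => by
      ext1 i
      simp only [formBracket_apply, Pi.smul_apply, poissonBracket_smul_left, smul_neg])
    (fun f A A' => by
      ext1 i
      simp only [formBracket_apply, Pi.add_apply, poissonBracket_add_right, neg_add])
    (fun c f A => by
      ext1 i
      simp only [formBracket_apply, Pi.smul_apply, poissonBracket_smul_right, smul_neg])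

/-- The bilinear map `formBilin θ` in the family of zero multilinear maps. -/
def formMultilin (θ : Matrix (Fin d) (Fin d) (SmoothFunction 𝕜 U)) :
    (m : ℕ) → SmoothFunction 𝕜 U →ₗ[𝕜]
      MultilinearMap 𝕜 (fun _ : Fin m => OneForm 𝕜 U) (OneForm 𝕜 U)
  | 1 => (MultilinearMap.ofSubsingletonₗ 𝕜 𝕜 (OneForm 𝕜 U) (OneForm 𝕜 U) (0 : Fin 1)).toLinearMap ∘ₗ
      formBilin θ
  | _ => 0

theorem formMultilin_add_two (θ : Matrix (Fin d) (Fin d) (SmoothFunction 𝕜 U)) (m : ℕ) :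
    formMultilin θ (m + 2) = 0 := rfl

/-- The multilinear maps `(f, A₁, …, Aₘ) ↦ γ^{(m)}(df, A₁, …, Aₘ)` for `m ≥ 1`, and `f ↦ df`
for `m = 0`. -/
def gammaMultilin (γ : Matrix (Fin d) (Fin d) (FormalFunction 𝕜 U)) :
    (m : ℕ) → SmoothFunction 𝕜 U →ₗ[𝕜]
      MultilinearMap 𝕜 (fun _ : Fin m => OneForm 𝕜 U) (OneForm 𝕜 U)
  | 0 =>
    { toFun := fun f => MultilinearMap.constOfIsEmpty 𝕜 _ (dForm f)
      map_add' := fun f g => by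
        ext A i
        simp [dForm, partialDeriv_add]
      map_smul' := fun c f => by
        ext A i
        simp [dForm, partialDeriv_smul] }
  | m + 1 =>
    { toFun := fun f => MultilinearMap.pi fun i => ∑ k,
        (LinearMap.mulLeft 𝕜 (partialDeriv k f)).compMultilinearMap
          -- The coefficient of `tᵐ` in `γ` is the one of degree `m + 1` in `p`, as `ω⁻¹` contains
          -- `t γ`.
          (((m + 1).factorial : 𝕜) • polar 𝕜 (m + 1) (PowerSeries.coeff m (γ k i)))
      map_add' := fun f g => by
        ext A i
        simp [partialDeriv_add, add_mul, Finset.sum_add_distrib]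
      map_smul' := fun c f => by
        ext A i
        simp [partialDeriv_smul, Finset.smul_sum, smul_comm c] }

theorem gammaMultilin_zero (γ : Matrix (Fin d) (Fin d) (FormalFunction 𝕜 U))
    (f : SmoothFunction 𝕜 U) (A : Fin 0 → OneForm 𝕜 U) : gammaMultilin γ 0 f A = dForm f := rfl

theorem gammaMultilin_succ (γ : Matrix (Fin d) (Fin d) (FormalFunction 𝕜 U)) (m : ℕ)
    (f : SmoothFunction 𝕜 U) (A : Fin (m + 1) → OneForm 𝕜 U) (i : Fin d) :
    gammaMultilin γ (m + 1) f A i = ((m + 1).factorial : 𝕜) •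
      ∑ k, partialDeriv k f * polar 𝕜 (m + 1) (PowerSeries.coeff m (γ k i)) A := by
  simp [gammaMultilin, Finset.smul_sum]

/-- The multilinear maps `Nₘ` with `δ^θ_f A = ∑ₘ tᵐ/m! Nₘ(f)(A, …, A)`. -/
def gaugeMultilin (θ : Matrix (Fin d) (Fin d) (SmoothFunction 𝕜 U))
    (γ : Matrix (Fin d) (Fin d) (FormalFunction 𝕜 U)) (m : ℕ) :
    SmoothFunction 𝕜 U →ₗ[𝕜] MultilinearMap 𝕜 (fun _ : Fin m => OneForm 𝕜 U) (OneForm 𝕜 U) :=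
  gammaMultilin γ m + formMultilin θ m

theorem gaugeMultilin_apply (θ : Matrix (Fin d) (Fin d) (SmoothFunction 𝕜 U))
    (γ : Matrix (Fin d) (Fin d) (FormalFunction 𝕜 U)) (m : ℕ) (f : SmoothFunction 𝕜 U)
    (A : Fin m → OneForm 𝕜 U) :
    gaugeMultilin θ γ m f A = gammaMultilin γ m f A + formMultilin θ m f A := rfl

theorem gaugeMultilin_comp_perm (θ : Matrix (Fin d) (Fin d) (SmoothFunction 𝕜 U))
    (γ : Matrix (Fin d) (Fin d) (FormalFunction 𝕜 U)) (m : ℕ) (f : SmoothFunction 𝕜 U)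
    (σ : Equiv.Perm (Fin m)) (A : Fin m → OneForm 𝕜 U) :
    gaugeMultilin θ γ m f (A ∘ σ) = gaugeMultilin θ γ m f A := by
  rcases m with _ | _ | m
  · rw [Subsingleton.elim (A ∘ σ) A]
  · rw [show A ∘ σ = A from funext fun i => congrArg A (Fin.ext (by omega))]
  · rw [gaugeMultilin_apply, gaugeMultilin_apply, formMultilin_add_two]
    refine congrArg₂ (· + ·) ?_ rfl
    ext1 i
    simp only [gammaMultilin_succ, polar_comp_perm]

theorem formMultilin_succ (θ : Matrix (Fin d) (Fin d) (SmoothFunction 𝕜 U)) (m : ℕ)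
    (f : SmoothFunction 𝕜 U) (A : Fin (m + 1) → OneForm 𝕜 U) :
    formMultilin θ (m + 1) f A = if m = 0 then formBracket θ (A 0) f else 0 := by
  cases m <;> rfl

/-- The factor `1/(m + 1)` of `polar_cons` reduces `(m + 1)!` to `m!`; the bracket with `θ` enters
only in the linear coefficient. -/
theorem gaugeMultilin_consConst (θ : Matrix (Fin d) (Fin d) (SmoothFunction 𝕜 U))
    (γ : Matrix (Fin d) (Fin d) (FormalFunction 𝕜 U)) (m : ℕ) (g : SmoothFunction 𝕜 U)
    (A B : OneForm 𝕜 U) (i : Fin d) (hγ : ∀ i j n, (PowerSeries.coeff n (γ i j)).IsHomogeneous (n + 1)) :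
    gaugeMultilin θ γ (m + 1) g (consConst _ B A) i
      = (m.factorial : 𝕜) • ((∑ k, partialDeriv k g * ∑ j, B j *
          MvPolynomial.eval A (MvPolynomial.pderiv j (PowerSeries.coeff m (γ k i))))
        - if m = 0 then poissonBracket θ g (B i) else 0) := by
  have h1 : consConst (m + 1) B A = Fin.cons B fun _ => A := by
    ext1 i
    refine Fin.cases rfl (fun _ => rfl) i
  have h2 : ((m + 1).factorial : 𝕜) * ((m + 1 : ℕ) : 𝕜)⁻¹ = m.factorial := by
    rw [Nat.factorial_succ, Nat.cast_mul, mul_comm, inv_mul_cancel_left₀]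
    exact_mod_cast m.succ_ne_zero
  have h3 : ∀ k j, polar 𝕜 m (MvPolynomial.pderiv j (PowerSeries.coeff m (γ k i))) (fun _ => A)
      = MvPolynomial.eval A (MvPolynomial.pderiv j (PowerSeries.coeff m (γ k i))) :=
    fun k j => polar_diagonal _ (by simpa using (hγ k i m).pderiv) A
  rw [gaugeMultilin_apply, Pi.add_apply, gammaMultilin_succ, h1, formMultilin_succ, smul_sub,
    sub_eq_add_neg]
  refine congrArg₂ (· + ·) ?_ ?_
  · simp_rw [polar_cons, h3, mul_smul_comm, ← Finset.smul_sum, smul_smul, h2]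
  · split_ifs with h
    · subst h
      simp [formBracket_apply]
    · simp

variable {θ : Matrix (Fin d) (Fin d) (SmoothFunction 𝕜 U)} {ω : FormalTensor 𝕜 U}
  {γ : Matrix (Fin d) (Fin d) (FormalFunction 𝕜 U)}

/-- The diagonal values of the multilinear maps are the coefficients of the gauge variation. -/
theorem gaugeMultilin_diagonal (hω : IsLocalSymplecticEmbedding θ ω γ) (n : ℕ)
    (f : SmoothFunction 𝕜 U) (A : OneForm 𝕜 U) (i : Fin d) :
    gaugeMultilin θ γ n f (fun _ => A) i
      = (n.factorial : 𝕜) • PowerSeries.coeff n (poissonGaugeVariation ω f A i) := by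
  have h0 : poissonGaugeVariation ω f A i = PowerSeries.C (partialDeriv i f)
      + PowerSeries.X * (∑ k, PowerSeries.C (partialDeriv k f) * sectionPullback A (γ k i)
        - PowerSeries.C (poissonBracket θ f (A i))) := by
    have h1 : PowerSeries.C (poissonBracket θ f (A i)) = ∑ k, PowerSeries.C (partialDeriv k f) *
        ∑ l, PowerSeries.C (θ k l) * PowerSeries.C (partialDeriv l (A i)) := by
      simp only [poissonBracket, map_sum, map_mul, Finset.mul_sum]
      exact Finset.sum_congr rfl fun _ _ => Finset.sum_congr rfl fun _ _ => by ring
    have h2 : ∀ k, PowerSeries.C (partialDeriv k f) *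
        (sectionPullback A (if k = i then (1 : FormalFunction 𝕜 U) else 0))
        = if k = i then PowerSeries.C (partialDeriv i f) else 0 := by
      intro k
      split_ifs with h
      · rw [map_one, mul_one, h]
      · rw [map_zero, mul_zero]
    rw [poissonGaugeVariation_eq hω, h1]
    simp only [hω.base_fibre, map_add, map_mul, sectionPullback_X, mul_add, h2, mul_neg,
      Finset.sum_add_distrib, Finset.sum_neg_distrib, Finset.sum_ite_eq', Finset.mem_univ, if_true,
      mul_sub, Finset.mul_sum]
    rw [neg_add_eq_sub, add_sub_assoc]
    refine congrArg₂ (· + ·) rfl (congrArg₂ (· - ·) ?_ ?_)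
    · exact Finset.sum_congr rfl fun _ _ => by ring
    · exact Finset.sum_congr rfl fun _ _ => Finset.sum_congr rfl fun _ _ => by ring
  rw [h0, gaugeMultilin_apply, Pi.add_apply]
  cases n with
  | zero =>
    rw [gammaMultilin_zero, map_add, PowerSeries.coeff_zero_C, PowerSeries.coeff_zero_X_mul]
    simp [dForm, formMultilin]
  | succ m =>
    rw [gammaMultilin_succ, formMultilin_succ, map_add, PowerSeries.coeff_succ_X_mul,
      PowerSeries.coeff_C, if_neg m.succ_ne_zero, zero_add, map_sub, map_sum, PowerSeries.coeff_C,
      smul_sub, sub_eq_add_neg]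
    refine congrArg₂ (· + ·) ?_ ?_
    · refine congrArg _ (Finset.sum_congr rfl fun k _ => ?_)
      rw [polar_diagonal _ (hω.homogeneous k i m), PowerSeries.coeff_C_mul, sectionPullback,
        PowerSeries.coeff_map]
    · split_ifs with h
      · subst h
        simp [formBracket_apply]
      · simp

theorem coeff_sum_bracket_seriesDeriv (f : SmoothFunction 𝕜 U)
    (F : PowerSeries (SmoothFunction 𝕜 U)) (n : ℕ) :
    PowerSeries.coeff n (∑ k, ∑ l, PowerSeries.C (θ k l) * PowerSeries.C (partialDeriv k f)
      * seriesDeriv l F) = poissonBracket θ f (PowerSeries.coeff n F) := by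
  simp only [map_sum, ← map_mul, PowerSeries.coeff_C_mul, seriesDeriv, PowerSeries.coeff_mk,
    poissonBracket]

/-- The Cauchy product sorts the fibre derivative terms by the order `r` of the inner variation,
matching the summation index in `Closes`. -/
theorem coeff_sum_mul_fibreDeriv (g : SmoothFunction 𝕜 U) (A : OneForm 𝕜 U) (i : Fin d)
    (V : Fin d → PowerSeries (SmoothFunction 𝕜 U)) (n : ℕ) :
    PowerSeries.coeff n (∑ j, V j * ∑ k, PowerSeries.C (partialDeriv k g)
          * sectionPullback A (coordDerivation (Sum.inr j) (γ k i)))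
      = ∑ r ∈ Finset.range (n + 1), ∑ k, partialDeriv k g * ∑ j, PowerSeries.coeff r (V j) *
          MvPolynomial.eval A (MvPolynomial.pderiv j (PowerSeries.coeff (n - r) (γ k i))) := by
  simp only [map_sum, PowerSeries.coeff_mul _ (V _),
    Finset.Nat.sum_antidiagonal_eq_sum_range_succ_mk, PowerSeries.coeff_C_mul, sectionPullback,
    PowerSeries.coeff_map, coordDerivation_apply, coeff_coordDeriv, polDerivation_inr]
  rw [Finset.sum_comm]
  refine Finset.sum_congr rfl fun r _ => ?_
  simp only [Finset.mul_sum]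
  rw [Finset.sum_comm]
  exact Finset.sum_congr rfl fun _ _ => Finset.sum_congr rfl fun _ _ => by ring

/-- This is the coefficient of `tⁿ` in `gaugeVariation_commutator`. The terms with `θ`-derivatives
arise from the index `r = n`, where the outer coefficient is the linear one. -/
theorem closes_gaugeMultilin (hω : IsLocalSymplecticEmbedding θ ω γ) :
    Closes (gaugeMultilin θ γ) (poissonBilin θ) := by
  intro n f g A
  ext1 i
  have h1 : ∀ (f g : SmoothFunction 𝕜 U) (r : ℕ), r ∈ Finset.range (n + 1) →
      ((r.factorial : 𝕜) * ((n - r).factorial : 𝕜))⁻¹ •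
        gaugeMultilin θ γ (n - r + 1) g (consConst _ (gaugeMultilin θ γ r f fun _ => A) A) i
      = (∑ k, partialDeriv k g * ∑ j, PowerSeries.coeff r (poissonGaugeVariation ω f A j) *
          MvPolynomial.eval A (MvPolynomial.pderiv j (PowerSeries.coeff (n - r) (γ k i))))
        - if r = n then poissonBracket θ g (PowerSeries.coeff n (poissonGaugeVariation ω f A i))
          else 0 := by
    intro f g r hr
    have h2 : (gaugeMultilin θ γ r f fun _ => A) = (r.factorial : 𝕜) •
        fun j => PowerSeries.coeff r (poissonGaugeVariation ω f A j) := by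
      ext1 j
      rw [gaugeMultilin_diagonal hω]
      rfl
    have h3 : (r.factorial : 𝕜) ≠ 0 := Nat.cast_ne_zero.mpr r.factorial_ne_zero
    have h4 : ((n - r).factorial : 𝕜) ≠ 0 := Nat.cast_ne_zero.mpr (n - r).factorial_ne_zero
    rw [h2, map_consConst_smul (Nat.succ_pos _), Pi.smul_apply,
      gaugeMultilin_consConst _ _ _ _ _ _ _ hω.homogeneous, smul_smul, smul_smul,
      mul_assoc, inv_mul_cancel₀ (mul_ne_zero h3 h4), one_smul]
    refine congrArg₂ (· - ·) rfl ?_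
    have h5 : n - r = 0 ↔ r = n := by
      have := Finset.mem_range.mp hr
      omega
    split_ifs with h6 h7 h7
    · rw [h7]
    · exact absurd (h5.mp h6) h7
    · exact absurd (h5.mpr h7) h6
    · rfl
  have h2 := congrArg (PowerSeries.coeff n) (gaugeVariation_commutator hω f g A i)
  rw [map_sub, map_add, map_add, coeff_sum_bracket_seriesDeriv, coeff_sum_bracket_seriesDeriv,
    coeff_sum_mul_fibreDeriv, coeff_sum_mul_fibreDeriv] at h2
  rw [Pi.smul_apply, poissonBilin_apply, gaugeMultilin_diagonal hω, smul_smul,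
    inv_mul_cancel₀ (Nat.cast_ne_zero.mpr n.factorial_ne_zero), one_smul, ← h2, Finset.sum_apply]
  simp only [Pi.smul_apply, Pi.sub_apply, smul_sub]
  rw [Finset.sum_sub_distrib, Finset.sum_congr rfl (h1 f g), Finset.sum_congr rfl (h1 g f),
    Finset.sum_sub_distrib, Finset.sum_sub_distrib, Finset.sum_ite_eq', Finset.sum_ite_eq',
    if_pos (Finset.mem_range.mpr n.lt_succ_self), if_pos (Finset.mem_range.mpr n.lt_succ_self)]
  abel

end PoissonGauge
end

noncomputable section

namespace PoissonGauge

open TwoTerm HomogeneousPolar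

variable {d : ℕ} {𝕜 : Type*} [RCLike 𝕜] {U : TopologicalSpace.Opens (Fin d → ℝ)}

variable {θ : Matrix (Fin d) (Fin d) (SmoothFunction 𝕜 U)} {ω : FormalTensor 𝕜 U}
  {γ : Matrix (Fin d) (Fin d) (FormalFunction 𝕜 U)}

/-! ### The L-infinity structure of the Poisson gauge algebroid -/

/-- The L-infinity structure inducing the Poisson gauge algebroid. -/
def gaugeStructure (hθ : IsPoisson θ) (hω : IsLocalSymplecticEmbedding θ ω γ) :
    LInftyStructure (formGrading 𝕜 U) :=
  -- `formGrading` and `TwoTerm.grading` have the same body, so the abstract construction applies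
  -- definitionally.
  lInftyStructure (gaugeMultilin_comp_perm θ γ) hθ.bracket_skew hθ.jacobi
    (closes_gaugeMultilin hω)

variable (hθ : IsPoisson θ) (hω : IsLocalSymplecticEmbedding θ ω γ)

theorem gaugeStructure_bracket (n : ℕ) : (gaugeStructure hθ hω).bracket n
    = bracket (gaugeMultilin θ γ) (poissonBilin θ) n := rfl

theorem bracketOne_gaugeStructure (n : ℕ) (f : SmoothFunction 𝕜 U) (A : OneForm 𝕜 U) :
    bracketOne (gaugeStructure hθ hω) n f A
      = (0, triangleSign 𝕜 n • gaugeMultilin θ γ n f fun _ => A) := by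
  have h : ∀ i : Fin (n + 1), i ≠ 0 →
      ((Fin.cons (f, 0) fun _ => (0, A) : Fin (n + 1) → GaugeSpace 𝕜 U) i).1 = 0 := by
    refine Fin.cases (fun h => absurd rfl h) fun i _ => rfl
  rw [bracketOne, gaugeStructure_bracket]
  refine Prod.ext (bracket_fst_of_fst_eq_zero _ _ _ 0 h) ?_
  rw [bracket_snd_of_fst_eq_zero _ _ _ 0 h]
  simp only [Fin.val_zero, pow_zero, one_mul, Fin.cons_zero, Fin.succAbove_zero, Fin.cons_succ]

theorem bracketTwo_gaugeStructure (n : ℕ) (f g : SmoothFunction 𝕜 U) (A : OneForm 𝕜 U) :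
    bracketTwo (gaugeStructure hθ hω) n f g A
      = (if n = 0 then -poissonBracket θ f g else 0, 0) := by
  rw [bracketTwo, gaugeStructure_bracket]
  refine Prod.ext ?_ (bracket_snd_eq_zero _ _ _ (i := 0) (j := 1) (Fin.ne_of_val_ne (by simp)) rfl rfl)
  rw [bracket_fst]
  split_ifs with h
  · subst h
    rfl
  · rw [negBilin_of_ne_two _ (by omega)]
    rfl

theorem gaugeMultilin_diagonal_gammaTensor (hω : IsLocalSymplecticEmbedding θ ω γ) (n : ℕ)
    (f : SmoothFunction 𝕜 U) (A : OneForm 𝕜 U) :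
    gaugeMultilin θ γ (n + 1) f (fun _ => A)
      = gammaTensor γ (n + 1) (dForm f) A + if n = 0 then formBracket θ A f else 0 := by
  rw [gaugeMultilin_apply, formMultilin_succ]
  refine congrArg₂ (· + ·) ?_ rfl
  ext1 i
  rw [gammaMultilin_succ]
  simp only [polar_diagonal _ (hω.homogeneous _ _ _)]
  rfl

theorem induces_gaugeStructure :
    InducesPoissonGaugeAlgebroid θ ω (gaugeStructure hθ hω) := by
  constructor
  · intro f A
    ext1 i
    ext1 n
    rw [gaugeVariation, PowerSeries.coeff_mk, bracketOne_gaugeStructure]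
    rw [show (((0 : SmoothFunction 𝕜 U), triangleSign 𝕜 n • gaugeMultilin θ γ n f fun _ => A) :
      GaugeSpace 𝕜 U).2 i = triangleSign 𝕜 n • gaugeMultilin θ γ n f (fun _ => A) i from rfl,
      gaugeMultilin_diagonal hω, smul_smul, smul_smul]
    have h1 : (-1 : 𝕜) ^ (n * (n - 1) / 2) / (n.factorial : 𝕜) * triangleSign 𝕜 n * n.factorial = 1 := by
      have h2 := triangleSign_mul_self (𝕜 := 𝕜) n
      rw [triangleSign] at h2 ⊢
      have h3 : (n.factorial : 𝕜) ≠ 0 := Nat.cast_ne_zero.mpr n.factorial_ne_zero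
      field_simp
      rw [sq, h2]
    rw [h1, one_smul]
  · intro f g A
    ext1 n
    rw [closureBracket, map_neg, PowerSeries.coeff_mk, bracketTwo_gaugeStructure, PowerSeries.coeff_C]
    split_ifs with h
    · subst h
      simp
    · simp

/-- The brackets of an L-infinity structure inducing the Poisson gauge algebroid are determined
on the arguments `f, A, …, A`. -/
theorem bracketOne_eq_of_induces {L L' : LInftyStructure (formGrading 𝕜 U)}
    (h : InducesPoissonGaugeAlgebroid θ ω L) (h' : InducesPoissonGaugeAlgebroid θ ω L') (n : ℕ)
    (f : SmoothFunction 𝕜 U) (A : OneForm 𝕜 U) : bracketOne L n f A = bracketOne L' n f A := by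
  -- The gauge variation records only the one-form component; the function component vanishes
  -- because the bracket has total degree `1`.
  have hdeg : ∀ L : LInftyStructure (formGrading 𝕜 U), (bracketOne L n f A).1 = 0 := by
    intro L
    have h1 := L.degree (n + 1) (Fin.cons 0 fun _ => 1) (Fin.cons (f, 0) fun _ => (0, A))
      (Fin.cases ((mem_grading (𝕜 := 𝕜)).mpr ⟨fun h => absurd rfl h, fun _ => rfl⟩)
        fun i => (mem_grading (𝕜 := 𝕜)).mpr ⟨fun _ => rfl, fun h => absurd rfl h⟩)
    refine ((mem_grading (𝕜 := 𝕜)).mp h1).1 ?_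
    rw [Fin.sum_univ_succ]
    simp
    omega
  have hc : (-1 : 𝕜) ^ (n * (n - 1) / 2) / (n.factorial : 𝕜) ≠ 0 :=
    div_ne_zero (pow_ne_zero _ (neg_ne_zero.mpr one_ne_zero))
      (Nat.cast_ne_zero.mpr n.factorial_ne_zero)
  refine Prod.ext ((hdeg L).trans (hdeg L').symm) ?_
  ext1 i
  have h2 := congrArg (PowerSeries.coeff n) (congrFun ((h.1 f A).trans (h'.1 f A).symm) i)
  rw [gaugeVariation, gaugeVariation, PowerSeries.coeff_mk, PowerSeries.coeff_mk] at h2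
  have h3 := congrArg (fun x => ((-1 : 𝕜) ^ (n * (n - 1) / 2) / (n.factorial : 𝕜))⁻¹ • x) h2
  simpa only [smul_smul, inv_mul_cancel₀ hc, one_smul] using h3

/-- The brackets of an L-infinity structure inducing the Poisson gauge algebroid are determined
on the arguments `f, g, A, …, A`. -/
theorem bracketTwo_eq_of_induces {L L' : LInftyStructure (formGrading 𝕜 U)}
    (h : InducesPoissonGaugeAlgebroid θ ω L) (h' : InducesPoissonGaugeAlgebroid θ ω L') (n : ℕ)
    (f g : SmoothFunction 𝕜 U) (A : OneForm 𝕜 U) : bracketTwo L n f g A = bracketTwo L' n f g A := by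
  have hdeg : ∀ L : LInftyStructure (formGrading 𝕜 U), (bracketTwo L n f g A).2 = 0 := by
    intro L
    have h1 := L.degree (n + 2) (Fin.cons 0 (Fin.cons 0 fun _ => 1))
      (Fin.cons (f, 0) (Fin.cons (g, 0) fun _ => (0, A)))
      (Fin.cases ((mem_grading (𝕜 := 𝕜)).mpr ⟨fun h => absurd rfl h, fun _ => rfl⟩)
        (Fin.cases ((mem_grading (𝕜 := 𝕜)).mpr ⟨fun h => absurd rfl h, fun _ => rfl⟩)
        fun i => (mem_grading (𝕜 := 𝕜)).mpr ⟨fun _ => rfl, fun h => absurd rfl h⟩))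
    refine ((mem_grading (𝕜 := 𝕜)).mp h1).2 ?_
    rw [Fin.sum_univ_succ, Fin.sum_univ_succ]
    simp
  have hc : (-1 : 𝕜) ^ (n * (n - 1) / 2) / (n.factorial : 𝕜) ≠ 0 :=
    div_ne_zero (pow_ne_zero _ (neg_ne_zero.mpr one_ne_zero))
      (Nat.cast_ne_zero.mpr n.factorial_ne_zero)
  refine Prod.ext ?_ ((hdeg L).trans (hdeg L').symm)
  have h2 := congrArg (PowerSeries.coeff n) ((h.2 f g A).trans (h'.2 f g A).symm)
  rw [closureBracket, closureBracket, map_neg, map_neg, neg_inj, PowerSeries.coeff_mk,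
    PowerSeries.coeff_mk] at h2
  have h3 := congrArg (fun x => ((-1 : 𝕜) ^ (n * (n - 1) / 2) / (n.factorial : 𝕜))⁻¹ • x) h2
  simpa only [smul_smul, inv_mul_cancel₀ hc, one_smul] using h3

/-- Any two L-infinity structures inducing the Poisson gauge algebroid are quasi-isomorphic. -/
theorem exists_isQuasiIso_of_induces {L L' : LInftyStructure (formGrading 𝕜 U)}
    (h : InducesPoissonGaugeAlgebroid θ ω L) (h' : InducesPoissonGaugeAlgebroid θ ω L') :
    ∃ φ : LInftyMorphism L L', φ.IsQuasiIso :=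
  LInfty.exists_isQuasiIso_of_bracket_eq L L' (TwoTerm.bracket_eq_of_diagonals L L'
    (bracketOne_eq_of_induces h h') (bracketTwo_eq_of_induces h h'))

end PoissonGauge
end

open PoissonGauge in
theorem proposition5p3 {𝕜 : Type*} [RCLike 𝕜] {d : ℕ}
    (U : TopologicalSpace.Opens (Fin d → ℝ))
    (θ : Matrix (Fin d) (Fin d) (SmoothFunction 𝕜 U)) (hθ : IsPoisson θ)
    (ω : FormalTensor 𝕜 U) (γ : Matrix (Fin d) (Fin d) (FormalFunction 𝕜 U))
    (hω : IsLocalSymplecticEmbedding θ ω γ) :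
    ∃ L : LInftyStructure (formGrading 𝕜 U),
      InducesPoissonGaugeAlgebroid θ ω L ∧
      (∀ f : SmoothFunction 𝕜 U, L.bracket 1 ![(f, 0)] = (0, dForm f)) ∧
      (∀ f g : SmoothFunction 𝕜 U,
        L.bracket 2 ![(f, 0), (g, 0)] = (-poissonBracket θ f g, 0)) ∧
      (∀ (f : SmoothFunction 𝕜 U) (A : OneForm 𝕜 U),
        L.bracket 2 ![(f, 0), (0, A)] = (0, formBracket θ A f + gammaTensor γ 1 (dForm f) A)) ∧
      (∀ n : ℕ, 2 ≤ n → ∀ (f : SmoothFunction 𝕜 U) (A : OneForm 𝕜 U),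
        bracketOne L n f A
          = (0, (-1 : 𝕜) ^ (n * (n - 1) / 2) • gammaTensor γ n (dForm f) A)) ∧
      (∀ n : ℕ, 1 ≤ n → ∀ (f g : SmoothFunction 𝕜 U) (A : OneForm 𝕜 U),
        bracketTwo L n f g A = 0) ∧
      (∀ L' : LInftyStructure (formGrading 𝕜 U), InducesPoissonGaugeAlgebroid θ ω L' →
        ∃ φ : LInftyMorphism L' L, φ.IsQuasiIso) := by
  refine ⟨gaugeStructure hθ hω, induces_gaugeStructure hθ hω, ?_, ?_, ?_, ?_, ?_,
    fun L' h' => exists_isQuasiIso_of_induces h' (induces_gaugeStructure hθ hω)⟩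
  · intro f
    -- There are no one-form slots when `n = 0`, so the value `0` for `A` is immaterial.
    have h1 := bracketOne_gaugeStructure hθ hω 0 f 0
    have h2 : (Fin.cons (f, 0) fun _ => (0, 0) : Fin 1 → GaugeSpace 𝕜 U) = ![(f, 0)] := by
      ext1 i
      fin_cases i
      rfl
    rw [bracketOne, h2, gaugeMultilin_apply, gammaMultilin_zero] at h1
    rw [h1]
    simp [TwoTerm.triangleSign, formMultilin]
  · intro f g
    have h1 := bracketTwo_gaugeStructure hθ hω 0 f g 0
    have h2 : (Fin.cons (f, 0) (Fin.cons (g, 0) fun _ => (0, 0)) : Fin 2 → GaugeSpace 𝕜 U)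
        = ![(f, 0), (g, 0)] := by
      ext1 i
      fin_cases i <;> rfl
    rwa [bracketTwo, h2, if_pos rfl] at h1
  · intro f A
    have h1 := bracketOne_gaugeStructure hθ hω 1 f A
    have h2 : (Fin.cons (f, 0) fun _ => (0, A) : Fin 2 → GaugeSpace 𝕜 U) = ![(f, 0), (0, A)] := by
      ext1 i
      fin_cases i <;> rfl
    rw [bracketOne, h2, gaugeMultilin_diagonal_gammaTensor hω, if_pos rfl,
      add_comm (gammaTensor _ _ _ _)] at h1
    rw [h1]
    simp [TwoTerm.triangleSign]
  · intro n hn f A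
    obtain ⟨m, rfl⟩ : ∃ m, n = m + 1 := ⟨n - 1, by omega⟩
    rw [bracketOne_gaugeStructure, gaugeMultilin_diagonal_gammaTensor hω, if_neg (by omega),
      add_zero]
    rfl
  · intro n hn f g A
    rw [bracketTwo_gaugeStructure, if_neg (by omega)]
    rfl
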